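/- Let $n\ge 1$ and $\kappa>1$, let $k>n/2$ be an integer and, if $\kappa$ is not an odd integer, assume $\kappa\ge k+2$. Let $0<s<s_c:=\frac n2-\frac4{\kappa-1}$. Consider the defocusing nonlinear beam equation $$\partial_t^2u+\Delta^2u=-|u|^{\kappa-1}u\qquad\text{on }\mathbb R^n .$$ By a solution on $[0,T]$ we mean $u$ with $(u,u_t)\in C([0,T];H^{k+2}(\mathbb R^n)\times H^{k}(\mathbb R^n))$ that satisfies the equation at every time in the sense of distributions on $\mathbb R^n$. Here $\|f\|_{H^\sigma}=\|(1-\Delta)^{\sigma/2}f\|_{L^2}$. (1) For every $\varepsilon>0$ there are a time $t$ with $0<t<\varepsilon$ and a real-valued solution $u$ on $[0,t]$ such that $u(0)$ is a Schwartz function, $u_t(0)=0$, $$\|u(0)\|_{H^s}<\varepsilon\qquad\text{and}\qquad \|u(t)\|_{H^s}>\varepsilon^{-1}.$$ (2) For every $t>0$ the solution map $\mathcal S\times\mathcal S\ni(u(0),u_t(0))\mapsto(u(t),u_t(t))$ fails to be (defined near $0$ and) continuous at $0$ in the $H^s\times H^{s-2}$ topology. That is, the following is false: for every $\eta>0$ there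 is $\delta>0$ such that for all $f,g\in\mathcal S(\mathbb R^n)$ with $\|f\|_{H^s}<\delta$ and $\|g\|_{H^{s-2}}<\delta$ there is a solution $u$ on $[0,t]$ with $u(0)=f$, $u_t(0)=g$, $\|u(t)\|_{H^s}<\eta$ and $\|u_t(t)\|_{H^{s-2}}<\eta$. -/

import Mathlib

open MeasureTheory Filter Topology
open scoped ENNReal FourierTransform SchwartzMap Laplacian

noncomputable section

namespace NonlinearBeam

/-- Euclidean space `ℝⁿ`. -/
abbrev Space (n : ℕ) : Type := EuclideanSpace ℝ (Fin n)

/-- The complex Hilbert space `L²(ℝⁿ)`. -/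
abbrev L2 (n : ℕ) : Type := Lp ℂ 2 (volume : Measure (Space n))

/-- The inhomogeneous Sobolev norm `‖f‖_{H^σ} = ‖⟨D⟩^σ f‖_{L²}` of `f ∈ L²(ℝⁿ)`, with values in
`[0, ∞]`; it is finite exactly when `f ∈ H^σ`. Mathlib's Fourier transform has the kernel
`exp (-2πi ⟨x, ξ⟩)`, so that the symbol of `⟨D⟩ = (1 - Δ)^{1/2}` is `(1 + (2π‖ξ‖)²)^{1/2}`. -/
def sobolevNorm {n : ℕ} (σ : ℝ) (f : L2 n) : ℝ≥0∞ :=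
  (∫⁻ ξ, ENNReal.ofReal ((1 + (2 * Real.pi * ‖ξ‖) ^ 2) ^ σ) *
    ‖((𝓕 f : L2 n) : Space n → ℂ) ξ‖ₑ ^ 2) ^ (1 / 2 : ℝ)

/-- `u ∈ C([0,T]; H^σ(ℝⁿ))`. -/
def ContinuousInSobolev {n : ℕ} (σ T : ℝ) (u : ℝ → L2 n) : Prop :=
  (∀ t ∈ Set.Icc 0 T, sobolevNorm σ (u t) < ∞) ∧
  ∀ t ∈ Set.Icc 0 T,
    Tendsto (fun r => sobolevNorm σ (u r - u t)) (𝓝[Set.Icc 0 T] t) (𝓝 0)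

/-- The power nonlinearity `|z|^{κ-1} z`. -/
def nonlinearity (κ : ℝ) (z : ℂ) : ℂ := ((‖z‖ ^ (κ - 1) : ℝ) : ℂ) * z

/-- `u`, with time derivative `v`, is a solution on the time interval `[0,T]` of the nonlinear beam
equation `∂ₜ²u + Δ²u = ω |u|^{κ-1} u` on `ℝⁿ`, of class `(u, ∂ₜu) ∈ C([0,T]; H^σ × H^{σ-2})`.
The equation holds at every time in the sense of distributions on `ℝⁿ`. (Used with `σ ≥ 2` and
`σ > n/2`, when `∂ₜu(t)` is in `L²` and `u(t)` is bounded.) -/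
structure IsSolution {n : ℕ} (ω κ σ T : ℝ) (u v : ℝ → L2 n) : Prop where
  continuous_fst : ContinuousInSobolev σ T u
  continuous_snd : ContinuousInSobolev (σ - 2) T v
  deriv_eq : ∀ t ∈ Set.Icc 0 T, HasDerivWithinAt u (v t) (Set.Icc 0 T) t
  equation : ∀ φ : 𝓢(Space n, ℂ), ∀ t ∈ Set.Icc 0 T,
    HasDerivWithinAt (fun r => ∫ x, v r x * φ x)
      (-(∫ x, u t x * (Δ (Δ φ) : 𝓢(Space n, ℂ)) x) +
        (ω : ℂ) * ∫ x, nonlinearity κ (u t x) * φ x)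
      (Set.Icc 0 T) t

/-- The solution map `(u(0), ∂ₜu(0)) ↦ (u(t), ∂ₜu(t))` at time `t`, on Schwartz data, is defined near
`0` and continuous at `0` in the topology of `H^s × H^{s-2}`: for every `η > 0`, all Schwartz data
that are small enough in `H^s × H^{s-2}` have a solution on `[0,t]` (in the class
`C([0,t]; H^σ × H^{σ-2})`) whose value at time `t` is smaller than `η` in `H^s × H^{s-2}`. -/
def SolutionMapContinuousAtZero (n : ℕ) (ω κ σ s t : ℝ) : Prop :=
  ∀ η : ℝ, 0 < η → ∃ δ : ℝ, 0 < δ ∧ ∀ f g : 𝓢(Space n, ℂ),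
    sobolevNorm s (f.toLp 2) < ENNReal.ofReal δ →
    sobolevNorm (s - 2) (g.toLp 2) < ENNReal.ofReal δ →
    ∃ u v : ℝ → L2 n, IsSolution ω κ σ t u v ∧ u 0 = f.toLp 2 ∧ v 0 = g.toLp 2 ∧
      sobolevNorm s (u t) < ENNReal.ofReal η ∧ sobolevNorm (s - 2) (v t) < ENNReal.ofReal η

end NonlinearBeam

end

/-!
Norm inflation for `∂ₜ²u + Δ²u = -|u|^{κ-1} u` below the critical exponent, by comparison with the
equation in which the dispersion is dropped.

For a coefficient `c`, consider `∂ₜ²u + c²Δ²u = -|u|^{κ-1} u`. With `a^{κ-1} τ² = 1`, the function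
`a u(t/τ, bx)` solves the beam equation (`c = 1`) if `u` solves the equation with `c = τ b²`. For
`c = 0` the equation is an ordinary differential equation at every point `x`. Its solution with
data `(f, 0)`, `f ≥ 0`, is `f(x) G(t η(x))` with `η = f^{(κ-1)/2}`, where `G` solves
`G'' = -|G|^{κ-1} G`, `G(0) = 1`, `G'(0) = 0`. As time grows, different points oscillate with
different phases, the solution moves to frequencies of order `t`, and its homogeneous Sobolev norm
of order `s > 0` becomes as large as desired, while its `L²` norm stays bounded. This is proved by
testing with `(∂ᵢη)² |G|^{κ-1} G(tη)`, which is `t⁻¹` times a derivative of a bounded function up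
to `O(t⁻¹)`, so that it has little mass at bounded frequencies (`enorm_inner_le_homNorm`), whereas
the pairing `∫ f (∂ᵢη)² |G(tη)|^{κ+1}` stays bounded below, by conservation of energy
(`IsOscillator.exists_le_integral`, `IsProfile.exists_lt_homNorm`). Powers of
`exp(-1/(1-‖x‖²))` make both `f` and `η` smooth and compactly supported (`exists_isProfile`).

Growth persists for small `c > 0` because the solution depends continuously on `c` and on the data,
down to `c = 0`. The linear group is taken out: in the half-wave variables
`z± = e^{±itω} (ω u ± i ∂ₜu)`, `ω = √(1 + c²Δ²)`, the equation becomes a first order system in which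
only bounded operators occur (`beamField`), locally Lipschitz because composition with
`z ↦ |z|^{κ-1} z` is locally Lipschitz in `H^k` for `k > n/2` (`exists_compositionOperator`).
Picard–Lindelöf and Grönwall give existence, stability (`exists_solution_near`) and uniqueness.
For `c ≠ 0`, solutions of the system correspond to distributional solutions of the equation
(`IsMild.isCoeffSolution`, `IsCoeffSolution.exists_isMild`). Throughout, `H^k` is parametrized by
`L²` through `ψ ↦ ⟨D⟩^{-k} 𝓕⁻¹ ψ` (`ofWeighted`).

Scaling with `b → ∞` and data of size `a b^{s-n/2} = ε'` in `H^s` now gives inflation: since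
`s < n/2 - 4/(κ-1)`, both `τ` and `c = τ b²` tend to zero (`exists_scaling_parameters`,
`exists_norm_inflation`).

For the solution map, suppose it is continuous at zero at time `t`. A small datum `(f, 0)` whose
solution is large at a time `r < t` then has a solution on `[0, t]` that is small at time `t`.
Reversed in time, this solution leads from small data to a large value in time `t - r`; a rescaling
by a bounded factor turns this into time `t`. The new data are not Schwartz functions, but can be
replaced by Schwartz functions by density and continuous dependence, which contradicts continuity
at zero (`not_solutionMapContinuousAtZero`).
-/

noncomputable section

namespace NonlinearBeam

open scoped BoundedContinuousFunction NNReal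

variable {n : ℕ}

/-! ### Bounded multipliers on `L²` -/

lemma memLp_bcf_mul (m : Space n →ᵇ ℂ) (f : L2 n) :
    MemLp (fun ξ => m ξ * f ξ) 2 (volume : Measure (Space n)) := by
  refine (Lp.memLp f).of_le_mul (c := ‖m‖)
    (m.continuous.aestronglyMeasurable.mul (Lp.memLp f).1) (ae_of_all _ fun ξ => ?_)
  rw [norm_mul]
  exact mul_le_mul_of_nonneg_right (m.norm_coe_le_norm ξ) (norm_nonneg _)

/-- Multiplication by a bounded continuous function, as a bounded operator on `L²`. -/
def mulOp (m : Space n →ᵇ ℂ) : L2 n →L[ℂ] L2 n :=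
  LinearMap.mkContinuous
    { toFun := fun f => (memLp_bcf_mul m f).toLp
      map_add' := fun f g => by
        rw [← MemLp.toLp_add]
        refine MemLp.toLp_congr _ _ ?_
        filter_upwards [Lp.coeFn_add f g] with ξ h
        simp only [h, Pi.add_apply, mul_add]
      map_smul' := fun c f => by
        rw [RingHom.id_apply, ← MemLp.toLp_const_smul]
        refine MemLp.toLp_congr _ _ ?_
        filter_upwards [Lp.coeFn_smul c f] with ξ h
        simp [h, mul_left_comm] }
    ‖m‖ (fun f => by
      refine Lp.norm_le_mul_norm_of_ae_le_mul ?_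
      filter_upwards [(memLp_bcf_mul m f).coeFn_toLp] with ξ h
      simp only [LinearMap.coe_mk, AddHom.coe_mk]
      rw [h, norm_mul]
      exact mul_le_mul_of_nonneg_right (m.norm_coe_le_norm ξ) (norm_nonneg _))

lemma mulOp_coe (m : Space n →ᵇ ℂ) (f : L2 n) : mulOp m f =ᵐ[volume] fun ξ => m ξ * f ξ :=
  (memLp_bcf_mul m f).coeFn_toLp

lemma norm_mulOp_le (m : Space n →ᵇ ℂ) (f : L2 n) : ‖mulOp m f‖ ≤ ‖m‖ * ‖f‖ :=
  (LinearMap.mkContinuous_norm_le _ (norm_nonneg m) _ |> (mulOp m).le_of_opNorm_le) f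

lemma mulOp_eq_of_ae {m : Space n →ᵇ ℂ} {f g : L2 n}
    (h : ∀ᵐ ξ, m ξ * f ξ = g ξ) : mulOp m f = g := by
  refine Lp.ext ?_
  filter_upwards [mulOp_coe m f, h] with ξ h1 h2
  rw [h1, h2]

lemma mulOp_sub (m₁ m₂ : Space n →ᵇ ℂ) (f : L2 n) :
    mulOp (m₁ - m₂) f = mulOp m₁ f - mulOp m₂ f := by
  refine mulOp_eq_of_ae ?_
  filter_upwards [mulOp_coe m₁ f, mulOp_coe m₂ f, Lp.coeFn_sub (mulOp m₁ f) (mulOp m₂ f)]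
    with ξ h1 h2 h3
  simp only [h1, h2, h3, sub_mul, Pi.sub_apply, BoundedContinuousFunction.coe_sub]

lemma mulOp_smul (c : ℂ) (m : Space n →ᵇ ℂ) (f : L2 n) :
    mulOp (c • m) f = c • mulOp m f := by
  refine mulOp_eq_of_ae ?_
  filter_upwards [mulOp_coe m f, Lp.coeFn_smul c (mulOp m f)] with ξ h1 h3
  simp [h1, h3, mul_assoc]

lemma mulOp_mulOp (m₁ m₂ : Space n →ᵇ ℂ) (f : L2 n) :
    mulOp m₁ (mulOp m₂ f) = mulOp (m₁ * m₂) f := by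
  refine mulOp_eq_of_ae ?_
  filter_upwards [mulOp_coe m₂ f, mulOp_coe (m₁ * m₂) f] with ξ h1 h3
  simp [h1, h3, mul_assoc]

lemma mulOp_const (c : ℂ) (f : L2 n) {m : Space n →ᵇ ℂ} (hm : ∀ ξ, m ξ = c) :
    mulOp m f = c • f := by
  refine mulOp_eq_of_ae ?_
  filter_upwards [Lp.coeFn_smul c f] with ξ h
  simp [h, hm]

lemma mulOp_injective {m : Space n →ᵇ ℂ} (hm : ∀ ξ, m ξ ≠ 0) :
    Function.Injective (mulOp m) := by
  refine (injective_iff_map_eq_zero _).2 fun f hf => ?_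
  refine Lp.ext ?_
  have h := mulOp_coe m f
  rw [hf] at h
  filter_upwards [h, Lp.coeFn_zero ℂ 2 (volume : Measure (Space n))] with ξ h1 h2
  rw [h2] at h1 ⊢
  simpa [hm ξ] using h1.symm

/-- A multiplier from a continuous function with an explicit bound. -/
def bddMul (m : Space n → ℂ) (hc : Continuous m) (C : ℝ) (h : ∀ ξ, ‖m ξ‖ ≤ C) : Space n →ᵇ ℂ :=
  BoundedContinuousFunction.ofNormedAddCommGroup m hc C h

lemma enorm_L2_sq (f : L2 n) : ‖f‖ₑ ^ 2 = ∫⁻ ξ, ‖f ξ‖ₑ ^ 2 := by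
  rw [Lp.enorm_def, eLpNorm_eq_lintegral_rpow_enorm_toReal (by norm_num) (by norm_num)]
  simp only [ENNReal.toReal_ofNat, ENNReal.rpow_ofNat]
  rw [← ENNReal.rpow_natCast, ← ENNReal.rpow_mul]
  norm_num

/-- Strong continuity: uniformly bounded multipliers that converge pointwise converge strongly,
jointly with the argument. -/
lemma tendsto_mulOp {ι : Type*} {l : Filter ι} [l.IsCountablyGenerated]
    {m : ι → Space n →ᵇ ℂ} {m₀ : Space n →ᵇ ℂ} {C : ℝ} (hC : ∀ᶠ p in l, ‖m p‖ ≤ C)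
    (hm : ∀ ξ, Tendsto (fun p => m p ξ) l (𝓝 (m₀ ξ)))
    {f : ι → L2 n} {f₀ : L2 n} (hf : Tendsto f l (𝓝 f₀)) :
    Tendsto (fun p => mulOp (m p) (f p)) l (𝓝 (mulOp m₀ f₀)) := by
  have h1 : Tendsto (fun p => mulOp (m p) (f p - f₀)) l (𝓝 0) := by
    refine squeeze_zero_norm' (a := fun p => C * ‖f p - f₀‖) ?_ ?_
    · filter_upwards [hC] with p hp
      exact (norm_mulOp_le _ _).trans (mul_le_mul_of_nonneg_right hp (norm_nonneg _))
    · simpa using (tendsto_iff_norm_sub_tendsto_zero.1 hf).const_mul C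
  have h2 : Tendsto (fun p => mulOp (m p - m₀) f₀) l (𝓝 0) := by
    rw [tendsto_zero_iff_enorm_tendsto_zero]
    have hsq : Tendsto (fun p => ‖mulOp (m p - m₀) f₀‖ₑ ^ 2) l (𝓝 0) := by
      have hlim : Tendsto (fun p => ∫⁻ ξ, ‖(m p - m₀) ξ * f₀ ξ‖ₑ ^ 2) l
          (𝓝 (∫⁻ _ : Space n, 0)) := by
        refine tendsto_lintegral_filter_of_dominated_convergence
          (fun ξ => (ENNReal.ofReal (C + ‖m₀‖)) ^ 2 * ‖f₀ ξ‖ₑ ^ 2) ?_ ?_ ?_ ?_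
        · refine Eventually.of_forall fun p => ?_
          exact (((m p - m₀).continuous.measurable.mul
            (Lp.stronglyMeasurable f₀).measurable).enorm).pow_const 2
        · filter_upwards [hC] with p hp
          refine ae_of_all _ fun ξ => ?_
          rw [enorm_mul, mul_pow]
          gcongr
          rw [← ofReal_norm]
          refine ENNReal.ofReal_le_ofReal ?_
          calc ‖(m p - m₀) ξ‖ ≤ ‖m p - m₀‖ := (m p - m₀).norm_coe_le_norm ξ
            _ ≤ ‖m p‖ + ‖m₀‖ := norm_sub_le _ _
            _ ≤ C + ‖m₀‖ := by gcongr
        · rw [lintegral_const_mul' _ _ (by simp), ← enorm_L2_sq]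
          exact ENNReal.mul_ne_top (by simp) (by simp)
        · refine ae_of_all _ fun ξ => ?_
          have : Tendsto (fun p => (m p - m₀) ξ * f₀ ξ) l (𝓝 0) := by
            have := ((hm ξ).sub_const (m₀ ξ)).mul_const (f₀ ξ)
            simpa using this
          have := (ENNReal.continuous_pow 2).tendsto 0 |>.comp
            (tendsto_zero_iff_enorm_tendsto_zero.1 this)
          simpa [Function.comp_def] using this
      rw [lintegral_zero] at hlim
      refine hlim.congr fun p => ?_
      rw [enorm_L2_sq]
      refine lintegral_congr_ae ?_
      filter_upwards [mulOp_coe (m p - m₀) f₀] with ξ h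
      rw [h]
    have := ((ENNReal.continuous_rpow_const (y := (1 / 2 : ℝ))).tendsto 0).comp hsq
    rw [ENNReal.zero_rpow_of_pos (by norm_num)] at this
    refine this.congr fun p => ?_
    rw [Function.comp_apply, ← ENNReal.rpow_natCast, ← ENNReal.rpow_mul]
    norm_num
  have h3 := (h1.add h2).add_const (mulOp m₀ f₀)
  simp only [add_zero, zero_add] at h3
  refine h3.congr fun p => ?_
  rw [map_sub, mulOp_sub]
  abel

lemma real_smul_L2 (r : ℝ) (f : L2 n) : r • f = (r : ℂ) • f :=
  RCLike.real_smul_eq_coe_smul (K := ℂ) r f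

/-- Product rule for a strongly differentiable family of multipliers. -/
lemma hasDerivWithinAt_mulOp {m : ℝ → Space n →ᵇ ℂ} {m' : Space n →ᵇ ℂ} {B C : ℝ}
    {S : Set ℝ} {t : ℝ} (hC : ∀ r, ‖m r‖ ≤ C) (hB : ∀ r ξ, ‖m r ξ - m t ξ‖ ≤ B * |r - t|)
    (hm : ∀ ξ, HasDerivAt (fun r => m r ξ) (m' ξ) t) {f : ℝ → L2 n} {f' : L2 n}
    (hf : HasDerivWithinAt f f' S t) :
    HasDerivWithinAt (fun r => mulOp (m r) (f r)) (mulOp m' (f t) + mulOp (m t) f') S t := by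
  have hB0 : 0 ≤ B := by
    have := (norm_nonneg _).trans (hB (t + 1) 0)
    simpa using this
  rw [hasDerivWithinAt_iff_tendsto_slope] at hf ⊢
  have hle : 𝓝[S \ {t}] t ≤ 𝓝[≠] t := nhdsWithin_mono _ fun x hx => hx.2
  have h1 : Tendsto (fun r => mulOp ((((r - t)⁻¹ : ℝ) : ℂ) • (m r - m t)) (f t)) (𝓝[S \ {t}] t)
      (𝓝 (mulOp m' (f t))) := by
    refine tendsto_mulOp (C := B) ?_ ?_ tendsto_const_nhds
    · filter_upwards [self_mem_nhdsWithin] with r hr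
      refine (BoundedContinuousFunction.norm_le hB0).2 fun ξ => ?_
      have hpos : 0 < |r - t| := abs_pos.2 (sub_ne_zero.2 hr.2)
      simp only [BoundedContinuousFunction.coe_smul, BoundedContinuousFunction.coe_sub,
        Pi.sub_apply, norm_smul, Complex.norm_real, norm_inv, Real.norm_eq_abs]
      rw [inv_mul_le_iff₀ hpos, mul_comm]
      exact hB r ξ
    · intro ξ
      have := (hasDerivAt_iff_tendsto_slope.1 (hm ξ)).mono_left hle
      refine this.congr fun r => ?_
      simp [slope_def_module]
  have h2 : Tendsto (fun r => mulOp (m r) (slope f t r)) (𝓝[S \ {t}] t)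
      (𝓝 (mulOp (m t) f')) := by
    refine tendsto_mulOp (C := C) (Eventually.of_forall hC) ?_ hf
    intro ξ
    exact (hm ξ).continuousAt.tendsto.mono_left (hle.trans nhdsWithin_le_nhds)
  refine (h1.add h2).congr fun r => ?_
  rw [mulOp_smul, mulOp_sub, slope_def_module, slope_def_module, real_smul_L2, real_smul_L2,
    map_smul, map_sub, ← smul_add]
  congr 1
  abel

/-! ### Perturbation of solutions of ordinary differential equations in Banach spaces -/

section ODE

open Set Metric
open scoped NNReal

variable {E : Type*} [NormedAddCommGroup E]

/-- Cutoff equal to `1` on the ball of radius `R` and to `0` outside the ball of radius `2R`. -/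
def radialCutoff (R : ℝ) (x : E) : ℝ := max 0 (min 1 (2 - ‖x‖ / R))

lemma radialCutoff_nonneg (R : ℝ) (x : E) : 0 ≤ radialCutoff R x := le_max_left _ _

lemma radialCutoff_le_one (R : ℝ) (x : E) : radialCutoff R x ≤ 1 :=
  max_le zero_le_one (min_le_left _ _)

lemma radialCutoff_eq_one {R : ℝ} (hR : 0 < R) {x : E} (hx : ‖x‖ ≤ R) : radialCutoff R x = 1 := by
  have : ‖x‖ / R ≤ 1 := (div_le_one hR).2 hx
  rw [radialCutoff, min_eq_left (by linarith), max_eq_right zero_le_one]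

lemma radialCutoff_eq_zero {R : ℝ} (hR : 0 < R) {x : E} (hx : 2 * R < ‖x‖) :
    radialCutoff R x = 0 := by
  have : 2 < ‖x‖ / R := (lt_div_iff₀ hR).2 hx
  rw [radialCutoff, max_eq_left]
  exact (min_le_right _ _).trans (by linarith)

lemma abs_radialCutoff_sub_le {R : ℝ} (hR : 0 < R) (x y : E) :
    |radialCutoff R x - radialCutoff R y| ≤ ‖x - y‖ / R := by
  have h1 : |radialCutoff R x - radialCutoff R y| ≤ |(2 - ‖x‖ / R) - (2 - ‖y‖ / R)| := by
    refine (abs_max_sub_max_le_max _ _ _ _).trans ?_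
    refine max_le (by simp) ?_
    refine (abs_min_sub_min_le_max _ _ _ _).trans ?_
    exact max_le (by simp) le_rfl
  refine h1.trans ?_
  have h2 : (2 - ‖x‖ / R) - (2 - ‖y‖ / R) = (‖y‖ - ‖x‖) / R := by ring
  rw [h2, abs_div, abs_of_pos hR, abs_sub_comm]
  gcongr
  exact abs_norm_sub_norm_le x y

variable [NormedSpace ℝ E]

/-- Truncating a map that is Lipschitz and bounded on a ball gives a globally Lipschitz map. -/
lemma lipschitzWith_radialCutoff_smul {F : E → E} {R : ℝ} {K B : ℝ≥0} (hR : 0 < R)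
    (hF : LipschitzOnWith K F (closedBall 0 (2 * R)))
    (hB : ∀ x ∈ closedBall (0 : E) (2 * R), ‖F x‖ ≤ B) :
    LipschitzWith (K + B / ⟨R, hR.le⟩) (fun x => radialCutoff R x • F x) := by
  have key : ∀ x y : E, ‖y‖ ≤ 2 * R → ‖radialCutoff R x • F x - radialCutoff R y • F y‖ ≤
      (K + B / R) * ‖x - y‖ := by
    intro x y hy
    have hy' : y ∈ closedBall (0 : E) (2 * R) := by simpa using hy
    have hc := abs_radialCutoff_sub_le hR x y
    by_cases hx : ‖x‖ ≤ 2 * R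
    · have hx' : x ∈ closedBall (0 : E) (2 * R) := by simpa using hx
      have h1 : radialCutoff R x • F x - radialCutoff R y • F y =
          radialCutoff R x • (F x - F y) + (radialCutoff R x - radialCutoff R y) • F y := by
        module
      rw [h1]
      refine (norm_add_le _ _).trans ?_
      rw [norm_smul, norm_smul, Real.norm_eq_abs, Real.norm_eq_abs,
        abs_of_nonneg (radialCutoff_nonneg R x)]
      have h2 := hF.norm_sub_le hx' hy'
      calc _ ≤ 1 * (K * ‖x - y‖) + ‖x - y‖ / R * B := by
            gcongr
            · exact radialCutoff_le_one R x
            · exact hB y hy'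
        _ = _ := by ring
    · rw [not_le] at hx
      have h0 := radialCutoff_eq_zero hR hx
      rw [h0, zero_sub, abs_neg] at hc
      rw [h0, zero_smul, zero_sub, norm_neg, norm_smul, Real.norm_eq_abs]
      calc _ ≤ ‖x - y‖ / R * B := by
            gcongr
            exact hB y hy'
        _ = 0 * ‖x - y‖ + B / R * ‖x - y‖ := by ring
        _ ≤ K * ‖x - y‖ + B / R * ‖x - y‖ := by gcongr; exact K.2
        _ = _ := by ring
  refine LipschitzWith.of_dist_le_mul fun x y => ?_
  rw [dist_eq_norm, dist_eq_norm]
  push_cast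
  change _ ≤ ((K : ℝ) + B / R) * _
  by_cases hy : ‖y‖ ≤ 2 * R
  · exact key x y hy
  by_cases hx : ‖x‖ ≤ 2 * R
  · rw [norm_sub_rev, norm_sub_rev x]
    exact key y x hx
  rw [not_le] at hx hy
  rw [radialCutoff_eq_zero hR hx, radialCutoff_eq_zero hR hy]
  simp only [zero_smul, sub_self, norm_zero]
  positivity

lemma hasDerivWithinAt_Ici_of_Icc {z : ℝ → E} {z' : E} {T t : ℝ} (ht : t ∈ Ico 0 T)
    (h : HasDerivWithinAt z z' (Icc 0 T) t) : HasDerivWithinAt z z' (Ici t) t := by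
  refine h.mono_of_mem_nhdsWithin ?_
  filter_upwards [Ico_mem_nhdsGE ht.2] with x hx
  exact ⟨ht.1.trans hx.1, hx.2.le⟩

/-- Let a family of vector fields depend continuously on a parameter and on time, and be Lipschitz
on bounded sets. If one member of the family has a solution on `[0,T]`, then nearby members have
solutions on `[0,T]` for nearby initial values, and these are uniformly close. -/
theorem exists_solution_near [CompleteSpace E] {f : ℝ → ℝ → E → E} {c₀ T : ℝ} (hT : 0 ≤ T)
    (hLip : ∀ R : ℝ, ∃ K : ℝ≥0, ∀ c, ∀ t ∈ Icc 0 T, LipschitzOnWith K (f c t) (closedBall 0 R))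
    (hcont : ∀ y : ℝ → E, ContinuousOn y (Icc 0 T) →
      ContinuousOn (fun p : ℝ × ℝ => f p.1 p.2 (y p.2)) (univ ×ˢ Icc 0 T))
    {z₀ : ℝ → E} (hz₀ : ∀ t ∈ Icc 0 T, HasDerivWithinAt z₀ (f c₀ t (z₀ t)) (Icc 0 T) t)
    {ε : ℝ} (hε : 0 < ε) :
    ∃ δ > 0, ∀ c, |c - c₀| < δ → ∀ a, ‖a - z₀ 0‖ < δ → ∃ z : ℝ → E, z 0 = a ∧
      ∀ t ∈ Icc 0 T, HasDerivWithinAt z (f c t (z t)) (Icc 0 T) t ∧ ‖z t - z₀ t‖ < ε := by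
  have hz₀c : ContinuousOn z₀ (Icc 0 T) := fun t ht => (hz₀ t ht).continuousWithinAt
  obtain ⟨M, hM⟩ := isCompact_Icc.exists_bound_of_continuousOn hz₀c
  have hM0 : 0 ≤ M := (norm_nonneg _).trans (hM 0 (left_mem_Icc.2 hT))
  -- the vector fields are truncated outside the ball of radius `R`, which contains the `ε`-tube
  -- around the given solution, and Picard–Lindelöf applies to the truncated fields on all of `[0, T]`
  set R := M + ε with hRdef
  have hR : 0 < R := by positivity
  obtain ⟨K, hK⟩ := hLip (2 * R)
  have hcomp : IsCompact (Icc (c₀ - 1) (c₀ + 1) ×ˢ Icc 0 T) := isCompact_Icc.prod isCompact_Icc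
  have hsub : Icc (c₀ - 1) (c₀ + 1) ×ˢ Icc 0 T ⊆ univ ×ˢ Icc 0 T :=
    prod_mono (subset_univ _) subset_rfl
  obtain ⟨L, hL⟩ := hcomp.exists_bound_of_continuousOn ((hcont (fun _ => 0)
    continuousOn_const).mono hsub)
  have hc₀mem : ∀ t ∈ Icc 0 T, (c₀, t) ∈ Icc (c₀ - 1) (c₀ + 1) ×ˢ Icc 0 T := fun t ht =>
    ⟨⟨by linarith, by linarith⟩, ht⟩
  have hL0 : 0 ≤ L := (norm_nonneg _).trans (hL _ (hc₀mem 0 (left_mem_Icc.2 hT)))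
  set B : ℝ≥0 := ⟨L, hL0⟩ + K * ⟨2 * R, by positivity⟩ with hBdef
  have hB : ∀ c ∈ Icc (c₀ - 1) (c₀ + 1), ∀ t ∈ Icc 0 T, ∀ x ∈ closedBall (0 : E) (2 * R),
      ‖f c t x‖ ≤ B := by
    intro c hc t ht x hx
    have h1 := (hK c t ht).norm_sub_le hx (mem_closedBall_self (by positivity))
    have h2 := hL (c, t) ⟨hc, ht⟩
    have hx' : ‖x‖ ≤ 2 * R := by simpa using hx
    rw [sub_zero] at h1
    calc ‖f c t x‖ ≤ ‖f c t 0‖ + ‖f c t x - f c t 0‖ := norm_le_norm_add_norm_sub' _ _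
      _ ≤ L + K * (2 * R) := add_le_add h2 (h1.trans (by gcongr))
      _ = B := by rw [hBdef]; rfl
  set K' : ℝ≥0 := max 1 (K + B / ⟨R, hR.le⟩) with hK'
  have hK'1 : (1 : ℝ) ≤ K' := by exact_mod_cast le_max_left _ _
  set F : ℝ → ℝ → E → E := fun c t x => radialCutoff R x • f c t x with hF
  have hFlip : ∀ c ∈ Icc (c₀ - 1) (c₀ + 1), ∀ t ∈ Icc 0 T, LipschitzWith K' (F c t) :=
    fun c hc t ht => (lipschitzWith_radialCutoff_smul hR (hK c t ht) (hB c hc t ht)).weaken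
      (le_max_right _ _)
  have hFB : ∀ c ∈ Icc (c₀ - 1) (c₀ + 1), ∀ t ∈ Icc 0 T, ∀ x, ‖F c t x‖ ≤ B := by
    intro c hc t ht x
    by_cases hx : ‖x‖ ≤ 2 * R
    · rw [hF]
      simp only [norm_smul, Real.norm_eq_abs, abs_of_nonneg (radialCutoff_nonneg R x)]
      calc _ ≤ 1 * (B : ℝ) := mul_le_mul (radialCutoff_le_one R x)
            (hB c hc t ht x (by simpa using hx)) (norm_nonneg _) zero_le_one
        _ = B := one_mul _
    · rw [not_le] at hx
      simp [hF, radialCutoff_eq_zero hR hx]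
  -- the choice of `η` that makes the Grönwall bound at most `ε / 2`
  set η : ℝ := ε / (4 * Real.exp (K' * T)) with hη
  have hη0 : 0 < η := by positivity
  have huc := hcomp.uniformContinuousOn_of_continuous ((hcont z₀ hz₀c).mono hsub)
  obtain ⟨δ₁, hδ₁, hclose⟩ := Metric.uniformContinuousOn_iff.1 huc η hη0
  refine ⟨min (min δ₁ 1) η, by positivity, fun c hc a ha => ?_⟩
  have hcδ : |c - c₀| < δ₁ := hc.trans_le ((min_le_left _ _).trans (min_le_left _ _))
  have hc1 : |c - c₀| < 1 := hc.trans_le ((min_le_left _ _).trans (min_le_right _ _))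
  have hcI : c ∈ Icc (c₀ - 1) (c₀ + 1) := by
    rw [abs_lt] at hc1
    exact ⟨by linarith, by linarith⟩
  have hPL : IsPicardLindelof (F c) (⟨0, left_mem_Icc.2 hT⟩ : Icc (0 : ℝ) T) a
      (B * T.toNNReal) 0 B K' := by
    refine ⟨fun t ht => (hFlip c hcI t ht).lipschitzOnWith, fun x _ => ?_,
      fun t ht x _ => hFB c hcI t ht x, ?_⟩
    · have h1 := hcont (fun _ => x) continuousOn_const
      have h2 : ContinuousOn (fun t => f c t x) (Icc 0 T) :=
        h1.comp (f := fun t : ℝ => (c, t)) (by fun_prop) fun t ht => ⟨mem_univ _, ht⟩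
      exact h2.const_smul _
    · simp [hT]
  obtain ⟨z, hz0, hz⟩ := hPL.exists_eq_forall_mem_Icc_hasDerivWithinAt₀
  change z 0 = a at hz0
  have hzc : ContinuousOn z (Icc 0 T) := fun t ht => (hz t ht).continuousWithinAt
  have hgr := dist_le_of_approx_trajectories_ODE_of_mem (v := F c) (s := fun _ => univ) (K := K')
    (a := 0) (b := T) (f := z) (f' := fun t => F c t (z t)) (εf := 0) (g := z₀)
    (g' := fun t => f c₀ t (z₀ t)) (εg := η) (δ := η)
    (fun t ht => (hFlip c hcI t (Ico_subset_Icc_self ht)).lipschitzOnWith) hzc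
    (fun t ht => hasDerivWithinAt_Ici_of_Icc ht (hz t (Ico_subset_Icc_self ht)))
    (fun t _ => (dist_self _).le) (fun _ _ => mem_univ _) hz₀c
    (fun t ht => hasDerivWithinAt_Ici_of_Icc ht (hz₀ t (Ico_subset_Icc_self ht)))
    (fun t ht => ?_) (fun _ _ => mem_univ _) ?_
  · have hlt : ∀ t ∈ Icc 0 T, ‖z t - z₀ t‖ < ε := by
      intro t ht
      have h1 := hgr t ht
      rw [dist_eq_norm] at h1
      refine h1.trans_lt ?_
      have hK0 : (K' : ℝ) ≠ 0 := by positivity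
      rw [gronwallBound_of_K_ne_0 hK0]
      simp only [zero_add, sub_zero]
      have hexp : Real.exp (K' * t) ≤ Real.exp (K' * T) :=
        Real.exp_le_exp.2 (by gcongr; exact ht.2)
      have hdiv : η / K' ≤ η := div_le_self hη0.le hK'1
      calc η * Real.exp (K' * t) + η / K' * (Real.exp (K' * t) - 1)
          ≤ η * Real.exp (K' * T) + η * Real.exp (K' * T) := by
            refine add_le_add (by gcongr) ?_
            refine mul_le_mul hdiv (by linarith) ?_ hη0.le
            rw [sub_nonneg]
            exact Real.one_le_exp (mul_nonneg K'.2 ht.1)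
        _ = ε / 2 := by rw [hη]; field_simp; ring
        _ < ε := by linarith
    refine ⟨z, hz0, fun t ht => ⟨?_, hlt t ht⟩⟩
    have hzR : ‖z t‖ ≤ R := by
      calc ‖z t‖ ≤ ‖z₀ t‖ + ‖z t - z₀ t‖ := norm_le_norm_add_norm_sub' _ _
        _ ≤ M + ε := add_le_add (hM t ht) (hlt t ht).le
    have := hz t ht
    rw [hF] at this
    simpa only [radialCutoff_eq_one hR hzR, one_smul] using this
  · have ht' := Ico_subset_Icc_self ht
    have hzR : ‖z₀ t‖ ≤ R := (hM t ht').trans (by linarith)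
    simp only [hF, radialCutoff_eq_one hR hzR, one_smul]
    refine (hclose (c₀, t) (hc₀mem t ht') (c, t) ⟨hcI, ht'⟩ ?_).le
    rw [Prod.dist_eq]
    simp only [dist_self]
    rw [max_eq_left dist_nonneg, dist_comm, Real.dist_eq]
    exact hcδ
  · rw [hz0, dist_eq_norm]
    exact (ha.trans_le (min_le_right _ _)).le

/-- Uniqueness for vector fields that are Lipschitz on bounded sets. -/
theorem solution_unique {f : ℝ → E → E} {T : ℝ}
    (hLip : ∀ R : ℝ, ∃ K : ℝ≥0, ∀ t ∈ Icc 0 T, LipschitzOnWith K (f t) (closedBall 0 R))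
    {z w : ℝ → E} (hz : ∀ t ∈ Icc 0 T, HasDerivWithinAt z (f t (z t)) (Icc 0 T) t)
    (hw : ∀ t ∈ Icc 0 T, HasDerivWithinAt w (f t (w t)) (Icc 0 T) t) (h0 : z 0 = w 0) :
    EqOn z w (Icc 0 T) := by
  have hzc : ContinuousOn z (Icc 0 T) := fun t ht => (hz t ht).continuousWithinAt
  have hwc : ContinuousOn w (Icc 0 T) := fun t ht => (hw t ht).continuousWithinAt
  obtain ⟨M, hM⟩ := isCompact_Icc.exists_bound_of_continuousOn hzc
  obtain ⟨N, hN⟩ := isCompact_Icc.exists_bound_of_continuousOn hwc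
  obtain ⟨K, hK⟩ := hLip (max M N)
  refine ODE_solution_unique_of_mem_Icc_right (v := f) (K := K)
    (s := fun _ => closedBall 0 (max M N))
    (fun t ht => hK t (Ico_subset_Icc_self ht)) hzc
    (fun t ht => hasDerivWithinAt_Ici_of_Icc ht (hz t (Ico_subset_Icc_self ht)))
    (fun t ht => ?_) hwc
    (fun t ht => hasDerivWithinAt_Ici_of_Icc ht (hw t (Ico_subset_Icc_self ht)))
    (fun t ht => ?_) h0
  · simpa using Or.inl (hM t (Ico_subset_Icc_self ht))
  · simpa using Or.inr (hN t (Ico_subset_Icc_self ht))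

end ODE

/-! ### Sobolev spaces on the Fourier side -/

/-- The symbol `⟨2πξ⟩ = (1 + (2π‖ξ‖)²)^{1/2}` of `⟨D⟩`. -/
def jap (ξ : Space n) : ℝ := √(1 + (2 * Real.pi * ‖ξ‖) ^ 2)

lemma jap_sq (ξ : Space n) : jap ξ ^ 2 = 1 + (2 * Real.pi * ‖ξ‖) ^ 2 :=
  Real.sq_sqrt (by positivity)

lemma one_le_jap (ξ : Space n) : 1 ≤ jap ξ := by
  rw [jap, Real.one_le_sqrt]
  nlinarith [sq_nonneg (2 * Real.pi * ‖ξ‖)]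

lemma jap_pos (ξ : Space n) : 0 < jap ξ := zero_lt_one.trans_le (one_le_jap ξ)

lemma continuous_jap : Continuous (jap : Space n → ℝ) := by unfold jap; fun_prop

/-- The power of `⟨2πξ⟩` in the form for which Mathlib knows temperate growth. -/
lemma jap_rpow (ξ : Space n) (r : ℝ) :
    jap ξ ^ r = (1 + ‖(2 * Real.pi) • ξ‖ ^ 2) ^ (r / 2) := by
  rw [jap, Real.sqrt_eq_rpow, ← Real.rpow_mul (by positivity), norm_smul, Real.norm_eq_abs,
    abs_of_pos Real.two_pi_pos]
  ring_nf

lemma hasTemperateGrowth_jap_rpow (r : ℝ) :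
    (fun ξ : Space n => ((jap ξ ^ r : ℝ) : ℂ)).HasTemperateGrowth := by
  have h1 : (fun ξ : Space n => (2 * Real.pi) • ξ).HasTemperateGrowth :=
    ((2 * Real.pi) • ContinuousLinearMap.id ℝ (Space n)).hasTemperateGrowth
  have h2 := (Function.hasTemperateGrowth_one_add_norm_sq_rpow (Space n) (r / 2)).comp h1
  have h3 := Function.HasTemperateGrowth.comp Complex.ofRealCLM.hasTemperateGrowth h2
  convert h3 using 1
  ext ξ
  simp [jap_rpow]

lemma sobolevNorm_eq (σ : ℝ) (f : L2 n) :
    sobolevNorm σ f = eLpNorm (fun ξ => ((jap ξ ^ σ : ℝ) : ℂ) * (𝓕 f : L2 n) ξ) 2 volume := by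
  rw [sobolevNorm, eLpNorm_eq_lintegral_rpow_enorm_toReal (by norm_num) (by norm_num)]
  simp only [ENNReal.toReal_ofNat, ENNReal.rpow_ofNat]
  congr 1
  refine lintegral_congr fun ξ => ?_
  rw [enorm_mul, mul_pow (‖((jap ξ ^ σ : ℝ) : ℂ)‖ₑ), ← ofReal_norm ((jap ξ ^ σ : ℝ) : ℂ),
      Complex.norm_real, Real.norm_eq_abs,
    abs_of_pos (Real.rpow_pos_of_pos (jap_pos ξ) _), ← ENNReal.ofReal_pow
      (Real.rpow_pos_of_pos (jap_pos ξ) σ).le, Real.rpow_pow_comm (jap_pos ξ).le, jap_sq]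

lemma sobolevNorm_mono {σ τ : ℝ} (h : σ ≤ τ) (f : L2 n) : sobolevNorm σ f ≤ sobolevNorm τ f := by
  rw [sobolevNorm_eq, sobolevNorm_eq]
  refine eLpNorm_mono fun ξ => ?_
  simp only [norm_mul, Complex.norm_real, Real.norm_eq_abs,
    abs_of_pos (Real.rpow_pos_of_pos (jap_pos ξ) _)]
  gcongr
  exact one_le_jap ξ

lemma aestronglyMeasurable_weight (σ : ℝ) (f : L2 n) :
    AEStronglyMeasurable (fun ξ => ((jap ξ ^ σ : ℝ) : ℂ) * f ξ) volume := by
  refine AEStronglyMeasurable.mul ?_ (Lp.memLp f).1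
  exact (Complex.continuous_ofReal.comp (continuous_jap.rpow_const
    fun ξ => Or.inl (jap_pos ξ).ne')).aestronglyMeasurable

lemma sobolevNorm_add_le (σ : ℝ) (f g : L2 n) :
    sobolevNorm σ (f + g) ≤ sobolevNorm σ f + sobolevNorm σ g := by
  simp only [sobolevNorm_eq]
  refine le_trans (le_of_eq ?_) (eLpNorm_add_le (aestronglyMeasurable_weight σ (𝓕 f))
    (aestronglyMeasurable_weight σ (𝓕 g)) (by norm_num))
  refine eLpNorm_congr_ae ?_
  rw [FourierTransform.fourier_add]
  filter_upwards [Lp.coeFn_add (𝓕 f) (𝓕 g)] with ξ h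
  rw [h, Pi.add_apply, Pi.add_apply, mul_add]

lemma sobolevNorm_smul (σ : ℝ) (c : ℂ) (f : L2 n) :
    sobolevNorm σ (c • f) = ‖c‖ₑ * sobolevNorm σ f := by
  simp only [sobolevNorm_eq]
  rw [← eLpNorm_const_smul]
  refine eLpNorm_congr_ae ?_
  rw [FourierTransform.fourier_smul]
  filter_upwards [Lp.coeFn_smul c (𝓕 f)] with ξ h
  rw [h, Pi.smul_apply, Pi.smul_apply]
  simp only [smul_eq_mul]
  ring

lemma sobolevNorm_neg (σ : ℝ) (f : L2 n) : sobolevNorm σ (-f) = sobolevNorm σ f := by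
  have := sobolevNorm_smul σ (-1) f
  simpa using this

/-- The bounded multiplier `⟨2πξ⟩^{-k}`. -/
def japInv (n k : ℕ) : Space n →ᵇ ℂ :=
  bddMul (fun ξ => (((jap ξ ^ k)⁻¹ : ℝ) : ℂ))
    (Complex.continuous_ofReal.comp ((continuous_jap.pow k).inv₀ fun ξ => (pow_pos
        (jap_pos ξ) k).ne'))
    1 (fun ξ => by
      rw [Complex.norm_real, norm_inv, norm_pow, Real.norm_eq_abs, abs_of_pos (jap_pos ξ)]
      exact inv_le_one_of_one_le₀ (one_le_pow₀ (one_le_jap ξ)))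

lemma japInv_apply (k : ℕ) (ξ : Space n) : japInv n k ξ = (((jap ξ ^ k)⁻¹ : ℝ) : ℂ) := rfl

lemma japInv_ne_zero (k : ℕ) (ξ : Space n) : japInv n k ξ ≠ 0 := by
  rw [japInv_apply, Complex.ofReal_ne_zero]
  exact inv_ne_zero (pow_pos (jap_pos ξ) k).ne'

/-- The isometric parametrization `ψ ↦ ⟨D⟩^{-k} 𝓕⁻¹ ψ` of `H^k` by `L²`. All evolution equations are
written for `ψ`, the weighted Fourier transform of the solution. -/
def ofWeighted (k : ℕ) : L2 n →L[ℂ] L2 n :=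
  (Lp.fourierTransformₗᵢ (Space n) ℂ).symm.toContinuousLinearEquiv.toContinuousLinearMap ∘L
    mulOp (japInv n k)

lemma ofWeighted_apply (k : ℕ) (ψ : L2 n) : ofWeighted k ψ = 𝓕⁻ (mulOp (japInv n k) ψ) := rfl

lemma fourier_ofWeighted (k : ℕ) (ψ : L2 n) : 𝓕 (ofWeighted k ψ) = mulOp (japInv n k) ψ := by
  rw [ofWeighted_apply, FourierTransform.fourier_fourierInv_eq]

lemma ofWeighted_injective (k : ℕ) : Function.Injective (ofWeighted k : L2 n → L2 n) := by
  intro ψ φ h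
  have := congrArg (fun f : L2 n => 𝓕 f) h
  simp only [fourier_ofWeighted] at this
  exact mulOp_injective (japInv_ne_zero k) this

lemma sobolevNorm_ofWeighted (k : ℕ) (ψ : L2 n) : sobolevNorm k (ofWeighted k ψ) = ‖ψ‖ₑ := by
  rw [sobolevNorm_eq, fourier_ofWeighted, Lp.enorm_def]
  refine eLpNorm_congr_ae ?_
  filter_upwards [mulOp_coe (japInv n k) ψ] with ξ h
  rw [h, japInv_apply, Real.rpow_natCast, ← mul_assoc, ← Complex.ofReal_mul,
    mul_inv_cancel₀ (pow_pos (jap_pos ξ) k).ne', Complex.ofReal_one, one_mul]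

lemma ofWeighted_mulOp_japInv (k l : ℕ) (ψ : L2 n) :
    ofWeighted k (mulOp (japInv n l) ψ) = ofWeighted (k + l) ψ := by
  rw [ofWeighted_apply, ofWeighted_apply, mulOp_mulOp]
  congr 3
  ext ξ
  simp [japInv_apply, pow_add, mul_comm]

lemma exists_ofWeighted {k : ℕ} {f : L2 n} (hf : sobolevNorm k f < ∞) :
    ∃ ψ, ofWeighted k ψ = f := by
  have hmem : MemLp (fun ξ => ((jap ξ ^ (k : ℝ) : ℝ) : ℂ) * (𝓕 f : L2 n) ξ) 2 volume :=
    ⟨aestronglyMeasurable_weight _ _, by rwa [← sobolevNorm_eq]⟩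
  have key : mulOp (japInv n k) hmem.toLp = 𝓕 f := ?_
  · refine ⟨hmem.toLp, ?_⟩
    rw [ofWeighted_apply, key, FourierTransform.fourierInv_fourier_eq]
  refine mulOp_eq_of_ae ?_
  filter_upwards [hmem.coeFn_toLp] with ξ h
  rw [h, japInv_apply, Real.rpow_natCast, ← mul_assoc, ← Complex.ofReal_mul,
    inv_mul_cancel₀ (pow_pos (jap_pos ξ) k).ne', Complex.ofReal_one, one_mul]

/-! ### Fourier transform of square integrable and of Schwartz functions -/

/-- The bilinear pairing `∫ g f` on `L²`. -/
def pairL2 (g : L2 n) : L2 n →L[ℂ] ℂ := (ContinuousLinearMap.mul ℂ ℂ).lpPairing volume 2 2 g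

lemma pairL2_apply (g f : L2 n) : pairL2 g f = ∫ x, g x * f x := by
  rw [pairL2, ContinuousLinearMap.lpPairing_eq_integral]
  rfl

lemma norm_pairL2_le (g f : L2 n) : ‖pairL2 g f‖ ≤ ‖g‖ * ‖f‖ := by
  rw [pairL2_apply]
  have h : ∫ x, g x * f x = inner ℂ (star g) f := by
    rw [L2.inner_def]
    refine integral_congr_ae ?_
    filter_upwards [Lp.coeFn_star g] with x hx
    rw [hx]
    simp [mul_comm]
  have h2 : ‖(star g : L2 n)‖ = ‖g‖ := by
    rw [Lp.norm_def, Lp.norm_def]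
    congr 1
    rw [eLpNorm_congr_ae (Lp.coeFn_star g)]
    exact eLpNorm_congr_norm_ae (ae_of_all _ fun x => by simp)
  rw [h, ← h2]
  exact norm_inner_le_norm _ _

lemma integral_mul_schwartz (f : L2 n) (φ : 𝓢(Space n, ℂ)) :
    ∫ x, f x * φ x = pairL2 (φ.toLp 2) f := by
  rw [pairL2_apply]
  refine integral_congr_ae ?_
  filter_upwards [φ.coeFn_toLp 2] with x hx
  rw [hx, mul_comm]

/-- The Fourier transform on `L²` as a bounded operator. -/
def fourierL2 (n : ℕ) : L2 n →L[ℂ] L2 n :=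
  (Lp.fourierTransformₗᵢ (Space n) ℂ).toContinuousLinearEquiv.toContinuousLinearMap

lemma fourierL2_apply (f : L2 n) : fourierL2 n f = 𝓕 f := rfl

/-- Parseval's identity between an `L²` function and a Schwartz function. -/
lemma integral_mul_schwartz_eq_fourier (f : L2 n) (φ : 𝓢(Space n, ℂ)) :
    ∫ x, f x * φ x = ∫ ξ, (𝓕 f : L2 n) ξ * (𝓕⁻ φ : 𝓢(Space n, ℂ)) ξ := by
  rw [integral_mul_schwartz, integral_mul_schwartz]
  set ψ : 𝓢(Space n, ℂ) := 𝓕⁻ φ with hψ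
  have h1 : ∀ ψ θ : 𝓢(Space n, ℂ), pairL2 (θ.toLp 2) (ψ.toLp 2) = ∫ x, ψ x * θ x := by
    intro ψ θ
    rw [← integral_mul_schwartz]
    refine integral_congr_ae ?_
    filter_upwards [ψ.coeFn_toLp 2] with x hx
    rw [hx]
  have heq : (pairL2 (φ.toLp 2) : L2 n → ℂ) = (pairL2 (ψ.toLp 2) ∘L fourierL2 n : L2 n →L[ℂ] ℂ) :=
      by
    refine (SchwartzMap.denseRange_toLpCLM (F := ℂ) (E := Space n) (p := 2) (μ := volume)
      ENNReal.ofNat_ne_top).equalizer (ContinuousLinearMap.continuous _)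
      (ContinuousLinearMap.continuous _) (funext fun g => ?_)
    rw [Function.comp_apply, Function.comp_apply, ContinuousLinearMap.comp_apply, fourierL2_apply,
      SchwartzMap.toLpCLM_apply, SchwartzMap.toLp_fourier_eq, h1, h1]
    have := SchwartzMap.integral_fourier_mul_eq g ψ
    rw [hψ, FourierTransform.fourier_fourierInv_eq] at this
    exact this.symm
  exact congrFun heq f

/-- A locally integrable function that annihilates all Schwartz functions vanishes. -/
lemma ae_eq_zero_of_integral_schwartz {q : Space n → ℂ} (hq : LocallyIntegrable q volume)
    (h : ∀ φ : 𝓢(Space n, ℂ), ∫ x, q x * φ x = 0) : ∀ᵐ x, q x = 0 := by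
  refine ae_eq_zero_of_integral_contDiff_smul_eq_zero hq fun g hg hgs => ?_
  have hs : HasCompactSupport (fun x => ((g x : ℝ) : ℂ)) := hgs.comp_left Complex.ofReal_zero
  have hc : ContDiff ℝ (⊤ : ℕ∞) (fun x => ((g x : ℝ) : ℂ)) :=
    Complex.ofRealCLM.contDiff.comp hg
  have := h (hs.toSchwartzMap hc)
  rw [← this]
  refine integral_congr_ae (ae_of_all _ fun x => ?_)
  simp only [Complex.real_smul]
  rw [mul_comm]
  rfl

/-- For integrable square integrable functions, the Fourier transform in `L²` is given by the
Fourier integral. -/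
lemma fourier_toLp_ae_eq {h : Space n → ℂ} (h1 : Integrable h) (h2 : MemLp h 2) :
    (𝓕 (h2.toLp h) : L2 n) =ᵐ[volume] 𝓕 h := by
  have hc : Continuous (𝓕 h) :=
    VectorFourier.fourierIntegral_continuous Real.continuous_fourierChar
      (by exact continuous_inner) h1
  have hli : LocallyIntegrable ((𝓕 (h2.toLp h) : L2 n) : Space n → ℂ) volume :=
    (Lp.memLp _).locallyIntegrable (by norm_num)
  have key := ae_eq_zero_of_integral_schwartz
    (q := fun ξ => (𝓕 (h2.toLp h) : L2 n) ξ - 𝓕 h ξ) (hli.sub hc.locallyIntegrable) ?_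
  · filter_upwards [key] with ξ hξ
    exact sub_eq_zero.1 hξ
  intro φ
  have e1 : ∫ ξ, 𝓕 h ξ * φ ξ = ∫ x, h x * 𝓕 φ x := by
    have := VectorFourier.integral_bilin_fourierIntegral_eq_flip (μ := volume) (ν := volume)
      (e := Real.fourierChar) (L := innerₗ (Space n)) (ContinuousLinearMap.mul ℂ ℂ)
      Real.continuous_fourierChar (by exact continuous_inner) h1 φ.integrable
    simp only [ContinuousLinearMap.mul_apply', flip_innerₗ] at this
    exact this
  have e2 := integral_mul_schwartz_eq_fourier (h2.toLp h) (𝓕 φ)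
  rw [FourierTransform.fourierInv_fourier_eq] at e2
  have i1 : Integrable (fun ξ => (𝓕 (h2.toLp h) : L2 n) ξ * φ ξ) :=
    (Lp.memLp _).integrable_mul (φ.memLp 2)
  have i2 : Integrable (fun ξ => 𝓕 h ξ * φ ξ) := by
    refine φ.integrable.bdd_mul (c := ∫ x, ‖h x‖) hc.aestronglyMeasurable
      (ae_of_all _ fun ξ => ?_)
    exact VectorFourier.norm_fourierIntegral_le_integral_norm _ _ _ _ _
  simp only [sub_mul]
  rw [integral_sub i1 i2, e1, ← e2, sub_eq_zero]
  refine integral_congr_ae ?_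
  filter_upwards [h2.coeFn_toLp] with x hx
  rw [hx]

/-- The weighted Fourier transform `⟨2πξ⟩^k 𝓕 f` of a Schwartz function. -/
def weighted (k : ℕ) (f : 𝓢(Space n, ℂ)) : L2 n :=
  (SchwartzMap.smulLeftCLM ℂ (fun ξ : Space n => ((jap ξ ^ (k : ℝ) : ℝ) : ℂ)) (𝓕 f)).toLp 2

lemma weighted_coe (k : ℕ) (f : 𝓢(Space n, ℂ)) :
    weighted k f =ᵐ[volume] fun ξ => ((jap ξ ^ k : ℝ) : ℂ) * 𝓕 f ξ := by
  refine (SchwartzMap.coeFn_toLp (SchwartzMap.smulLeftCLM ℂ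
    (fun ξ : Space n => ((jap ξ ^ (k : ℝ) : ℝ) : ℂ)) (𝓕 f)) 2 volume).trans
    (ae_of_all _ fun ξ => ?_)
  rw [SchwartzMap.smulLeftCLM_apply_apply (hasTemperateGrowth_jap_rpow _), Real.rpow_natCast,
    smul_eq_mul]

lemma mulOp_japInv_weighted (k : ℕ) (f : 𝓢(Space n, ℂ)) :
    mulOp (japInv n k) (weighted k f) = (𝓕 f).toLp 2 := by
  refine mulOp_eq_of_ae ?_
  filter_upwards [weighted_coe k f, (𝓕 f).coeFn_toLp 2] with ξ h1 h2
  rw [h1, h2, japInv_apply, ← mul_assoc, ← Complex.ofReal_mul,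
    inv_mul_cancel₀ (pow_pos (jap_pos ξ) k).ne', Complex.ofReal_one, one_mul]

lemma ofWeighted_weighted (k : ℕ) (f : 𝓢(Space n, ℂ)) : ofWeighted k (weighted k f) = f.toLp 2 := by
  rw [ofWeighted_apply, mulOp_japInv_weighted, ← SchwartzMap.toLp_fourier_eq,
    FourierTransform.fourierInv_fourier_eq]

lemma weighted_sub (k : ℕ) (f g : 𝓢(Space n, ℂ)) :
    weighted k (f - g) = weighted k f - weighted k g := by
  apply ofWeighted_injective k
  rw [map_sub]
  simp only [ofWeighted_weighted]
  exact (SchwartzMap.toLpCLM ℂ ℂ 2 volume).map_sub f g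

lemma mulOp_japInv_weighted_add (k l : ℕ) (f : 𝓢(Space n, ℂ)) :
    mulOp (japInv n l) (weighted (k + l) f) = weighted k f := by
  apply ofWeighted_injective k
  rw [ofWeighted_mulOp_japInv, ofWeighted_weighted, ofWeighted_weighted]

lemma denseRange_weighted (k : ℕ) : DenseRange (weighted k : 𝓢(Space n, ℂ) → L2 n) := by
  have hsub : Set.range (SchwartzMap.toLpCLM ℂ ℂ 2 (volume : Measure (Space n))) ⊆
      Set.range (weighted k : 𝓢(Space n, ℂ) → L2 n) := by
    rintro _ ⟨ψ, rfl⟩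
    refine ⟨𝓕⁻ (SchwartzMap.smulLeftCLM ℂ (fun ξ : Space n => ((jap ξ ^ (-(k : ℝ)) : ℝ) : ℂ)) ψ),
      ?_⟩
    rw [weighted, FourierTransform.fourier_fourierInv_eq,
      SchwartzMap.smulLeftCLM_smulLeftCLM_apply (hasTemperateGrowth_jap_rpow _)
        (hasTemperateGrowth_jap_rpow _), SchwartzMap.toLpCLM_apply]
    congr 1
    ext ξ
    rw [SchwartzMap.smulLeftCLM_apply_apply ((hasTemperateGrowth_jap_rpow _).mul
        (hasTemperateGrowth_jap_rpow _))]
    simp only [Pi.mul_apply]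
    rw [← Complex.ofReal_mul, ← Real.rpow_add (jap_pos ξ)]
    simp
  exact (SchwartzMap.denseRange_toLpCLM (F := ℂ) (E := Space n) (p := 2) (μ := volume)
    ENNReal.ofNat_ne_top).mono hsub

lemma sobolevNorm_toLp (k : ℕ) (f : 𝓢(Space n, ℂ)) :
    sobolevNorm k (f.toLp 2) = ‖weighted k f‖ₑ := by
  rw [← ofWeighted_weighted k f, sobolevNorm_ofWeighted]

/-! ### Point evaluations on `H^k`, `k > n/2` -/

lemma memLp_japInv {k : ℕ} (hk : (n : ℝ) / 2 < k) : MemLp (japInv n k) 2 volume := by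
  refine (memLp_two_iff_integrable_sq_norm (japInv n k).continuous.aestronglyMeasurable).2 ?_
  have h1 := integrable_rpow_neg_one_add_norm_sq (E := Space n) (μ := volume) (r := 2 * k)
    (by rw [finrank_euclideanSpace_fin]; linarith)
  have h2 := h1.comp_smul (R := 2 * Real.pi) Real.two_pi_pos.ne'
  refine h2.congr (ae_of_all _ fun ξ => ?_)
  simp only
  rw [japInv_apply, Complex.norm_real, norm_inv, norm_pow, Real.norm_eq_abs,
    abs_of_pos (jap_pos ξ), inv_pow, ← pow_mul, ← Real.rpow_natCast (jap ξ),
    ← Real.rpow_neg (jap_pos ξ).le, jap_rpow]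
  congr 1
  push_cast
  ring

/-- The function `ξ ↦ e^{2πi⟨x,ξ⟩} ⟨2πξ⟩^{-k}` that represents the evaluation at `x`. -/
def evalKernel (k : ℕ) (x ξ : Space n) : ℂ := Real.fourierChar (inner ℝ ξ x) * japInv n k ξ

lemma norm_evalKernel (k : ℕ) (x ξ : Space n) : ‖evalKernel k x ξ‖ = ‖japInv n k ξ‖ := by
  rw [evalKernel, norm_mul, Circle.norm_coe, one_mul]

lemma memLp_evalKernel {k : ℕ} (hk : (n : ℝ) / 2 < k) (x : Space n) :
    MemLp (evalKernel k x) 2 volume := by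
  refine (memLp_japInv hk).of_le ?_ (ae_of_all _ fun ξ => (norm_evalKernel k x ξ).le)
  refine Continuous.aestronglyMeasurable ?_
  unfold evalKernel
  have := Real.continuous_fourierChar
  fun_prop

/-- Evaluation at `x` of the function in `H^k` parametrized by `ψ`. -/
def evalAt {k : ℕ} (hk : (n : ℝ) / 2 < k) (x : Space n) : L2 n →L[ℂ] ℂ :=
  pairL2 ((memLp_evalKernel hk x).toLp)

lemma evalAt_apply {k : ℕ} (hk : (n : ℝ) / 2 < k) (x : Space n) (ψ : L2 n) :
    evalAt hk x ψ = ∫ ξ, evalKernel k x ξ * ψ ξ := by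
  rw [evalAt, pairL2_apply]
  refine integral_congr_ae ?_
  filter_upwards [(memLp_evalKernel hk x).coeFn_toLp] with ξ h
  rw [h]

/-- The constant of the embedding `H^k ⊆ L^∞`. -/
def supConst {k : ℕ} (hk : (n : ℝ) / 2 < k) : ℝ := ‖(memLp_japInv hk).toLp‖

lemma norm_evalAt_le {k : ℕ} (hk : (n : ℝ) / 2 < k) (x : Space n) (ψ : L2 n) :
    ‖evalAt hk x ψ‖ ≤ supConst hk * ‖ψ‖ := by
  refine (norm_pairL2_le _ _).trans (le_of_eq ?_)
  rw [supConst, Lp.norm_toLp, Lp.norm_toLp]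
  congr 2
  exact eLpNorm_congr_norm_ae (ae_of_all _ fun ξ => norm_evalKernel k x ξ)

/-- Evaluation at `x` is inversion of the Fourier transform, once the weight is removed. -/
lemma evalAt_eq_fourierInv {k : ℕ} (hk : (n : ℝ) / 2 < k) (x : Space n) {ψ : L2 n}
    {h : Space n → ℂ} (hψ : ψ =ᵐ[volume] fun ξ => ((jap ξ ^ k : ℝ) : ℂ) * h ξ) :
    evalAt hk x ψ = 𝓕⁻ h x := by
  rw [evalAt_apply, Real.fourierInv_eq]
  refine integral_congr_ae ?_
  filter_upwards [hψ] with ξ hξ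
  rw [hξ, evalKernel, japInv_apply, mul_assoc, ← mul_assoc _ _ (h ξ), ← Complex.ofReal_mul,
    inv_mul_cancel₀ (pow_pos (jap_pos ξ) k).ne', Complex.ofReal_one, one_mul]
  rfl

lemma evalAt_weighted {k : ℕ} (hk : (n : ℝ) / 2 < k) (x : Space n) (f : 𝓢(Space n, ℂ)) :
    evalAt hk x (weighted k f) = f x := by
  rw [evalAt_eq_fourierInv hk x (weighted_coe k f)]
  change 𝓕⁻ (⇑(𝓕 f : 𝓢(Space n, ℂ))) x = f x
  rw [← SchwartzMap.fourierInv_coe, FourierTransform.fourierInv_fourier_eq]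

lemma exists_seq_ae_tendsto {f : ℕ → L2 n} {f₀ : L2 n} (h : Tendsto f atTop (𝓝 f₀)) :
    ∃ ns : ℕ → ℕ, StrictMono ns ∧
      ∀ᵐ x, Tendsto (fun i => f (ns i) x) atTop (𝓝 (f₀ x)) :=
  (tendstoInMeasure_of_tendsto_Lp h).exists_seq_tendsto_ae

lemma exists_seq_weighted_tendsto (k : ℕ) (ψ : L2 n) :
    ∃ f : ℕ → 𝓢(Space n, ℂ), Tendsto (fun i => weighted k (f i)) atTop (𝓝 ψ) := by
  obtain ⟨u, hu, hlim⟩ := mem_closure_iff_seq_limit.1 (denseRange_weighted k ψ)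
  choose f hf using hu
  exact ⟨f, by simpa only [hf] using hlim⟩

/-- Point evaluations give a representative of the `L²` class. -/
lemma ofWeighted_ae_eq {k : ℕ} (hk : (n : ℝ) / 2 < k) (ψ : L2 n) :
    ofWeighted k ψ =ᵐ[volume] fun x => evalAt hk x ψ := by
  obtain ⟨f, hf⟩ := exists_seq_weighted_tendsto k ψ
  have h1 : Tendsto (fun i => ofWeighted k (weighted k (f i))) atTop (𝓝 (ofWeighted k ψ)) :=
    ((ofWeighted k).continuous.tendsto ψ).comp hf
  obtain ⟨ns, hns, hae⟩ := exists_seq_ae_tendsto h1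
  have h2 : ∀ᵐ x, ∀ i, (ofWeighted k (weighted k (f i)) : L2 n) x = f i x := by
    refine ae_all_iff.2 fun i => ?_
    rw [ofWeighted_weighted]
    exact (f i).coeFn_toLp 2
  filter_upwards [hae, h2] with x hx hx2
  refine tendsto_nhds_unique hx ?_
  simp only [hx2, ← evalAt_weighted hk x]
  exact (((evalAt hk x).continuous.tendsto ψ).comp hf).comp hns.tendsto_atTop

lemma eq_of_evalAt_eq {k : ℕ} (hk : (n : ℝ) / 2 < k) {ψ φ : L2 n}
    (h : ∀ x, evalAt hk x ψ = evalAt hk x φ) : ψ = φ := by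
  apply ofWeighted_injective k
  refine Lp.ext ?_
  filter_upwards [ofWeighted_ae_eq hk ψ, ofWeighted_ae_eq hk φ] with x h1 h2
  rw [h1, h2, h]

/-! ### Complex conjugation -/

/-- The action of complex conjugation on the Fourier side, `ψ ↦ conj (ψ (-ξ))`. -/
def conjRefl : L2 n →L[ℝ] L2 n :=
  (ContinuousLinearMap.compLpL 2 volume (Complex.conjCLE : ℂ →L[ℝ] ℂ)) ∘L
    (Lp.compMeasurePreservingₗᵢ ℝ (Neg.neg : Space n → Space n)
      (Measure.measurePreserving_neg volume)).toContinuousLinearMap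

lemma conjRefl_coe (ψ : L2 n) :
    conjRefl ψ =ᵐ[volume] fun ξ => (starRingEnd ℂ) (ψ (-ξ)) := by
  have h1 := ContinuousLinearMap.coeFn_compLpL (p := 2) (μ := (volume : Measure (Space n)))
    (Complex.conjCLE : ℂ →L[ℝ] ℂ) (Lp.compMeasurePreserving (Neg.neg : Space n → Space n)
      (Measure.measurePreserving_neg volume) ψ)
  have h2 := Lp.coeFn_compMeasurePreserving ψ (Measure.measurePreserving_neg
    (volume : Measure (Space n)))
  refine h1.trans ?_
  filter_upwards [h2] with ξ h
  rw [h]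
  rfl

lemma ae_neg {p : Space n → Prop} (h : ∀ᵐ ξ, p ξ) : ∀ᵐ ξ, p (-ξ) :=
  (Measure.measurePreserving_neg (volume : Measure (Space n))).quasiMeasurePreserving.ae h

lemma conjRefl_mulOp {m m' : Space n →ᵇ ℂ} (h : ∀ ξ, (starRingEnd ℂ) (m (-ξ)) = m' ξ) (ψ : L2 n) :
    conjRefl (mulOp m ψ) = mulOp m' (conjRefl ψ) := by
  symm
  refine mulOp_eq_of_ae ?_
  filter_upwards [conjRefl_coe (mulOp m ψ), conjRefl_coe ψ, ae_neg (mulOp_coe m ψ)] with ξ h1 h2 h3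
  rw [h1, h2, h3, map_mul, h]

lemma evalAt_conjRefl {k : ℕ} (hk : (n : ℝ) / 2 < k) (x : Space n) (ψ : L2 n) :
    evalAt hk x (conjRefl ψ) = (starRingEnd ℂ) (evalAt hk x ψ) := by
  rw [evalAt_apply, evalAt_apply, ← integral_conj, ← integral_neg_eq_self]
  refine integral_congr_ae ?_
  filter_upwards [ae_neg (conjRefl_coe ψ)] with ξ h
  rw [h, map_mul, neg_neg]
  congr 1
  simp only [evalKernel, map_mul, inner_neg_left, Complex.conj_ofReal, japInv_apply, jap, norm_neg]
  congr 1
  rw [Real.fourierChar_apply, Real.fourierChar_apply, ← Complex.exp_conj]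
  congr 1
  simp [Complex.conj_ofNat]

/-! ### Sobolev norms of integer order and products of Schwartz functions -/

section

open scoped LineDeriv

/-- The norm of `H^j`, computed with the Fourier integral. -/
def hNorm (j : ℕ) (h : Space n → ℂ) : ℝ≥0∞ :=
  eLpNorm (fun ξ => ((jap ξ ^ j : ℝ) : ℂ) * 𝓕 h ξ) 2 volume

lemma enorm_jap_pow (j : ℕ) (ξ : Space n) : ‖((jap ξ ^ j : ℝ) : ℂ)‖ₑ = ENNReal.ofReal
    (jap ξ) ^ j := by
  rw [← ofReal_norm, Complex.norm_real, norm_pow, Real.norm_eq_abs, abs_of_pos (jap_pos ξ),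
    ENNReal.ofReal_pow (jap_pos ξ).le]

lemma hNorm_eq_enorm (j : ℕ) (h : Space n → ℂ) :
    hNorm j h = eLpNorm (fun ξ => ENNReal.ofReal (jap ξ) ^ j * ‖𝓕 h ξ‖ₑ) 2 volume := by
  rw [hNorm, ← eLpNorm_enorm]
  simp only [enorm_mul, enorm_jap_pow]

lemma hNorm_schwartz (k : ℕ) (f : 𝓢(Space n, ℂ)) : hNorm k f = ‖weighted k f‖ₑ := by
  rw [Lp.enorm_def, hNorm]
  refine eLpNorm_congr_ae ?_
  filter_upwards [weighted_coe k f] with ξ h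
  rw [h]
  rfl

lemma hNorm_schwartz_lt_top (k : ℕ) (f : 𝓢(Space n, ℂ)) : hNorm k f < ∞ := by
  rw [hNorm_schwartz]
  exact enorm_lt_top

lemma hNorm_mono {i j : ℕ} (hij : i ≤ j) (h : Space n → ℂ) : hNorm i h ≤ hNorm j h := by
  refine eLpNorm_mono fun ξ => ?_
  simp only [norm_mul, Complex.norm_real, norm_pow, Real.norm_eq_abs, abs_of_pos (jap_pos ξ)]
  gcongr
  exact one_le_jap ξ

lemma continuous_fourier {h : Space n → ℂ} (hh : Integrable h) : Continuous (𝓕 h) :=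
  VectorFourier.fourierIntegral_continuous Real.continuous_fourierChar
    (by exact continuous_inner) hh

lemma continuous_weight_mul_fourier (j : ℕ) {h : Space n → ℂ} (hh : Integrable h) :
    Continuous (fun ξ => ((jap ξ ^ j : ℝ) : ℂ) * 𝓕 h ξ) :=
  (Complex.continuous_ofReal.comp (continuous_jap.pow j)).mul (continuous_fourier hh)

lemma fourier_add_apply {g h : Space n → ℂ} (hg : Integrable g) (hh : Integrable h) (ξ : Space n) :
    𝓕 (fun x => g x + h x) ξ = 𝓕 g ξ + 𝓕 h ξ := by
  have := VectorFourier.fourierIntegral_add (μ := volume) (L := innerₗ (Space n))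
    Real.continuous_fourierChar (by exact continuous_inner) hg hh
  exact congrFun this.symm ξ |>.symm

lemma hNorm_add_le (j : ℕ) {g h : Space n → ℂ} (hg : Integrable g) (hh : Integrable h) :
    hNorm j (fun x => g x + h x) ≤ hNorm j g + hNorm j h := by
  refine le_trans (le_of_eq ?_) (eLpNorm_add_le
    (continuous_weight_mul_fourier j hg).aestronglyMeasurable
    (continuous_weight_mul_fourier j hh).aestronglyMeasurable (by norm_num))
  refine congrArg (fun f => eLpNorm f 2 volume) (funext fun ξ => ?_)
  rw [Pi.add_apply, fourier_add_apply hg hh, mul_add]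

/-- The `i`-th standard basis vector. -/
def stdVec (i : Fin n) : Space n := EuclideanSpace.single i 1

lemma inner_stdVec (ξ : Space n) (i : Fin n) : inner ℝ ξ (stdVec i) = ξ i := by
  simp [stdVec, EuclideanSpace.inner_single_right]

lemma fourier_fderiv_apply {h : Space n → ℂ} (h1 : Integrable h) (h2 : Differentiable ℝ h)
    (h3 : Integrable (fderiv ℝ h)) (m ξ : Space n) :
    𝓕 (fun x => fderiv ℝ h x m) ξ = (2 * Real.pi * Complex.I * (inner ℝ ξ m : ℝ)) * 𝓕 h ξ := by
  have e1 : 𝓕 (fun x => fderiv ℝ h x m) ξ = 𝓕 (fderiv ℝ h) ξ m :=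
    (Real.fourier_continuousLinearMap_apply h3).symm
  rw [e1, Real.fourier_fderiv h1 h2 h3, VectorFourier.fourierSMulRight_apply]
  simp only [neg_apply, innerSL_apply_apply ℝ, neg_smul, Complex.real_smul, smul_eq_mul]
  ring

lemma jap_le_sum (ξ : Space n) : jap ξ ≤ 1 + ∑ i, 2 * Real.pi * |ξ i| := by
  have h1 : jap ξ ≤ 1 + 2 * Real.pi * ‖ξ‖ := by
    refine Real.sqrt_le_iff.2 ⟨by positivity, ?_⟩
    nlinarith [mul_nonneg Real.two_pi_pos.le (norm_nonneg ξ)]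
  refine h1.trans ?_
  rw [← Finset.mul_sum]
  gcongr
  have h2 : ξ = ∑ i, ξ i • stdVec i := by
    ext j
    simp [stdVec, Finset.sum_apply, Pi.single_apply]
  calc ‖ξ‖ = ‖∑ i, ξ i • stdVec i‖ := by rw [← h2]
    _ ≤ ∑ i, ‖ξ i • stdVec i‖ := norm_sum_le _ _
    _ = ∑ i, |ξ i| := by simp [norm_smul, stdVec]

/-- Functions of class `C¹` that are bounded and integrable together with their derivative. -/
structure Nice {E : Type*} [NormedAddCommGroup E] [NormedSpace ℝ E] (P : Space n → E) : Prop where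
  contDiff : ContDiff ℝ 1 P
  bounded : ∃ C, ∀ x, ‖P x‖ ≤ C
  integrable : Integrable P
  integrable_fderiv : Integrable (fderiv ℝ P)

lemma Nice.differentiable {E : Type*} [NormedAddCommGroup E] [NormedSpace ℝ E] {P : Space n → E}
    (h : Nice P) : Differentiable ℝ P := h.contDiff.differentiable (by norm_num)

lemma memLp_two_of_bounded {h : Space n → ℂ} (h1 : Integrable h) {C : ℝ} (hC : ∀ x, ‖h x‖ ≤ C) :
    MemLp h 2 := by
  refine (memLp_two_iff_integrable_sq_norm h1.1).2 ?_
  refine (h1.norm.const_mul C).mono' (h1.1.norm.pow 2) (ae_of_all _ fun x => ?_)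
  rw [Real.norm_eq_abs, abs_of_nonneg (by positivity), sq]
  exact mul_le_mul_of_nonneg_right (hC x) (norm_nonneg _)

lemma schwartz_bounded (f : 𝓢(Space n, ℂ)) : ∃ C, ∀ x, ‖f x‖ ≤ C :=
  ⟨_, f.norm_le_seminorm ℝ⟩

lemma nice_schwartz (f : 𝓢(Space n, ℂ)) : Nice (f : Space n → ℂ) :=
  ⟨f.smooth 1, schwartz_bounded f, f.integrable, (SchwartzMap.fderivCLM ℝ (Space n) ℂ f).integrable⟩

section NiceComp

variable {E F : Type*} [NormedAddCommGroup E] [NormedSpace ℝ E] [NormedAddCommGroup F]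
  [NormedSpace ℝ F]

lemma Nice.prodMk {P : Space n → E} {Q : Space n → F} (hP : Nice P) (hQ : Nice Q) :
    Nice (fun x => (P x, Q x)) := by
  obtain ⟨C, hC⟩ := hP.bounded
  obtain ⟨D, hD⟩ := hQ.bounded
  refine ⟨hP.contDiff.prodMk hQ.contDiff, ⟨max C D, fun x => ?_⟩,
    hP.integrable.prodMk hQ.integrable, ?_⟩
  · exact max_le_max (hC x) (hD x)
  · have h1 : Continuous (fderiv ℝ fun x => (P x, Q x)) :=
      (hP.contDiff.prodMk hQ.contDiff).continuous_fderiv (by norm_num)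
    refine (hP.integrable_fderiv.norm.add hQ.integrable_fderiv.norm).mono' h1.aestronglyMeasurable
      (ae_of_all _ fun x => ?_)
    rw [(hP.differentiable x).fderiv_prodMk (hQ.differentiable x)]
    refine (ContinuousLinearMap.opNorm_prod _ _).le.trans ?_
    refine (norm_prod_le_iff.2 ⟨?_, ?_⟩)
    · simp
    · simp

lemma Nice.comp [ProperSpace E] {P : Space n → E} (hP : Nice P) {H : E → F}
    (hH : ContDiff ℝ 1 H) (h0 : H 0 = 0) : Nice (fun x => H (P x)) := by
  obtain ⟨C, hC⟩ := hP.bounded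
  have hd : Differentiable ℝ H := hH.differentiable (by norm_num)
  obtain ⟨M, hM⟩ := (isCompact_closedBall (0 : E) C).exists_bound_of_continuousOn
    (hH.continuous_fderiv (by norm_num)).continuousOn
  have hmem : ∀ x, P x ∈ Metric.closedBall (0 : E) C := fun x => by simpa using hC x
  have hM0 : 0 ≤ M := (norm_nonneg _).trans (hM _ (hmem 0))
  have hC0 : 0 ≤ C := (norm_nonneg _).trans (hC 0)
  have hle : ∀ x, ‖H (P x)‖ ≤ M * ‖P x‖ := by
    intro x
    have := (convex_closedBall (0 : E) C).norm_image_sub_le_of_norm_fderiv_le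
      (fun y _ => hd y) hM (Metric.mem_closedBall_self hC0) (hmem x)
    simpa [h0] using this
  have hc : ContDiff ℝ 1 (fun x => H (P x)) := hH.comp hP.contDiff
  refine ⟨hc, ⟨M * C, fun x => (hle x).trans (by gcongr; exact hC x)⟩, ?_, ?_⟩
  · exact (hP.integrable.norm.const_mul M).mono' hc.continuous.aestronglyMeasurable
      (ae_of_all _ hle)
  · refine (hP.integrable_fderiv.norm.const_mul M).mono'
      (hc.continuous_fderiv (by norm_num)).aestronglyMeasurable (ae_of_all _ fun x => ?_)
    have : fderiv ℝ (fun x => H (P x)) x = (fderiv ℝ H (P x)) ∘L (fderiv ℝ P x) :=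
      fderiv_comp x (hd _) (hP.differentiable x)
    rw [this]
    exact (ContinuousLinearMap.opNorm_comp_le _ _).trans
      (mul_le_mul_of_nonneg_right (hM _ (hmem x)) (norm_nonneg _))

end NiceComp

lemma Nice.memLp {h : Space n → ℂ} (hh : Nice h) : MemLp h 2 :=
  let ⟨_, hC⟩ := hh.bounded
  memLp_two_of_bounded hh.integrable hC

lemma Nice.integrable_fderiv_apply {h : Space n → ℂ} (hh : Nice h) (m : Space n) :
    Integrable (fun x => fderiv ℝ h x m) :=
  (ContinuousLinearMap.apply ℝ ℂ m).integrable_comp hh.integrable_fderiv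

/-- `‖h‖_{H^{j+1}}` is controlled by the `H^j` norms of `h` and of its partial derivatives. -/
lemma hNorm_succ_le (j : ℕ) {h : Space n → ℂ} (hh : Nice h) :
    hNorm (j + 1) h ≤ hNorm j h + ∑ i, hNorm j (fun x => fderiv ℝ h x (stdVec i)) := by
  have hmeas : ∀ g : Space n → ℂ, Integrable g → AEStronglyMeasurable
      (fun ξ => ENNReal.ofReal (jap ξ) ^ j * ‖𝓕 g ξ‖ₑ) volume := by
    intro g hg
    refine AEMeasurable.aestronglyMeasurable ?_
    exact ((ENNReal.measurable_ofReal.comp continuous_jap.measurable).pow_const j).mul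
      (continuous_fourier hg).measurable.enorm |>.aemeasurable
  simp only [hNorm_eq_enorm]
  refine le_trans ?_ (add_le_add le_rfl (eLpNorm_sum_le (s := Finset.univ)
    (fun i _ => hmeas _ (hh.integrable_fderiv_apply (stdVec i))) (by norm_num)))
  refine le_trans ?_ (eLpNorm_add_le (hmeas _ hh.integrable)
    (Finset.aestronglyMeasurable_sum _
      fun i _ => hmeas _ (hh.integrable_fderiv_apply (stdVec i))) (by norm_num))
  refine eLpNorm_mono_enorm fun ξ => ?_
  simp only [Pi.add_apply, Finset.sum_apply, enorm_eq_self]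
  have hb : ENNReal.ofReal (jap ξ) ≤ 1 + ∑ i, ENNReal.ofReal (2 * Real.pi * |ξ i|) := by
    rw [← ENNReal.ofReal_one, ← ENNReal.ofReal_sum_of_nonneg (fun i _ => by positivity),
      ← ENNReal.ofReal_add zero_le_one (Finset.sum_nonneg fun i _ => by positivity)]
    exact ENNReal.ofReal_le_ofReal (jap_le_sum ξ)
  calc ENNReal.ofReal (jap ξ) ^ (j + 1) * ‖𝓕 h ξ‖ₑ
      = ENNReal.ofReal (jap ξ) * (ENNReal.ofReal (jap ξ) ^ j * ‖𝓕 h ξ‖ₑ) := by ring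
    _ ≤ (1 + ∑ i, ENNReal.ofReal (2 * Real.pi * |ξ i|)) *
        (ENNReal.ofReal (jap ξ) ^ j * ‖𝓕 h ξ‖ₑ) := by gcongr
    _ = _ := by
      rw [add_mul, one_mul, Finset.sum_mul]
      congr 1
      refine Finset.sum_congr rfl fun i _ => ?_
      rw [fourier_fderiv_apply hh.integrable hh.differentiable hh.integrable_fderiv, enorm_mul,
        inner_stdVec]
      have : ‖(2 * Real.pi * Complex.I * (ξ i : ℂ))‖ₑ = ENNReal.ofReal (2 * Real.pi * |ξ i|) := by
        rw [← ofReal_norm]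
        congr 1
        simp [abs_of_pos Real.pi_pos]
      rw [this]
      ring

lemma hNorm_fderiv_le (j : ℕ) {h : Space n → ℂ} (hh : Nice h) (i : Fin n) :
    hNorm j (fun x => fderiv ℝ h x (stdVec i)) ≤ hNorm (j + 1) h := by
  refine eLpNorm_mono fun ξ => ?_
  rw [fourier_fderiv_apply hh.integrable hh.differentiable hh.integrable_fderiv, inner_stdVec,
    pow_succ]
  simp only [norm_mul, Complex.norm_real, norm_pow, Real.norm_eq_abs, abs_of_pos (jap_pos ξ),
    Complex.norm_ofNat, Complex.norm_I, abs_of_pos Real.pi_pos, mul_one]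
  have h1 : |ξ i| ≤ ‖ξ‖ := PiLp.norm_apply_le ξ i
  have h2 : 2 * Real.pi * |ξ i| ≤ jap ξ := by
    refine le_trans (by gcongr : 2 * Real.pi * |ξ i| ≤ 2 * Real.pi * ‖ξ‖) ?_
    exact Real.le_sqrt_of_sq_le (by linarith)
  rw [mul_assoc (jap ξ ^ j) (jap ξ)]
  exact mul_le_mul_of_nonneg_left (mul_le_mul_of_nonneg_right h2
    (norm_nonneg (𝓕 h ξ))) (pow_nonneg (jap_pos ξ).le j)

lemma hNorm_zero {h : Space n → ℂ} (h1 : Integrable h) (h2 : MemLp h 2) :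
    hNorm 0 h = eLpNorm h 2 volume := by
  have e1 : hNorm 0 h = ‖(𝓕 (h2.toLp h) : L2 n)‖ₑ := by
    rw [Lp.enorm_def, hNorm]
    refine eLpNorm_congr_ae ?_
    filter_upwards [fourier_toLp_ae_eq h1 h2] with ξ hξ
    simp [hξ]
  rw [e1, ← ofReal_norm, Lp.norm_fourier_eq, ofReal_norm, Lp.enorm_toLp]

/-- The product of two Schwartz functions. -/
def mulS (f g : 𝓢(Space n, ℂ)) : 𝓢(Space n, ℂ) :=
  SchwartzMap.pairing (ContinuousLinearMap.mul ℂ ℂ) f g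

@[simp] lemma mulS_apply (f g : 𝓢(Space n, ℂ)) (x : Space n) : mulS f g x = f x * g x := by
  simp [mulS]

/-- The complex conjugate of a Schwartz function. -/
def conjS (f : 𝓢(Space n, ℂ)) : 𝓢(Space n, ℂ) :=
  SchwartzMap.postcompCLM (𝕜 := ℝ) (Complex.conjCLE : ℂ →L[ℝ] ℂ) f

@[simp] lemma conjS_apply (f : 𝓢(Space n, ℂ)) (x : Space n) :
    conjS f x = (starRingEnd ℂ) (f x) := by
  simp [conjS]

/-! ### Products in Sobolev spaces -/

lemma eLpNorm_two_sq {α : Type*} [MeasurableSpace α] {μ : Measure α} (A : α → ℝ≥0∞) :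
    eLpNorm A 2 μ ^ 2 = ∫⁻ x, A x ^ 2 ∂μ := by
  rw [eLpNorm_eq_lintegral_rpow_enorm_toReal (by norm_num) (by norm_num)]
  simp only [ENNReal.toReal_ofNat, ENNReal.rpow_ofNat, enorm_eq_self]
  rw [← ENNReal.rpow_natCast, ← ENNReal.rpow_mul]
  norm_num

lemma lintegral_mul_le_eLpNorm_two {α : Type*} [MeasurableSpace α] {μ : Measure α}
    {A B : α → ℝ≥0∞} (hA : AEMeasurable A μ) (hB : AEMeasurable B μ) :
    ∫⁻ x, A x * B x ∂μ ≤ eLpNorm A 2 μ * eLpNorm B 2 μ := by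
  have := ENNReal.lintegral_mul_le_Lp_mul_Lq μ Real.HolderConjugate.two_two hA hB
  refine this.trans (le_of_eq ?_)
  rw [eLpNorm_eq_lintegral_rpow_enorm_toReal (by norm_num) (by norm_num),
    eLpNorm_eq_lintegral_rpow_enorm_toReal (by norm_num) (by norm_num)]
  simp

/-- Young's inequality `‖A * B‖₂ ≤ ‖A‖₂ ‖B‖₁` for nonnegative functions. -/
lemma eLpNorm_convolution_le {A B : Space n → ℝ≥0∞} (hA : Measurable A) (hB : Measurable B) :
    eLpNorm (fun ξ => ∫⁻ η, A (ξ - η) * B η) 2 volume ≤ eLpNorm A 2 volume * ∫⁻ η, B η := by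
  have hAB : Measurable (fun p : Space n × Space n => A (p.1 - p.2) ^ 2 * B p.2) :=
    ((hA.comp (measurable_fst.sub measurable_snd)).pow_const 2).mul (hB.comp measurable_snd)
  have key : ∀ ξ, (∫⁻ η, A (ξ - η) * B η) ^ 2 ≤ (∫⁻ η, A (ξ - η) ^ 2 * B η) * ∫⁻ η, B η := by
    intro ξ
    have hAξ : Measurable fun η => A (ξ - η) := hA.comp (measurable_const.sub measurable_id)
    have h1 := lintegral_mul_le_eLpNorm_two (μ := volume)
      (A := fun η => A (ξ - η) * B η ^ (1 / 2 : ℝ)) (B := fun η => B η ^ (1 / 2 : ℝ))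
      (hAξ.mul (hB.pow_const _)).aemeasurable (hB.pow_const _).aemeasurable
    have hs : ∀ b : ℝ≥0∞, b ^ (1 / 2 : ℝ) * b ^ (1 / 2 : ℝ) = b := by
      intro b
      rw [← ENNReal.rpow_add_of_nonneg _ _ (by norm_num) (by norm_num)]
      norm_num
    have hs2 : ∀ b : ℝ≥0∞, (b ^ (1 / 2 : ℝ)) ^ 2 = b := fun b => by rw [sq, hs]
    simp only [mul_assoc, hs] at h1
    calc _ ≤ _ := pow_le_pow_left' h1 2
      _ = _ := by rw [mul_pow, eLpNorm_two_sq, eLpNorm_two_sq]; simp only [mul_pow, hs2]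
  rw [← ENNReal.pow_le_pow_left_iff two_ne_zero, mul_pow, eLpNorm_two_sq, eLpNorm_two_sq]
  calc ∫⁻ ξ, (∫⁻ η, A (ξ - η) * B η) ^ 2
      ≤ ∫⁻ ξ, (∫⁻ η, A (ξ - η) ^ 2 * B η) * ∫⁻ η, B η := lintegral_mono key
    _ = (∫⁻ ξ, ∫⁻ η, A (ξ - η) ^ 2 * B η) * ∫⁻ η, B η :=
        lintegral_mul_const _ hAB.lintegral_prod_right'
    _ = (∫⁻ η, ∫⁻ ξ, A (ξ - η) ^ 2 * B η) * ∫⁻ η, B η := by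
        rw [lintegral_lintegral_swap hAB.aemeasurable]
    _ = (∫⁻ η, (∫⁻ ξ, A ξ ^ 2) * B η) * ∫⁻ η, B η := by
        congr 1
        refine lintegral_congr fun η => ?_
        have hm : Measurable fun ξ => A (ξ - η) ^ 2 :=
          (hA.comp (measurable_id.sub measurable_const)).pow_const 2
        rw [lintegral_mul_const _ hm, lintegral_sub_right_eq_self (fun ξ => A ξ ^ 2) η]
    _ = _ := by rw [lintegral_const_mul _ hB]; ring

lemma enorm_fourier_mulS_le (f g : 𝓢(Space n, ℂ)) (ξ : Space n) :
    ‖𝓕 (fun x => f x * g x) ξ‖ₑ ≤ ∫⁻ η, ‖𝓕 (f : Space n → ℂ) (ξ - η)‖ₑ * ‖𝓕 (g :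
        Space n → ℂ) η‖ₑ := by
  set F : 𝓢(Space n, ℂ) := 𝓕⁻ f with hF
  set G : 𝓢(Space n, ℂ) := 𝓕⁻ g with hG
  have e1 : (𝓕 (SchwartzMap.convolution (ContinuousLinearMap.mul ℂ ℂ) G F) : 𝓢(Space n, ℂ)) =
      mulS g f := by
    rw [SchwartzMap.fourier_convolution, hF, hG, FourierTransform.fourier_fourierInv_eq,
      FourierTransform.fourier_fourierInv_eq]
    rfl
  have e2 : (fun x => f x * g x) = (mulS g f : Space n → ℂ) := by
    ext x
    rw [mulS_apply, mul_comm]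
  have e3 : 𝓕 (fun x => f x * g x) ξ =
      SchwartzMap.convolution (ContinuousLinearMap.mul ℂ ℂ) G F (-ξ) := by
    rw [e2, ← e1, ← neg_neg ξ, ← Real.fourierInv_eq_fourier_neg, ← SchwartzMap.fourierInv_coe,
      FourierTransform.fourierInv_fourier_eq, neg_neg]
  have hFG : ∀ (h : 𝓢(Space n, ℂ)) (y : Space n), (𝓕⁻ h : 𝓢(Space n, ℂ)) y = 𝓕 (h : Space n → ℂ)
      (-y) := by
    intro h y
    rw [SchwartzMap.fourierInv_coe, Real.fourierInv_eq_fourier_neg]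
  rw [e3, SchwartzMap.convolution_apply, convolution_def]
  refine (enorm_integral_le_lintegral_enorm _).trans (le_of_eq ?_)
  rw [← lintegral_neg_eq_self]
  refine lintegral_congr fun η => ?_
  rw [ContinuousLinearMap.mul_apply', enorm_mul, hF, hG, hFG, hFG, mul_comm, neg_neg]
  rw [show -(-ξ - -η) = ξ - η by abel]

lemma jap_add_le (ξ η : Space n) : jap ξ ≤ 2 * max (jap (ξ - η)) (jap η) := by
  have h1 : ‖ξ‖ ≤ 2 * max ‖ξ - η‖ ‖η‖ := by
    calc ‖ξ‖ = ‖(ξ - η) + η‖ := by rw [sub_add_cancel]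
      _ ≤ ‖ξ - η‖ + ‖η‖ := norm_add_le _ _
      _ ≤ _ := by linarith [le_max_left ‖ξ - η‖ ‖η‖, le_max_right ‖ξ - η‖ ‖η‖]
  have h2 : ∀ a b : Space n, ‖a‖ ≤ 2 * ‖b‖ → jap a ≤ 2 * jap b := by
    intro a b hab
    refine Real.sqrt_le_iff.2 ⟨by have := jap_pos b; positivity, ?_⟩
    rw [mul_pow 2 (jap b), jap_sq]
    have : (2 * Real.pi * ‖a‖) ^ 2 ≤ (2 * Real.pi * (2 * ‖b‖)) ^ 2 := by gcongr
    nlinarith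
  rcases le_total ‖ξ - η‖ ‖η‖ with h | h
  · rw [max_eq_right h] at h1
    exact (h2 _ _ h1).trans (by gcongr; exact le_max_right _ _)
  · rw [max_eq_left h] at h1
    exact (h2 _ _ h1).trans (by gcongr; exact le_max_left _ _)

/-- The elementary inequality behind the product estimate: the larger frequency takes all the
derivatives, and the smaller one gains the integrable weight. -/
lemma jap_pow_le {a b c k : ℕ} (habc : c + k = a + b) (ha : a ≤ k) (hb : b ≤ k) (ξ η : Space n) :
    jap ξ ^ c ≤ 2 ^ c * (jap (ξ - η) ^ a * (jap η ^ b * (jap η ^ k)⁻¹) +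
      (jap (ξ - η) ^ a * (jap (ξ - η) ^ k)⁻¹) * jap η ^ b) := by
  have key : ∀ p q : ℝ, 1 ≤ p → 1 ≤ q → p ≤ q → ∀ a b : ℕ, c + k = a + b → a ≤ k →
      q ^ c ≤ p ^ a * (p ^ k)⁻¹ * q ^ b := by
    intro p q hp hq hpq a b h ha
    have hp0 : 0 < p := by linarith
    rw [mul_assoc, mul_comm, mul_assoc, inv_mul_eq_div, le_div_iff₀ (pow_pos hp0 k)]
    obtain ⟨d, rfl⟩ := Nat.exists_eq_add_of_le ha
    have hb : b = c + d := by omega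
    rw [hb]
    calc q ^ c * p ^ (a + d) = (q ^ c * p ^ a) * p ^ d := by ring
      _ ≤ (q ^ c * p ^ a) * q ^ d := by gcongr
      _ = q ^ (c + d) * p ^ a := by ring
  set p := jap (ξ - η)
  set q := jap η
  have hp : 1 ≤ p := one_le_jap _
  have hq : 1 ≤ q := one_le_jap _
  have hp0 : 0 < p := by linarith
  have hq0 : 0 < q := by linarith
  refine (pow_le_pow_left₀ (jap_pos ξ).le (jap_add_le ξ η) c).trans ?_
  rw [mul_pow]
  gcongr
  rcases le_total p q with h | h
  · rw [max_eq_right h]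
    refine (key p q hp hq h a b habc ha).trans ?_
    exact le_add_of_nonneg_left (by positivity)
  · rw [max_eq_left h]
    refine (key q p hq hp h b a (by omega) hb).trans ?_
    rw [mul_comm (q ^ b * (q ^ k)⁻¹)]
    exact le_add_of_nonneg_right (by positivity)

/-- The product estimate `H^a · H^b ⊆ H^{a+b-k}` for `a, b ≤ k ≤ a + b` and `k > n/2`. -/
lemma exists_hNorm_mul_le {k : ℕ} (hk : (n : ℝ) / 2 < k) {a b c : ℕ} (habc : c + k = a + b)
    (ha : a ≤ k) (hb : b ≤ k) : ∃ C : ℝ≥0, ∀ f g : 𝓢(Space n, ℂ),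
      hNorm c (fun x => f x * g x) ≤ C * (hNorm a f * hNorm b g) := by
  set S : ℝ≥0∞ := eLpNorm (fun ξ : Space n => (ENNReal.ofReal (jap ξ) ^ k)⁻¹) 2 volume with hS
  have hSeq : S = eLpNorm (japInv n k) 2 volume := by
    rw [hS, ← eLpNorm_enorm (f := japInv n k)]
    congr 1
    ext ξ
    rw [japInv_apply, ← ofReal_norm, Complex.norm_real, norm_inv, norm_pow, Real.norm_eq_abs,
      abs_of_pos (jap_pos ξ), ENNReal.ofReal_inv_of_pos (pow_pos (jap_pos ξ) k),
      ENNReal.ofReal_pow (jap_pos ξ).le]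
  have hSfin : S ≠ ∞ := by
    rw [hSeq]
    exact (memLp_japInv hk).2.ne
  refine ⟨2 ^ c * (2 * S.toNNReal), fun f g => ?_⟩
  have hjm : Measurable (fun ξ : Space n => ENNReal.ofReal (jap ξ)) :=
    ENNReal.measurable_ofReal.comp continuous_jap.measurable
  set A : 𝓢(Space n, ℂ) → ℕ → Space n → ℝ≥0∞ := fun f a ξ =>
    ENNReal.ofReal (jap ξ) ^ a * ‖𝓕 (f : Space n → ℂ) ξ‖ₑ with hAdef
  have hA : ∀ f a, Measurable (A f a) := fun f a =>
    (hjm.pow_const a).mul (continuous_fourier f.integrable).measurable.enorm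
  set W : Space n → ℝ≥0∞ := fun ξ => (ENNReal.ofReal (jap ξ) ^ k)⁻¹ with hW
  have hWm : Measurable W := (hjm.pow_const k).inv
  have hpt : ∀ ξ η : Space n, ENNReal.ofReal (jap ξ) ^ c ≤ 2 ^ c *
      (ENNReal.ofReal (jap (ξ - η)) ^ a * (ENNReal.ofReal (jap η) ^ b * W η) +
        ENNReal.ofReal (jap (ξ - η)) ^ a * W (ξ - η) * ENNReal.ofReal (jap η) ^ b) := by
    intro ξ η
    have h1 := ENNReal.ofReal_le_ofReal (jap_pow_le habc ha hb ξ η)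
    have p1 := jap_pos (ξ - η)
    have p2 := jap_pos η
    rw [ENNReal.ofReal_pow (jap_pos ξ).le, ENNReal.ofReal_mul (by positivity),
      ENNReal.ofReal_add (by positivity) (by positivity), ENNReal.ofReal_mul (by positivity),
      ENNReal.ofReal_mul (by positivity), ENNReal.ofReal_mul (by positivity),
      ENNReal.ofReal_mul (by positivity), ENNReal.ofReal_inv_of_pos (by positivity),
      ENNReal.ofReal_inv_of_pos (by positivity), ENNReal.ofReal_pow p1.le, ENNReal.ofReal_pow p2.le,
      ENNReal.ofReal_pow p2.le, ENNReal.ofReal_pow p1.le, ENNReal.ofReal_pow (by norm_num)] at h1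
    simpa only [ENNReal.ofReal_ofNat] using h1
  set I₁ : Space n → ℝ≥0∞ := fun ξ => ∫⁻ η, A f a (ξ - η) * (A g b η * W η) with hI₁
  set I₂ : Space n → ℝ≥0∞ := fun ξ => ∫⁻ η, A g b (ξ - η) * (A f a η * W η) with hI₂
  have hm₁ : ∀ ξ, Measurable fun η => A f a (ξ - η) * (A g b η * W η) := fun ξ =>
    ((hA f a).comp (measurable_const.sub measurable_id)).mul ((hA g b).mul hWm)
  have hL1 : ∀ (h : 𝓢(Space n, ℂ)) (d : ℕ), ∫⁻ η, A h d η * W η ≤ hNorm d h * S := by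
    intro h d
    rw [hNorm_eq_enorm, hS]
    exact lintegral_mul_le_eLpNorm_two (hA h d).aemeasurable hWm.aemeasurable
  have hbound : ∀ (f g : 𝓢(Space n, ℂ)) (a b : ℕ),
      eLpNorm (fun ξ => ∫⁻ η, A f a (ξ - η) * (A g b η * W η)) 2 volume ≤
        hNorm a f * (hNorm b g * S) := by
    intro f g a b
    refine (eLpNorm_convolution_le (hA f a) ((hA g b).mul hWm)).trans ?_
    rw [hNorm_eq_enorm a]
    gcongr
    exact hL1 g b
  have hmeasI : ∀ (f g : 𝓢(Space n, ℂ)) (a b : ℕ),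
      Measurable (fun ξ => ∫⁻ η, A f a (ξ - η) * (A g b η * W η)) := by
    intro f g a b
    refine Measurable.lintegral_prod_right' (f := fun p : Space n × Space n =>
      A f a (p.1 - p.2) * (A g b p.2 * W p.2)) ?_
    exact ((hA f a).comp (measurable_fst.sub measurable_snd)).mul
      (((hA g b).mul hWm).comp measurable_snd)
  have hpoint : ∀ ξ, ENNReal.ofReal (jap ξ) ^ c * ‖𝓕 (fun x => f x * g x) ξ‖ₑ ≤
      2 ^ c * (I₁ ξ + I₂ ξ) := by
    intro ξ
    have hsub : I₂ ξ = ∫⁻ η, A f a (ξ - η) * W (ξ - η) * A g b η := by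
      rw [hI₂, ← lintegral_sub_left_eq_self _ ξ]
      refine lintegral_congr fun η => ?_
      rw [sub_sub_cancel]
      ring
    calc ENNReal.ofReal (jap ξ) ^ c * ‖𝓕 (fun x => f x * g x) ξ‖ₑ
        ≤ ENNReal.ofReal (jap ξ) ^ c * ∫⁻ η, ‖𝓕 (f : Space n → ℂ) (ξ - η)‖ₑ *
          ‖𝓕 (g : Space n → ℂ) η‖ₑ := by gcongr; exact enorm_fourier_mulS_le f g ξ
      _ = ∫⁻ η, ENNReal.ofReal (jap ξ) ^ c * (‖𝓕 (f : Space n → ℂ) (ξ - η)‖ₑ *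
          ‖𝓕 (g : Space n → ℂ) η‖ₑ) := (lintegral_const_mul' _ _ (by finiteness)).symm
      _ ≤ ∫⁻ η, 2 ^ c * (A f a (ξ - η) * (A g b η * W η) +
          A f a (ξ - η) * W (ξ - η) * A g b η) := by
        refine lintegral_mono fun η => ?_
        refine (mul_le_mul_left (hpt ξ η) _).trans (le_of_eq ?_)
        simp only [hAdef]
        ring
      _ = 2 ^ c * (I₁ ξ + I₂ ξ) := by
        rw [lintegral_const_mul' _ _ (by finiteness), lintegral_add_left (hm₁ ξ), hsub]
  calc hNorm c (fun x => f x * g x)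
      ≤ eLpNorm (fun ξ => 2 ^ c * (I₁ ξ + I₂ ξ)) 2 volume := by
        rw [hNorm_eq_enorm]
        exact eLpNorm_mono_enorm fun ξ => by simpa using hpoint ξ
    _ ≤ 2 ^ c * eLpNorm (I₁ + I₂) 2 volume := by
        have := eLpNorm_le_nnreal_smul_eLpNorm_of_ae_le_mul' (μ := volume) (c := 2 ^ c) (p := 2)
          (f := fun ξ => 2 ^ c * (I₁ ξ + I₂ ξ)) (g := I₁ + I₂) (ae_of_all _ fun ξ => by simp)
        simpa [ENNReal.smul_def] using this
    _ ≤ 2 ^ c * (hNorm a f * (hNorm b g * S) + hNorm b g * (hNorm a f * S)) := by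
        gcongr
        refine (eLpNorm_add_le (hmeasI f g a b).aestronglyMeasurable
          (hmeasI g f b a).aestronglyMeasurable (by norm_num)).trans ?_
        exact add_le_add (hbound f g a b) (hbound g f b a)
    _ = _ := by
        push_cast
        rw [ENNReal.coe_toNNReal hSfin]
        ring

/-! ### Composition with smooth functions in `H^k` -/

lemma fourier_conj (h : Space n → ℂ) (ξ : Space n) :
    𝓕 (fun x => (starRingEnd ℂ) (h x)) ξ = (starRingEnd ℂ) (𝓕 h (-ξ)) := by
  rw [Real.fourier_eq, Real.fourier_eq, ← integral_conj]
  refine integral_congr_ae (ae_of_all _ fun x => ?_)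
  simp only [Circle.smul_def, smul_eq_mul, map_mul, inner_neg_right, neg_neg]
  congr 1
  rw [Real.fourierChar_apply, Real.fourierChar_apply, ← Complex.exp_conj]
  congr 1
  simp [Complex.conj_ofNat]

lemma hNorm_conj (j : ℕ) (f : 𝓢(Space n, ℂ)) : hNorm j (conjS f) = hNorm j f := by
  have h1 : (conjS f : Space n → ℂ) = fun x => (starRingEnd ℂ) (f x) := by
    ext x; simp
  rw [h1, hNorm, hNorm]
  have h2 : (fun ξ => ((jap ξ ^ j : ℝ) : ℂ) * 𝓕 (fun x => (starRingEnd ℂ) (f x)) ξ) =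
      fun ξ => (starRingEnd ℂ) ((fun ξ => ((jap ξ ^ j : ℝ) : ℂ) * 𝓕 (f : Space n → ℂ) ξ) (-ξ)) := by
    ext ξ
    simp only [map_mul, fourier_conj, Complex.conj_ofReal, jap, norm_neg]
  rw [h2]
  have h3 := eLpNorm_comp_measurePreserving (p := 2)
    (continuous_weight_mul_fourier j f.integrable).aestronglyMeasurable
    (Measure.measurePreserving_neg (volume : Measure (Space n)))
  rw [← h3]
  exact eLpNorm_congr_norm_ae (ae_of_all _ fun ξ => by simp)

/-- The Wirtinger derivative `∂G/∂z`. -/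
def dz (G : ℂ → ℂ) (z : ℂ) : ℂ := (fderiv ℝ G z 1 - Complex.I * fderiv ℝ G z Complex.I) / 2

/-- The Wirtinger derivative `∂G/∂z̄`. -/
def dzb (G : ℂ → ℂ) (z : ℂ) : ℂ := (fderiv ℝ G z 1 + Complex.I * fderiv ℝ G z Complex.I) / 2

lemma fderiv_eq_wirtinger (G : ℂ → ℂ) (z w : ℂ) :
    fderiv ℝ G z w = dz G z * w + dzb G z * (starRingEnd ℂ) w := by
  have h1 : w = w.re • (1 : ℂ) + w.im • Complex.I := by
    simp [Complex.re_add_im]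
  have h2 : fderiv ℝ G z w = w.re * fderiv ℝ G z 1 + w.im * fderiv ℝ G z Complex.I := by
    conv_lhs => rw [h1]
    rw [map_add, map_smul, map_smul, Complex.real_smul, Complex.real_smul]
  have h3 : w + (starRingEnd ℂ) w = 2 * w.re := by rw [Complex.add_conj]; push_cast; ring
  have h4 : w - (starRingEnd ℂ) w = 2 * w.im * Complex.I := by
    rw [Complex.sub_conj]; push_cast; ring
  rw [h2, dz, dzb]
  linear_combination (-(1 / 2) * fderiv ℝ G z 1) * h3 +
    (1 / 2) * Complex.I * fderiv ℝ G z Complex.I * h4 + ((w.im : ℂ) * fderiv ℝ G z Complex.I) *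
      Complex.I_mul_I

lemma contDiff_dz {G : ℂ → ℂ} {j : ℕ} (hG : ContDiff ℝ (j + 1 : ℕ) G) : ContDiff ℝ j (dz G) := by
  have h : ContDiff ℝ j (fderiv ℝ G) := hG.fderiv_right (by norm_cast)
  exact ((h.clm_apply contDiff_const).sub (contDiff_const.mul
      (h.clm_apply contDiff_const))).div_const 2

lemma contDiff_dzb {G : ℂ → ℂ} {j : ℕ} (hG : ContDiff ℝ (j + 1 : ℕ) G) : ContDiff ℝ j (dzb G) := by
  have h : ContDiff ℝ j (fderiv ℝ G) := hG.fderiv_right (by norm_cast)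
  exact ((h.clm_apply contDiff_const).add (contDiff_const.mul
      (h.clm_apply contDiff_const))).div_const 2

/-- The partial derivative `∂ᵢ f` of a Schwartz function. -/
def partialS (i : Fin n) (f : 𝓢(Space n, ℂ)) : 𝓢(Space n, ℂ) := ∂_{stdVec i} f

lemma partialS_apply (i : Fin n) (f : 𝓢(Space n, ℂ)) (x : Space n) :
    partialS i f x = fderiv ℝ f x (stdVec i) := SchwartzMap.lineDerivOp_apply_eq_fderiv _ _ _

lemma partialS_sub (i : Fin n) (f g : 𝓢(Space n, ℂ)) :
    partialS i (f - g) = partialS i f - partialS i g := by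
  ext x
  rw [sub_apply, partialS_apply, partialS_apply, partialS_apply]
  have : ((f - g : 𝓢(Space n, ℂ)) : Space n → ℂ) = fun x => f x - g x := rfl
  rw [this, fderiv_fun_sub f.differentiable.differentiableAt g.differentiable.differentiableAt]
  rfl

lemma hNorm_partialS_le (j : ℕ) (i : Fin n) (f : 𝓢(Space n, ℂ)) :
    hNorm j (partialS i f) ≤ hNorm (j + 1) f := by
  have h : (partialS i f : Space n → ℂ) = fun x => fderiv ℝ f x (stdVec i) :=
    funext fun x => partialS_apply i f x
  rw [h]
  exact hNorm_fderiv_le j (nice_schwartz f) i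

lemma norm_schwartz_le {k : ℕ} (hk : (n : ℝ) / 2 < k) (u : 𝓢(Space n, ℂ)) (x : Space n) :
    ‖u x‖ ≤ supConst hk * ‖weighted k u‖ := by
  rw [← evalAt_weighted hk x u]
  exact norm_evalAt_le hk x _

lemma supConst_nonneg {k : ℕ} (hk : (n : ℝ) / 2 < k) : 0 ≤ supConst hk := norm_nonneg _

lemma norm_weighted_le {k : ℕ} {u : 𝓢(Space n, ℂ)} {R : ℝ≥0} (hu : hNorm k u ≤ R) :
    ‖weighted k u‖ ≤ R := by
  rw [hNorm_schwartz, ← ENNReal.ofReal_coe_nnreal, ← ofReal_norm,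
    ENNReal.ofReal_le_ofReal_iff R.coe_nonneg] at hu
  exact hu

lemma exists_bound_comp {k : ℕ} (hk : (n : ℝ) / 2 < k) {E : Type*} [NormedAddCommGroup E]
    {G : ℂ → E} (hG : Continuous G) (R : ℝ≥0) :
    ∃ C : ℝ≥0, ∀ z, ‖z‖ ≤ supConst hk * R → ‖G z‖ ≤ C := by
  obtain ⟨C, hC⟩ := (isCompact_closedBall (0 : ℂ) (supConst hk * R)).exists_bound_of_continuousOn
    hG.continuousOn
  exact ⟨C.toNNReal, fun z hz => (hC z (by simpa using hz)).trans (Real.le_coe_toNNReal C)⟩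

lemma norm_le_of_hNorm_le {k : ℕ} (hk : (n : ℝ) / 2 < k) {u : 𝓢(Space n, ℂ)} {R : ℝ≥0}
    (hu : hNorm k u ≤ R) (x : Space n) : ‖u x‖ ≤ supConst hk * R :=
  (norm_schwartz_le hk u x).trans
    (mul_le_mul_of_nonneg_left (norm_weighted_le hu) (supConst_nonneg hk))

lemma integrable_comp_mul {G : ℂ → ℂ} (hG : Continuous G) (u g : 𝓢(Space n, ℂ)) :
    Integrable (fun x => G (u x) * g x) := by
  obtain ⟨R, hR⟩ := schwartz_bounded u
  obtain ⟨C, hC⟩ := (isCompact_closedBall (0 : ℂ) R).exists_bound_of_continuousOn hG.continuousOn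
  exact g.integrable.bdd_mul (c := C) (hG.comp u.continuous).aestronglyMeasurable
    (ae_of_all _ fun x => hC _ (by simpa using hR x))

lemma bounded_comp_mul {G : ℂ → ℂ} (hG : Continuous G) (u g : 𝓢(Space n, ℂ)) :
    MemLp (fun x => G (u x) * g x) 2 := by
  obtain ⟨R, hR⟩ := schwartz_bounded u
  obtain ⟨C, hC⟩ := (isCompact_closedBall (0 : ℂ) R).exists_bound_of_continuousOn hG.continuousOn
  obtain ⟨D, hD⟩ := schwartz_bounded g
  refine memLp_two_of_bounded (integrable_comp_mul hG u g) (C := C * D) fun x => ?_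
  have h1 := hC (u x) (by simpa using hR x)
  rw [norm_mul]
  exact mul_le_mul h1 (hD x) (norm_nonneg _) ((norm_nonneg _).trans h1)

lemma hNorm_zero_le_of_norm_le {h : Space n → ℂ} (h1 : Integrable h) (h2 : MemLp h 2)
    {g : 𝓢(Space n, ℂ)} {C : ℝ≥0} (hC : ∀ x, ‖h x‖ ≤ C * ‖g x‖) : hNorm 0 h ≤ C * hNorm 0 g := by
  rw [hNorm_zero h1 h2, hNorm_zero g.integrable (nice_schwartz g).memLp]
  have := eLpNorm_le_nnreal_smul_eLpNorm_of_ae_le_mul (μ := volume) (p := 2) (f := h) (g := g)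
    (c := C) (ae_of_all _ fun x => by exact_mod_cast hC x)
  simpa [ENNReal.smul_def] using this

lemma nice_comp_mul {G : ℂ → ℂ} (hG : ContDiff ℝ 1 G) (u g : 𝓢(Space n, ℂ)) :
    Nice (fun x => G (u x) * g x) :=
  ((nice_schwartz u).prodMk (nice_schwartz g)).comp (H := fun p : ℂ × ℂ => G p.1 * p.2)
    ((hG.comp contDiff_fst).mul contDiff_snd) (by simp)

/-- The Leibniz rule; each summand is again a function of `u` times a Schwartz function, which makes
an induction on the order of the Sobolev norm possible. -/
lemma fderiv_comp_mul {G : ℂ → ℂ} (hG : Differentiable ℝ G) (u g : 𝓢(Space n, ℂ)) (i : Fin n)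
    (x : Space n) : fderiv ℝ (fun x => G (u x) * g x) x (stdVec i) =
      dz G (u x) * mulS (partialS i u) g x + dzb G (u x) * mulS (conjS (partialS i u)) g x +
        G (u x) * partialS i g x := by
  have hu : HasFDerivAt (fun x => G (u x)) ((fderiv ℝ G (u x)) ∘L (fderiv ℝ u x)) x :=
    (hG (u x)).hasFDerivAt.comp x u.differentiable.differentiableAt.hasFDerivAt
  have hg : HasFDerivAt g (fderiv ℝ g x) x := g.differentiable.differentiableAt.hasFDerivAt
  have e : (fun x => G (u x) * g x) = (fun x => G (u x)) * g := rfl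
  rw [e, (hu.mul hg).fderiv]
  simp only [_root_.add_apply, _root_.smul_apply, ContinuousLinearMap.comp_apply, smul_eq_mul,
    fderiv_eq_wirtinger G, mulS_apply, conjS_apply, partialS_apply]
  ring

/-- If `u` is bounded in `H^k`, then multiplication by `G(u)` is bounded on `H^j`, `j ≤ k`. -/
lemma exists_hNorm_comp_mul_le {k : ℕ} (hk : (n : ℝ) / 2 < k) (R : ℝ≥0) (j : ℕ) (hj : j ≤ k) :
    ∀ G : ℂ → ℂ, ContDiff ℝ j G → ∃ C : ℝ≥0, ∀ u g : 𝓢(Space n, ℂ), hNorm k u ≤ R →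
      hNorm j (fun x => G (u x) * g x) ≤ C * hNorm j g := by
  induction j with
  | zero =>
    intro G hG
    obtain ⟨C, hC⟩ := exists_bound_comp hk hG.continuous R
    refine ⟨C, fun u g hu => hNorm_zero_le_of_norm_le (integrable_comp_mul hG.continuous u g)
      (bounded_comp_mul hG.continuous u g) fun x => ?_⟩
    rw [norm_mul]
    exact mul_le_mul_of_nonneg_right (hC _ (norm_le_of_hNorm_le hk hu x)) (norm_nonneg _)
  | succ j ih =>
    intro G hG
    have hGj : ContDiff ℝ j G := hG.of_le (by norm_cast; omega)
    have hG1 : ContDiff ℝ 1 G := hG.of_le (by norm_cast; omega)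
    have hGd : Differentiable ℝ G := hG1.differentiable (by norm_num)
    obtain ⟨C₀, hC₀⟩ := ih (by omega) G hGj
    obtain ⟨C₁, hC₁⟩ := ih (by omega) (dz G) (contDiff_dz hG)
    obtain ⟨C₂, hC₂⟩ := ih (by omega) (dzb G) (contDiff_dzb hG)
    -- `H^{k-1} · H^{j+1} ⊆ H^j` controls the terms in which the derivative falls on `u`
    obtain ⟨P, hP⟩ := exists_hNorm_mul_le hk (a := k - 1) (b := j + 1) (c := j) (by omega)
      (by omega) hj
    refine ⟨C₀ + n * (C₁ * (P * R) + C₂ * (P * R) + C₀), fun u g hu => ?_⟩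
    have hk1 : k - 1 + 1 = k := by omega
    have hpu : ∀ i, hNorm (k - 1) (partialS i u) ≤ R := fun i =>
      (hNorm_partialS_le (k - 1) i u).trans (by rwa [hk1])
    have hprod : ∀ f : 𝓢(Space n, ℂ), hNorm (k - 1) f ≤ R →
        hNorm j (mulS f g) ≤ P * R * hNorm (j + 1) g := by
      intro f hf
      have := hP f g
      have e : (mulS f g : Space n → ℂ) = fun x => f x * g x := funext fun x => mulS_apply f g x
      rw [e, mul_assoc]
      exact this.trans (by gcongr)
    refine (hNorm_succ_le j (nice_comp_mul hG1 u g)).trans ?_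
    have hterm : ∀ i, hNorm j (fun x => fderiv ℝ (fun x => G (u x) * g x) x (stdVec i)) ≤
        (C₁ * (P * R) + C₂ * (P * R) + C₀ : ℝ≥0) * hNorm (j + 1) g := by
      intro i
      simp only [fderiv_comp_mul hGd]
      have i1 := integrable_comp_mul (contDiff_dz hG).continuous u (mulS (partialS i u) g)
      have i2 := integrable_comp_mul (contDiff_dzb hG).continuous u (mulS (conjS (partialS i u)) g)
      have i3 := integrable_comp_mul hG.continuous u (partialS i g)
      refine (hNorm_add_le j (i1.add i2) i3).trans ?_
      push_cast
      rw [add_mul, add_mul]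
      refine add_le_add ((hNorm_add_le j i1 i2).trans (add_le_add ?_ ?_)) ?_
      · refine (hC₁ u _ hu).trans ?_
        rw [mul_assoc]
        gcongr
        exact hprod _ (hpu i)
      · refine (hC₂ u _ hu).trans ?_
        rw [mul_assoc]
        gcongr
        exact hprod _ (by rw [hNorm_conj]; exact hpu i)
      · refine (hC₀ u _ hu).trans ?_
        gcongr
        exact hNorm_partialS_le j i g
    calc _ ≤ C₀ * hNorm (j + 1) g + ∑ _i : Fin n,
          (C₁ * (P * R) + C₂ * (P * R) + C₀ : ℝ≥0) * hNorm (j + 1) g := by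
          gcongr with i
          · exact (hC₀ u g hu).trans (by gcongr; exact hNorm_mono (by omega) _)
          · exact hterm i
      _ = _ := by
          rw [Finset.sum_const, Finset.card_univ, Fintype.card_fin, nsmul_eq_mul]
          push_cast
          ring

/-! ### Lipschitz bounds for composition in `H^k` -/

lemma exists_lipschitz_comp {k : ℕ} (hk : (n : ℝ) / 2 < k) {G : ℂ → ℂ} (hG : ContDiff ℝ 1 G)
    (R : ℝ≥0) : ∃ L : ℝ≥0, ∀ z w, ‖z‖ ≤ supConst hk * R → ‖w‖ ≤ supConst hk * R →
      ‖G z - G w‖ ≤ L * ‖z - w‖ := by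
  obtain ⟨L, hL⟩ := exists_bound_comp hk (hG.continuous_fderiv (by norm_num)) R
  refine ⟨L, fun z w hz hw => ?_⟩
  exact (convex_closedBall (0 : ℂ) (supConst hk * R)).norm_image_sub_le_of_norm_fderiv_le
    (𝕜 := ℝ) (f := G) (C := L) (fun y _ => (hG.differentiable (by norm_num)) y)
    (fun y hy => hL y (by simpa using hy)) (by simpa using hw) (by simpa using hz)

lemma integrable_sub_comp_mul {G : ℂ → ℂ} (hG : Continuous G) (u w g : 𝓢(Space n, ℂ)) :
    Integrable (fun x => (G (u x) - G (w x)) * g x) := by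
  simp only [sub_mul]
  exact (integrable_comp_mul hG u g).sub (integrable_comp_mul hG w g)

lemma memLp_sub_comp_mul {G : ℂ → ℂ} (hG : Continuous G) (u w g : 𝓢(Space n, ℂ)) :
    MemLp (fun x => (G (u x) - G (w x)) * g x) 2 := by
  simp only [sub_mul]
  exact (bounded_comp_mul hG u g).sub (bounded_comp_mul hG w g)

lemma norm_sub_le_hNorm {k : ℕ} (hk : (n : ℝ) / 2 < k) (u w : 𝓢(Space n, ℂ)) (x : Space n) :
    ‖u x - w x‖ ≤ supConst hk * (hNorm k (u - w : 𝓢(Space n, ℂ))).toReal := by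
  have h := norm_schwartz_le hk (u - w) x
  rw [hNorm_schwartz, toReal_enorm]
  exact h

lemma fderiv_sub_comp_mul {G : ℂ → ℂ} (hG : Differentiable ℝ G) (u w g : 𝓢(Space n, ℂ))
    (i : Fin n) (x : Space n) :
    fderiv ℝ (fun x => (G (u x) - G (w x)) * g x) x (stdVec i) =
      (((dz G (u x) - dz G (w x)) * mulS (partialS i u) g x +
        (dzb G (u x) - dzb G (w x)) * mulS (conjS (partialS i u)) g x) +
      (dz G (w x) * mulS (partialS i (u - w)) g x +
        dzb G (w x) * mulS (conjS (partialS i (u - w))) g x)) +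
      (G (u x) - G (w x)) * partialS i g x := by
  have hd : ∀ v : 𝓢(Space n, ℂ), DifferentiableAt ℝ (fun x => G (v x) * g x) x := fun v =>
    ((hG (v x)).comp x v.differentiable.differentiableAt).mul g.differentiable.differentiableAt
  simp only [sub_mul]
  rw [fderiv_fun_sub (hd u) (hd w), _root_.sub_apply, fderiv_comp_mul hG, fderiv_comp_mul hG,
    partialS_sub]
  simp only [mulS_apply, conjS_apply, sub_apply, map_sub]
  ring

lemma nice_sub_comp_mul {G : ℂ → ℂ} (hG : ContDiff ℝ 1 G) (u w g : 𝓢(Space n, ℂ)) :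
    Nice (fun x => (G (u x) - G (w x)) * g x) :=
  (((nice_schwartz u).prodMk (nice_schwartz w)).prodMk (nice_schwartz g)).comp
    (H := fun p : (ℂ × ℂ) × ℂ => (G p.1.1 - G p.1.2) * p.2)
    (((hG.comp (contDiff_fst.comp contDiff_fst)).sub
      (hG.comp (contDiff_snd.comp contDiff_fst))).mul contDiff_snd) (by simp)

/-- The triangle inequality for the five terms of the Leibniz rule for `(G(u) - G(w)) g`. -/
lemma hNorm_add_five_le (j : ℕ) {a b c d e : Space n → ℂ} (ha : Integrable a) (hb : Integrable b)
    (hc : Integrable c) (hd : Integrable d) (he : Integrable e) :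
    hNorm j (fun x => ((a x + b x) + (c x + d x)) + e x) ≤
      ((hNorm j a + hNorm j b) + (hNorm j c + hNorm j d)) + hNorm j e :=
  (hNorm_add_le j ((ha.add hb).add (hc.add hd)) he).trans (add_le_add
    ((hNorm_add_le j (ha.add hb) (hc.add hd)).trans
      (add_le_add (hNorm_add_le j ha hb) (hNorm_add_le j hc hd))) le_rfl)

/-- Multiplication by `G(u)` on `H^j`, `j ≤ k`, is Lipschitz in `u ∈ H^k`, on bounded sets. -/
lemma exists_hNorm_sub_comp_mul_le {k : ℕ} (hk : (n : ℝ) / 2 < k) (R : ℝ≥0) (j : ℕ) (hj : j ≤ k) :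
    ∀ G : ℂ → ℂ, ContDiff ℝ (j + 1 : ℕ) G → ∃ C : ℝ≥0, ∀ u w g : 𝓢(Space n, ℂ), hNorm k u ≤ R →
      hNorm k w ≤ R → hNorm j (fun x => (G (u x) - G (w x)) * g x) ≤
        C * hNorm k (u - w : 𝓢(Space n, ℂ)) * hNorm j g := by
  induction j with
  | zero =>
    intro G hG
    have hG1 : ContDiff ℝ 1 G := by simpa using hG
    obtain ⟨L, hL⟩ := exists_lipschitz_comp hk hG1 R
    refine ⟨L * (supConst hk).toNNReal, fun u w g hu hw => ?_⟩
    have hfin := (hNorm_schwartz_lt_top k (u - w)).ne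
    have := hNorm_zero_le_of_norm_le (g := g) (C := L * (supConst hk).toNNReal *
      (hNorm k (u - w : 𝓢(Space n, ℂ))).toNNReal) (integrable_sub_comp_mul hG1.continuous u w g)
      (memLp_sub_comp_mul hG1.continuous u w g) fun x => ?_
    · rwa [ENNReal.coe_mul, ENNReal.coe_toNNReal hfin] at this
    · rw [norm_mul]
      refine mul_le_mul_of_nonneg_right ?_ (norm_nonneg _)
      refine (hL _ _ (norm_le_of_hNorm_le hk hu x) (norm_le_of_hNorm_le hk hw x)).trans ?_
      rw [NNReal.coe_mul, NNReal.coe_mul, mul_assoc, Real.coe_toNNReal _ (supConst_nonneg hk)]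
      exact mul_le_mul_of_nonneg_left (norm_sub_le_hNorm hk u w x) L.2
  | succ j ih =>
    intro G hG
    have hGj : ContDiff ℝ (j + 1 : ℕ) G := hG.of_le (by norm_cast; omega)
    have hG1 : ContDiff ℝ 1 G := hG.of_le (by norm_cast; omega)
    have hGd : Differentiable ℝ G := hG1.differentiable (by norm_num)
    have cz := contDiff_dz hG
    have czb := contDiff_dzb hG
    obtain ⟨C₀, hC₀⟩ := ih (by omega) G hGj
    obtain ⟨C₁, hC₁⟩ := ih (by omega) (dz G) cz
    obtain ⟨C₂, hC₂⟩ := ih (by omega) (dzb G) czb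
    -- the constants `C` belong to differences `G(u) - G(w)`, the constants `D` to differences `∂ᵢ(u-w)`
    obtain ⟨D₁, hD₁⟩ := exists_hNorm_comp_mul_le hk R j (by omega) (dz G)
      (cz.of_le (by norm_cast; omega))
    obtain ⟨D₂, hD₂⟩ := exists_hNorm_comp_mul_le hk R j (by omega) (dzb G)
      (czb.of_le (by norm_cast; omega))
    obtain ⟨P, hP⟩ := exists_hNorm_mul_le hk (a := k - 1) (b := j + 1) (c := j) (by omega)
      (by omega) hj
    refine ⟨C₀ + n * ((C₁ * (P * R) + C₂ * (P * R)) + (D₁ * P + D₂ * P) + C₀),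
      fun u w g hu hw => ?_⟩
    have hk1 : k - 1 + 1 = k := by omega
    have hpu : ∀ (f : 𝓢(Space n, ℂ)) i, hNorm (k - 1) (partialS i f) ≤ hNorm k f := fun f i =>
      (hNorm_partialS_le (k - 1) i f).trans_eq (by rw [hk1])
    have hprod : ∀ (f : 𝓢(Space n, ℂ)) (A : ℝ≥0∞), hNorm (k - 1) f ≤ A →
        hNorm j (mulS f g) ≤ P * (A * hNorm (j + 1) g) := by
      intro f A hf
      have := hP f g
      have e : (mulS f g : Space n → ℂ) = fun x => f x * g x := funext fun x => mulS_apply f g x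
      rw [e]
      exact this.trans (by gcongr)
    set δ : ℝ≥0∞ := hNorm k (u - w : 𝓢(Space n, ℂ)) with hδ
    refine (hNorm_succ_le j (nice_sub_comp_mul hG1 u w g)).trans ?_
    have hterm : ∀ i, hNorm j (fun x => fderiv ℝ (fun x => (G (u x) - G (w x)) * g x) x
        (stdVec i)) ≤ ((C₁ * (P * R) + C₂ * (P * R)) + (D₁ * P + D₂ * P) + C₀ : ℝ≥0) *
          (δ * hNorm (j + 1) g) := by
      intro i
      simp only [fderiv_sub_comp_mul hGd]
      refine (hNorm_add_five_le j
        (integrable_sub_comp_mul cz.continuous u w (mulS (partialS i u) g))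
        (integrable_sub_comp_mul czb.continuous u w (mulS (conjS (partialS i u)) g))
        (integrable_comp_mul cz.continuous w (mulS (partialS i (u - w)) g))
        (integrable_comp_mul czb.continuous w (mulS (conjS (partialS i (u - w))) g))
        (integrable_sub_comp_mul hG.continuous u w (partialS i g))).trans ?_
      have t1 := (hC₁ u w (mulS (partialS i u) g) hu hw).trans
        (mul_le_mul_right (hprod _ R ((hpu u i).trans hu)) _)
      have t2 := (hC₂ u w (mulS (conjS (partialS i u)) g) hu hw).trans
        (mul_le_mul_right (hprod _ R ((hNorm_conj _ _).trans_le ((hpu u i).trans hu))) _)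
      have t3 := (hD₁ w (mulS (partialS i (u - w)) g) hw).trans
        (mul_le_mul_right (hprod _ δ (hpu _ i)) _)
      have t4 := (hD₂ w (mulS (conjS (partialS i (u - w))) g) hw).trans
        (mul_le_mul_right (hprod _ δ ((hNorm_conj _ _).trans_le (hpu _ i))) _)
      have t5 := (hC₀ u w (partialS i g) hu hw).trans
        (mul_le_mul_right (hNorm_partialS_le j i g) _)
      rw [← hδ] at t1 t2 t5
      refine (add_le_add (add_le_add (add_le_add t1 t2) (add_le_add t3 t4)) t5).trans
        (le_of_eq ?_)
      push_cast
      ring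
    calc _ ≤ C₀ * (δ * hNorm (j + 1) g) + ∑ _i : Fin n,
          ((C₁ * (P * R) + C₂ * (P * R)) + (D₁ * P + D₂ * P) + C₀ : ℝ≥0) *
            (δ * hNorm (j + 1) g) := by
          gcongr with i
          · refine (hC₀ u w g hu hw).trans ?_
            rw [mul_assoc]
            gcongr
            exact hNorm_mono (by omega) _
          · exact hterm i
      _ = _ := by
          rw [Finset.sum_const, Finset.card_univ, Fintype.card_fin, nsmul_eq_mul]
          push_cast
          ring

lemma nice_sub_comp {F : ℂ → ℂ} (hF : ContDiff ℝ 1 F) (u w : 𝓢(Space n, ℂ)) :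
    Nice (fun x => F (u x) - F (w x)) :=
  ((nice_schwartz u).prodMk (nice_schwartz w)).comp
    (H := fun p : ℂ × ℂ => F p.1 - F p.2)
    ((hF.comp contDiff_fst).sub (hF.comp contDiff_snd)) (by simp)

lemma fderiv_sub_comp {F : ℂ → ℂ} (hF : Differentiable ℝ F) (u w : 𝓢(Space n, ℂ)) (i : Fin n)
    (x : Space n) : fderiv ℝ (fun x => F (u x) - F (w x)) x (stdVec i) =
      (((dz F (u x) - dz F (w x)) * partialS i u x +
        (dzb F (u x) - dzb F (w x)) * conjS (partialS i u) x) +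
      (dz F (w x) * partialS i (u - w) x + dzb F (w x) * conjS (partialS i (u - w)) x)) +
        (0 : 𝓢(Space n, ℂ)) x := by
  have hd : ∀ v : 𝓢(Space n, ℂ), HasFDerivAt (fun x => F (v x))
      ((fderiv ℝ F (v x)) ∘L (fderiv ℝ v x)) x := fun v =>
    (hF (v x)).hasFDerivAt.comp x v.differentiable.differentiableAt.hasFDerivAt
  rw [fderiv_fun_sub (hd u).differentiableAt (hd w).differentiableAt, (hd u).fderiv,
    (hd w).fderiv, partialS_sub]
  simp only [_root_.sub_apply, ContinuousLinearMap.comp_apply, fderiv_eq_wirtinger F,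
    partialS_apply, conjS_apply, map_sub, zero_apply]
  ring

/-- Composition with `F`, `F(0) = 0`, is Lipschitz on bounded subsets of `H^k`. -/
lemma exists_hNorm_sub_comp_le {k : ℕ} (hk : (n : ℝ) / 2 < k) (R : ℝ≥0) {F : ℂ → ℂ}
    (hF : ContDiff ℝ (k + 1 : ℕ) F) (j : ℕ) (hj : j ≤ k) :
    ∃ C : ℝ≥0, ∀ u w : 𝓢(Space n, ℂ), hNorm k u ≤ R → hNorm k w ≤ R →
      hNorm j (fun x => F (u x) - F (w x)) ≤ C * hNorm k (u - w : 𝓢(Space n, ℂ)) := by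
  have hF1 : ContDiff ℝ 1 F := hF.of_le (by norm_cast; omega)
  have hFd : Differentiable ℝ F := hF1.differentiable (by norm_num)
  induction j with
  | zero =>
    obtain ⟨L, hL⟩ := exists_lipschitz_comp hk hF1 R
    refine ⟨L, fun u w hu hw => ?_⟩
    refine (hNorm_zero_le_of_norm_le (g := u - w) (C := L) (nice_sub_comp hF1 u w).integrable
      (nice_sub_comp hF1 u w).memLp fun x => ?_).trans (by gcongr; exact hNorm_mono (by omega) _)
    exact hL _ _ (norm_le_of_hNorm_le hk hu x) (norm_le_of_hNorm_le hk hw x)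
  | succ j ih =>
    obtain ⟨C₀, hC₀⟩ := ih (by omega)
    have cz := contDiff_dz hF
    have czb := contDiff_dzb hF
    obtain ⟨C₁, hC₁⟩ := exists_hNorm_sub_comp_mul_le hk R j (by omega) (dz F)
      (cz.of_le (by norm_cast))
    obtain ⟨C₂, hC₂⟩ := exists_hNorm_sub_comp_mul_le hk R j (by omega) (dzb F)
      (czb.of_le (by norm_cast))
    obtain ⟨D₁, hD₁⟩ := exists_hNorm_comp_mul_le hk R j (by omega) (dz F)
      (cz.of_le (by norm_cast; omega))
    obtain ⟨D₂, hD₂⟩ := exists_hNorm_comp_mul_le hk R j (by omega) (dzb F)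
      (czb.of_le (by norm_cast; omega))
    refine ⟨C₀ + n * ((C₁ * R + C₂ * R) + (D₁ + D₂)), fun u w hu hw => ?_⟩
    set δ : ℝ≥0∞ := hNorm k (u - w : 𝓢(Space n, ℂ)) with hδ
    have hpu : ∀ (f : 𝓢(Space n, ℂ)) i, hNorm j (partialS i f) ≤ hNorm k f := fun f i =>
      (hNorm_partialS_le j i f).trans (hNorm_mono hj _)
    refine (hNorm_succ_le j (nice_sub_comp hF1 u w)).trans ?_
    have hterm : ∀ i, hNorm j (fun x => fderiv ℝ (fun x => F (u x) - F (w x)) x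
        (stdVec i)) ≤ ((C₁ * R + C₂ * R) + (D₁ + D₂) : ℝ≥0) * δ := by
      intro i
      simp only [fderiv_sub_comp hFd]
      refine (hNorm_add_five_le j
        (integrable_sub_comp_mul cz.continuous u w (partialS i u))
        (integrable_sub_comp_mul czb.continuous u w (conjS (partialS i u)))
        (integrable_comp_mul cz.continuous w (partialS i (u - w)))
        (integrable_comp_mul czb.continuous w (conjS (partialS i (u - w))))
        (0 : 𝓢(Space n, ℂ)).integrable).trans ?_
      have t1 := (hC₁ u w (partialS i u) hu hw).trans
        (mul_le_mul_right ((hpu u i).trans hu) _)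
      have t2 := (hC₂ u w (conjS (partialS i u)) hu hw).trans
        (mul_le_mul_right ((hNorm_conj _ _).trans_le ((hpu u i).trans hu)) _)
      have t3 := (hD₁ w (partialS i (u - w)) hw).trans (mul_le_mul_right (hpu _ i) _)
      have t4 := (hD₂ w (conjS (partialS i (u - w))) hw).trans
        (mul_le_mul_right ((hNorm_conj _ _).trans_le (hpu _ i)) _)
      have t5 : hNorm j (0 : 𝓢(Space n, ℂ)) = 0 := by
        have h0 : weighted j (0 : 𝓢(Space n, ℂ)) = 0 := by
          simpa using weighted_sub j (0 : 𝓢(Space n, ℂ)) 0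
        rw [hNorm_schwartz, h0, enorm_zero]
      rw [t5, add_zero]
      rw [← hδ] at t1 t2 t3 t4
      refine (add_le_add (add_le_add t1 t2) (add_le_add t3 t4)).trans (le_of_eq ?_)
      push_cast
      ring
    calc _ ≤ C₀ * δ + ∑ _i : Fin n, ((C₁ * R + C₂ * R) + (D₁ + D₂) : ℝ≥0) * δ := by
          gcongr with i
          · exact hC₀ u w hu hw
          · exact hterm i
      _ = _ := by
          rw [Finset.sum_const, Finset.card_univ, Fintype.card_fin, nsmul_eq_mul]
          push_cast
          ring

/-! ### The composition operator on `H^k` -/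

/-- A continuous integrable function with finite `H^k` norm is given by an element of the
parametrization of `H^k`. -/
lemma exists_evalAt_eq {k : ℕ} (hk : (n : ℝ) / 2 < k) {h : Space n → ℂ} (hc : Continuous h)
    (hi : Integrable h) (hf : hNorm k h < ∞) :
    ∃ ψ : L2 n, (∀ x, evalAt hk x ψ = h x) ∧ ‖ψ‖ₑ = hNorm k h := by
  have hm : MemLp (fun ξ => ((jap ξ ^ k : ℝ) : ℂ) * 𝓕 h ξ) 2 volume :=
    ⟨(continuous_weight_mul_fourier k hi).aestronglyMeasurable, hf⟩
  have hint : Integrable (𝓕 h) := by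
    refine (MemLp.integrable_mul (memLp_japInv hk) hm).congr (ae_of_all _ fun ξ => ?_)
    simp only [Pi.mul_apply, japInv_apply]
    rw [← mul_assoc, ← Complex.ofReal_mul, inv_mul_cancel₀ (pow_pos (jap_pos ξ) k).ne',
      Complex.ofReal_one, one_mul]
  refine ⟨hm.toLp, fun x => ?_, ?_⟩
  · rw [evalAt_eq_fourierInv hk x hm.coeFn_toLp, hc.fourierInv_fourier_eq hi hint]
  · rw [Lp.enorm_toLp]
    rfl

lemma exists_evalAt_eq_comp {k : ℕ} (hk : (n : ℝ) / 2 < k) {F : ℂ → ℂ}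
    (hF : ContDiff ℝ (k + 1 : ℕ) F) (hF0 : F 0 = 0) (u : 𝓢(Space n, ℂ)) :
    ∃ χ : L2 n, ∀ x, evalAt hk x χ = F (u x) := by
  have hF1 : ContDiff ℝ 1 F := hF.of_le (by norm_cast; omega)
  have h1 := nice_sub_comp hF1 u 0
  obtain ⟨C, hC⟩ := exists_hNorm_sub_comp_le hk (hNorm k u).toNNReal hF k le_rfl
  have h2 := hC u 0 (by rw [ENNReal.coe_toNNReal (hNorm_schwartz_lt_top k u).ne]) (by
    have h0 : weighted k (0 : 𝓢(Space n, ℂ)) = 0 := by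
      simpa using weighted_sub k (0 : 𝓢(Space n, ℂ)) 0
    rw [hNorm_schwartz, h0, enorm_zero]
    exact zero_le)
  obtain ⟨χ, hχ, -⟩ := exists_evalAt_eq hk h1.contDiff.continuous h1.integrable
    (h2.trans_lt (ENNReal.mul_lt_top ENNReal.coe_lt_top (hNorm_schwartz_lt_top k _)))
  exact ⟨χ, fun x => by rw [hχ, zero_apply, hF0, sub_zero]⟩

/-- The bound for the composition operator on Schwartz functions, in terms of the parametrization of
`H^k` by `L²`. -/
lemma exists_norm_sub_le_of_evalAt_eq {k : ℕ} (hk : (n : ℝ) / 2 < k) {F : ℂ → ℂ}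
    (hF : ContDiff ℝ (k + 1 : ℕ) F) (R : ℝ≥0) :
    ∃ C : ℝ≥0, ∀ (u w : 𝓢(Space n, ℂ)) (χ θ : L2 n), ‖weighted k u‖ ≤ R → ‖weighted k w‖ ≤ R →
      (∀ x, evalAt hk x χ = F (u x)) → (∀ x, evalAt hk x θ = F (w x)) →
      ‖χ - θ‖ ≤ C * ‖weighted k u - weighted k w‖ := by
  have hF1 : ContDiff ℝ 1 F := hF.of_le (by norm_cast; omega)
  obtain ⟨C, hC⟩ := exists_hNorm_sub_comp_le hk R hF k le_rfl
  refine ⟨C, fun u w χ θ hu hw hχ hθ => ?_⟩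
  have hR : ∀ v : 𝓢(Space n, ℂ), ‖weighted k v‖ ≤ R → hNorm k v ≤ R := by
    intro v hv
    rw [hNorm_schwartz, ← ofReal_norm, ← ENNReal.ofReal_coe_nnreal]
    exact ENNReal.ofReal_le_ofReal hv
  have h1 := nice_sub_comp hF1 u w
  have h2 := hC u w (hR u hu) (hR w hw)
  obtain ⟨ψ, hψ, hn⟩ := exists_evalAt_eq hk h1.contDiff.continuous h1.integrable
    (h2.trans_lt (ENNReal.mul_lt_top ENNReal.coe_lt_top (hNorm_schwartz_lt_top k _)))
  have e : χ - θ = ψ := eq_of_evalAt_eq hk fun x => by rw [map_sub, hχ, hθ, hψ]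
  rw [← hn, hNorm_schwartz, weighted_sub, ← ofReal_norm, ← ofReal_norm,
    ← ENNReal.ofReal_coe_nnreal, ← ENNReal.ofReal_mul C.coe_nonneg,
    ENNReal.ofReal_le_ofReal_iff (by positivity)] at h2
  rwa [e]

/-- Passage to the limit from Schwartz functions to `H^k`: the compositions form a Cauchy sequence,
and its limit is identified by point evaluations. -/
lemma exists_tendsto_comp {k : ℕ} (hk : (n : ℝ) / 2 < k) {F : ℂ → ℂ}
    (hF : ContDiff ℝ (k + 1 : ℕ) F) {ψ : L2 n} {f : ℕ → 𝓢(Space n, ℂ)}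
    {χ : ℕ → L2 n} (hχ : ∀ i x, evalAt hk x (χ i) = F (f i x))
    (hf : Tendsto (fun i => weighted k (f i)) atTop (𝓝 ψ)) :
    ∃ θ : L2 n, Tendsto χ atTop (𝓝 θ) ∧ ∀ x, evalAt hk x θ = F (evalAt hk x ψ) := by
  obtain ⟨r, hr⟩ := (Metric.isBounded_range_of_tendsto _ hf).subset_closedBall 0
  have hr' : ∀ i, ‖weighted k (f i)‖ ≤ r.toNNReal := fun i =>
    (by simpa using hr (Set.mem_range_self i) : ‖weighted k (f i)‖ ≤ r).trans
      (Real.le_coe_toNNReal r)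
  obtain ⟨C, hC⟩ := exists_norm_sub_le_of_evalAt_eq hk hF r.toNNReal
  have hcau : CauchySeq χ := by
    have h1 := hf.cauchySeq
    rw [Metric.cauchySeq_iff] at h1 ⊢
    intro ε hε
    obtain ⟨N, hN⟩ := h1 (ε / (C + 1)) (by positivity)
    refine ⟨N, fun i hi j hj => ?_⟩
    have h2 := hN i hi j hj
    rw [dist_eq_norm, lt_div_iff₀ (by positivity)] at h2
    rw [dist_eq_norm]
    refine (hC _ _ _ _ (hr' i) (hr' j) (hχ i) (hχ j)).trans_lt (lt_of_le_of_lt ?_ h2)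
    nlinarith [norm_nonneg (weighted k (f i) - weighted k (f j))]
  obtain ⟨θ, hθ⟩ := cauchySeq_tendsto_of_complete hcau
  refine ⟨θ, hθ, fun x => ?_⟩
  refine tendsto_nhds_unique (((evalAt hk x).continuous.tendsto θ).comp hθ) ?_
  have h3 := (hF.continuous.tendsto _).comp (((evalAt hk x).continuous.tendsto ψ).comp hf)
  refine h3.congr fun i => ?_
  simp only [Function.comp_apply]
  rw [hχ, evalAt_weighted]

/-- The composition operator `u ↦ F ∘ u` on `H^k`, in the parametrization of `H^k` by `L²`. -/
lemma exists_compositionOperator {k : ℕ} (hk : (n : ℝ) / 2 < k) {F : ℂ → ℂ}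
    (hF : ContDiff ℝ (k + 1 : ℕ) F) (hF0 : F 0 = 0) :
    ∃ N : L2 n → L2 n, (∀ ψ x, evalAt hk x (N ψ) = F (evalAt hk x ψ)) ∧
      ∀ R : ℝ, ∃ C : ℝ≥0, LipschitzOnWith C N (Metric.closedBall 0 R) := by
  choose χ hχ using exists_evalAt_eq_comp (n := n) hk hF hF0
  have hex : ∀ ψ : L2 n, ∃ θ : L2 n, ∀ x, evalAt hk x θ = F (evalAt hk x ψ) := by
    intro ψ
    obtain ⟨f, hf⟩ := exists_seq_weighted_tendsto k ψ
    obtain ⟨θ, -, hθ⟩ := exists_tendsto_comp hk hF (fun i => hχ (f i)) hf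
    exact ⟨θ, hθ⟩
  choose N hN using hex
  refine ⟨N, hN, fun R => ?_⟩
  obtain ⟨C, hC⟩ := exists_norm_sub_le_of_evalAt_eq hk hF (R + 1).toNNReal (n := n)
  refine ⟨C, LipschitzOnWith.of_dist_le_mul fun ψ hψ φ hφ => ?_⟩
  obtain ⟨f, hf⟩ := exists_seq_weighted_tendsto k ψ
  obtain ⟨g, hg⟩ := exists_seq_weighted_tendsto k φ
  obtain ⟨θ, h1, hθ⟩ := exists_tendsto_comp hk hF (fun i => hχ (f i)) hf
  obtain ⟨θ', h1', hθ'⟩ := exists_tendsto_comp hk hF (fun i => hχ (g i)) hg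
  have e : θ = N ψ := eq_of_evalAt_eq hk fun x => by rw [hθ, hN]
  have e' : θ' = N φ := eq_of_evalAt_eq hk fun x => by rw [hθ', hN]
  rw [← e, ← e', dist_eq_norm, dist_eq_norm]
  have hlt : ∀ {ψ : L2 n} {f : ℕ → 𝓢(Space n, ℂ)}, ψ ∈ Metric.closedBall 0 R →
      Tendsto (fun i => weighted k (f i)) atTop (𝓝 ψ) →
      ∀ᶠ i in atTop, ‖weighted k (f i)‖ ≤ (R + 1).toNNReal := by
    intro ψ f hψ hf
    have h2 : ‖ψ‖ < R + 1 := by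
      have : ‖ψ‖ ≤ R := by simpa using hψ
      linarith
    filter_upwards [hf.norm.eventually (gt_mem_nhds h2)] with i hi
    exact hi.le.trans (Real.le_coe_toNNReal _)
  refine le_of_tendsto_of_tendsto (h1.sub h1').norm ((hf.sub hg).norm.const_mul (C : ℝ)) ?_
  filter_upwards [hlt hψ hf, hlt hφ hg] with i hi hi'
  exact hC _ _ _ _ hi hi' (hχ _) (hχ _)

end

/-! ### Regularity of the power nonlinearity -/

section

open scoped LineDeriv ContDiff

lemma norm_le_of_homogeneous {E F : Type*} [NormedAddCommGroup E] [NormedSpace ℝ E] [ProperSpace E]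
    [NormedAddCommGroup F] [NormedSpace ℝ F] {f : E → F} {α : ℝ}
    (hf : ContinuousOn f {0}ᶜ) (h0 : f 0 = 0)
    (hom : ∀ t : ℝ, 0 < t → ∀ z, f (t • z) = t ^ α • f z) :
    ∃ C, 0 ≤ C ∧ ∀ z, ‖f z‖ ≤ C * ‖z‖ ^ α := by
  obtain ⟨C, hC⟩ := (isCompact_sphere (0 : E) 1).exists_bound_of_continuousOn
    (hf.mono fun z hz h => by simp [Set.mem_singleton_iff.1 h] at hz)
  refine ⟨max C 0, le_max_right _ _, fun z => ?_⟩
  rcases eq_or_ne z 0 with rfl | hz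
  · rw [h0, norm_zero]
    positivity
  · have hz' : 0 < ‖z‖ := norm_pos_iff.2 hz
    have h1 : f z = ‖z‖ ^ α • f (‖z‖⁻¹ • z) := by
      rw [← hom _ hz', smul_smul, mul_inv_cancel₀ hz'.ne', one_smul]
    rw [h1, norm_smul, Real.norm_of_nonneg (by positivity), mul_comm]
    refine mul_le_mul_of_nonneg_right ((hC _ ?_).trans (le_max_left _ _)) (by positivity)
    simp [norm_smul, hz]

/-- A function that is smooth away from the origin and positively homogeneous of degree `α > j` is of
class `C^j`. -/
lemma contDiff_of_homogeneous {E : Type} [NormedAddCommGroup E] [NormedSpace ℝ E] [ProperSpace E]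
    (j : ℕ) : ∀ {F : Type} [NormedAddCommGroup F] [NormedSpace ℝ F] {f : E → F} {α : ℝ},
      ContDiffOn ℝ ∞ f {0}ᶜ → f 0 = 0 → (∀ t : ℝ, 0 < t → ∀ z, f (t • z) = t ^ α • f z) →
      (j : ℝ) < α → ContDiff ℝ j f := by
  induction j with
  | zero =>
    intro F _ _ f α hf h0 hom hα
    obtain ⟨C, hC0, hC⟩ := norm_le_of_homogeneous hf.continuousOn h0 hom
    rw [Nat.cast_zero] at hα
    refine contDiff_zero.2 (continuous_iff_continuousAt.2 fun z => ?_)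
    rcases eq_or_ne z 0 with rfl | hz
    · rw [ContinuousAt, h0]
      refine squeeze_zero_norm hC ?_
      have h1 : Continuous fun z : E => C * ‖z‖ ^ α :=
        continuous_const.mul (continuous_norm.rpow_const fun _ => Or.inr hα.le)
      simpa [Real.zero_rpow hα.ne'] using h1.tendsto 0
    · exact hf.continuousOn.continuousAt (isOpen_compl_singleton.mem_nhds hz)
  | succ j ih =>
    intro F _ _ f α hf h0 hom hα
    push_cast at hα
    have hj : (0 : ℝ) ≤ j := j.cast_nonneg
    obtain ⟨C, hC0, hC⟩ := norm_le_of_homogeneous hf.continuousOn h0 hom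
    -- `α > 1`, so that the derivative at the origin exists and vanishes; the derivative of `f` is
    -- homogeneous of degree `α - 1`
    have hzero : HasFDerivAt f (0 : E →L[ℝ] F) 0 := by
      refine .of_isLittleO ?_
      simp only [h0, sub_zero, _root_.zero_apply]
      rw [Asymptotics.isLittleO_iff]
      intro c hc
      have h1 : Continuous fun z : E => C * ‖z‖ ^ (α - 1) :=
        continuous_const.mul (continuous_norm.rpow_const fun _ => Or.inr (by linarith))
      have h2 := h1.tendsto 0
      rw [norm_zero, Real.zero_rpow (by linarith), mul_zero] at h2
      filter_upwards [h2.eventually (gt_mem_nhds hc)] with z hz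
      rcases eq_or_ne z 0 with rfl | hz0
      · simp [h0]
      · refine (hC z).trans ?_
        have hz' : 0 < ‖z‖ := norm_pos_iff.2 hz0
        have : ‖z‖ ^ α = ‖z‖ ^ (α - 1) * ‖z‖ := by
          rw [Real.rpow_sub_one hz'.ne', div_mul_cancel₀ _ hz'.ne']
        rw [this, ← mul_assoc]
        gcongr
    have hd : Differentiable ℝ f := by
      intro z
      rcases eq_or_ne z 0 with rfl | hz
      · exact hzero.differentiableAt
      · exact (hf.contDiffAt (isOpen_compl_singleton.mem_nhds hz)).differentiableAt (by simp)
    rw [show ((j + 1 : ℕ) : WithTop ℕ∞) = (j : WithTop ℕ∞) + 1 by norm_cast,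
      contDiff_succ_iff_fderiv]
    refine ⟨hd, by simp, ih (α := α - 1) ?_ hzero.fderiv ?_ (by linarith)⟩
    · exact hf.fderiv_of_isOpen isOpen_compl_singleton (by simp)
    · intro t ht z
      have h1 : HasFDerivAt (fun z => f (t • z)) (fderiv ℝ f (t • z) ∘L
          (t • ContinuousLinearMap.id ℝ E)) z :=
        (hd (t • z)).hasFDerivAt.comp z ((hasFDerivAt_id z).const_smul t)
      have h2 : HasFDerivAt (fun z => f (t • z)) (t ^ α • fderiv ℝ f z) z := by
        simp only [hom t ht]
        exact (hd z).hasFDerivAt.const_smul _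
      have h3 := h1.unique h2
      have h4 : t • fderiv ℝ f (t • z) = t ^ α • fderiv ℝ f z := by
        rw [← h3]
        ext v
        simp
      rw [Real.rpow_sub_one ht.ne', div_eq_inv_mul, mul_smul, ← h4, smul_smul,
        inv_mul_cancel₀ ht.ne', one_smul]

lemma nonlinearity_zero (κ : ℝ) : nonlinearity κ 0 = 0 := by simp [nonlinearity]

lemma nonlinearity_ofReal_mul (κ : ℝ) {t : ℝ} (ht : 0 < t) (z : ℂ) :
    nonlinearity κ (t * z) = ((t ^ κ : ℝ) : ℂ) * nonlinearity κ z := by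
  rw [nonlinearity, nonlinearity, norm_mul, Complex.norm_real, Real.norm_of_nonneg ht.le,
    Real.mul_rpow ht.le (norm_nonneg z), Real.rpow_sub_one ht.ne']
  have : (t : ℂ) ≠ 0 := by exact_mod_cast ht.ne'
  push_cast
  field_simp

lemma nonlinearity_conj (κ : ℝ) (z : ℂ) :
    nonlinearity κ ((starRingEnd ℂ) z) = (starRingEnd ℂ) (nonlinearity κ z) := by
  simp [nonlinearity]

lemma contDiff_nonlinearity {κ : ℝ} (hκ : 1 < κ) {k : ℕ}
    (hsmooth : (∃ m : ℕ, Odd m ∧ κ = m) ∨ (k : ℝ) + 2 ≤ κ) :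
    ContDiff ℝ (k + 1 : ℕ) (nonlinearity κ) := by
  rcases hsmooth with ⟨m, ⟨l, rfl⟩, rfl⟩ | h
  · have : nonlinearity ((2 * l + 1 : ℕ) : ℝ) = fun z => (((‖z‖ ^ 2) ^ l : ℝ) : ℂ) * z := by
      ext z
      rw [nonlinearity, ← pow_mul, ← Real.rpow_natCast]
      congr 3
      push_cast
      ring
    rw [this]
    exact (Complex.ofRealCLM.contDiff.comp ((contDiff_norm_sq ℝ).pow l)).mul contDiff_id
  · refine contDiff_of_homogeneous (k + 1) (α := κ) ?_ (nonlinearity_zero κ) ?_ (by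
      push_cast; linarith)
    · intro z hz
      have hz0 : z ≠ 0 := hz
      refine ContDiffAt.contDiffWithinAt ?_
      refine ContDiffAt.mul (Complex.ofRealCLM.contDiff.contDiffAt.comp z ?_) contDiffAt_id
      exact (contDiffAt_norm ℝ hz0).rpow_const_of_ne (norm_ne_zero_iff.2 hz0)
    · intro t ht z
      rw [Complex.real_smul, Complex.real_smul, nonlinearity_ofReal_mul κ ht]

end

/-! ### The linear beam equation on the Fourier side -/

/-- A function whose images under sufficiently many functionals have the right derivatives is
differentiable. -/
lemma hasDerivWithinAt_of_separating {ι E F : Type*} [NormedAddCommGroup E] [NormedSpace ℝ E]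
    [CompleteSpace E] [NormedAddCommGroup F] [NormedSpace ℝ F] (L : ι → E →L[ℝ] F)
    (hL : ∀ x, (∀ i, L i x = 0) → x = 0) {T : ℝ} (hT : 0 ≤ T) {z G : ℝ → E}
    (hG : ContinuousOn G (Set.Icc 0 T))
    (h : ∀ i, ∀ t ∈ Set.Icc 0 T, HasDerivWithinAt (fun r => L i (z r)) (L i (G t))
        (Set.Icc 0 T) t) :
    ∀ t ∈ Set.Icc 0 T, HasDerivWithinAt z (G t) (Set.Icc 0 T) t := by
  set G' : ℝ → E := Set.IccExtend hT ((Set.Icc 0 T).domRestrict G) with hG'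
  have hG'c : Continuous G' := hG.domRestrict.Icc_extend'
  have hG'e : ∀ t ∈ Set.Icc 0 T, G' t = G t := fun t ht => Set.IccExtend_of_mem hT _ ht
  set D : ℝ → E := fun t => ∫ s in (0 : ℝ)..t, G' s with hD
  have hDd : ∀ t, HasDerivAt D (G' t) t := fun t =>
    intervalIntegral.integral_hasDerivAt_right (hG'c.intervalIntegrable _ _)
      (hG'c.stronglyMeasurableAtFilter _ _) hG'c.continuousAt
  have key : ∀ t ∈ Set.Icc 0 T, z t = z 0 + D t := by
    intro t ht
    rw [← sub_eq_zero]
    refine hL _ fun i => ?_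
    have hd : ∀ r ∈ Set.Icc 0 T, HasDerivWithinAt (fun r => L i (z r - (z 0 + D r))) 0
        (Set.Icc 0 T) r := by
      intro r hr
      have h1 := (L i).hasFDerivAt.comp_hasDerivWithinAt r
        ((hDd r).hasDerivWithinAt (s := Set.Icc 0 T))
      have h2 := ((h i r hr).sub h1).sub_const (L i (z 0))
      rw [hG'e r hr, sub_self] at h2
      refine h2.congr_of_mem (fun y _ => ?_) hr
      simp only [map_sub, map_add, Pi.sub_apply, Function.comp_apply]
      abel
    have h3 := constant_of_derivWithin_zero
      (fun r hr => (hd r hr).differentiableWithinAt) (fun r hr => by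
        have hr' := Set.Ico_subset_Icc_self hr
        refine (hd r hr').derivWithin (uniqueDiffOn_Icc (hr.1.trans_lt hr.2) r hr')) t ht
    rw [h3]
    simp [hD]
  intro t ht
  have h4 := ((hDd t).hasDerivWithinAt (s := Set.Icc 0 T)).const_add (z 0)
  rw [hG'e t ht] at h4
  exact h4.congr key (key t ht)

/-- The symbol `√(1 + c² (2π‖ξ‖)⁴)` of `(1 + c² Δ²)^{1/2}`. -/
def om (c : ℝ) (ξ : Space n) : ℝ := √(1 + c ^ 2 * (2 * Real.pi * ‖ξ‖) ^ 4)

lemma om_sq (c : ℝ) (ξ : Space n) : om c ξ ^ 2 = 1 + c ^ 2 * (2 * Real.pi * ‖ξ‖) ^ 4 :=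
  Real.sq_sqrt (by positivity)

lemma one_le_om (c : ℝ) (ξ : Space n) : 1 ≤ om c ξ := by
  rw [om, Real.one_le_sqrt]
  linarith [show 0 ≤ c ^ 2 * (2 * Real.pi * ‖ξ‖) ^ 4 by positivity]

lemma om_pos (c : ℝ) (ξ : Space n) : 0 < om c ξ := zero_lt_one.trans_le (one_le_om c ξ)

lemma om_ne_zero (c : ℝ) (ξ : Space n) : (om c ξ : ℂ) ≠ 0 := by
  exact_mod_cast (om_pos c ξ).ne'

lemma continuous_om (c : ℝ) : Continuous (om c : Space n → ℝ) := by unfold om; fun_prop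

lemma continuous_om_left (ξ : Space n) : Continuous (fun c => om c ξ) := by unfold om; fun_prop

lemma om_neg (c : ℝ) (ξ : Space n) : om c (-ξ) = om c ξ := by simp [om]

lemma om_le (c : ℝ) (ξ : Space n) : om c ξ ≤ (1 + |c|) * jap ξ ^ 2 := by
  refine Real.sqrt_le_iff.2 ⟨by positivity, ?_⟩
  rw [jap_sq]
  set p := (2 * Real.pi * ‖ξ‖) ^ 2 with hp
  have h1 : (2 * Real.pi * ‖ξ‖) ^ 4 = p ^ 2 := by rw [hp]; ring
  have hp0 : 0 ≤ p := by positivity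
  have h2 : c ^ 2 = |c| ^ 2 := (sq_abs c).symm
  rw [h1, h2, mul_pow]
  have hc := abs_nonneg c
  nlinarith [mul_nonneg hc hp0, mul_nonneg (mul_nonneg hc hc) hp0, mul_nonneg hc (sq_nonneg p),
    sq_nonneg p]

lemma jap_sq_le {c : ℝ} (hc : c ≠ 0) (ξ : Space n) : jap ξ ^ 2 ≤ 2 * (1 + |c|⁻¹) * om c ξ := by
  have hc' : 0 < |c| := abs_pos.2 hc
  have h0 := om_pos c ξ
  refine le_of_sq_le_sq ?_ (by positivity)
  rw [mul_pow _ (om c ξ), om_sq, jap_sq]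
  set p := (2 * Real.pi * ‖ξ‖) ^ 2 with hp
  have h1 : (2 * Real.pi * ‖ξ‖) ^ 4 = p ^ 2 := by rw [hp]; ring
  have h2 : |c|⁻¹ * |c| = 1 := inv_mul_cancel₀ hc'.ne'
  have h3 : c ^ 2 = |c| ^ 2 := (sq_abs c).symm
  have hp0 : 0 ≤ p := by positivity
  rw [h1, h3]
  have h4 : (2 * (1 + |c|⁻¹)) ^ 2 * (1 + |c| ^ 2 * p ^ 2) =
      4 * ((1 + |c|⁻¹) ^ 2 + (|c| + 1) ^ 2 * p ^ 2) := by
    have : (|c| + 1) ^ 2 = (1 + |c|⁻¹) ^ 2 * |c| ^ 2 := by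
      rw [← mul_pow, add_mul, h2, one_mul]
    rw [this]
    ring
  rw [h4]
  have hi : 0 < |c|⁻¹ := inv_pos.2 hc'
  nlinarith [sq_nonneg (p - 1), mul_nonneg hc'.le (sq_nonneg p), sq_nonneg p,
    mul_nonneg (mul_nonneg hc'.le hc'.le) (sq_nonneg p)]

/-- The multiplier `e^{i t ω(ξ)}`. -/
def phase (c t : ℝ) : Space n →ᵇ ℂ :=
  bddMul (fun ξ => Complex.exp (Complex.I * ((om c ξ * t : ℝ) : ℂ)))
    (Complex.continuous_exp.comp (continuous_const.mul (Complex.continuous_ofReal.comp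
      ((continuous_om c).mul continuous_const)))) 1
    (fun _ => (Complex.norm_exp_I_mul_ofReal _).le)

lemma phase_apply (c t : ℝ) (ξ : Space n) :
    phase c t ξ = Complex.exp (Complex.I * ((om c ξ * t : ℝ) : ℂ)) := rfl

lemma norm_bddMul_le (m : Space n → ℂ) (hc : Continuous m) {C : ℝ} (h : ∀ ξ, ‖m ξ‖ ≤ C)
    (hC : 0 ≤ C) : ‖bddMul m hc C h‖ ≤ C :=
  (BoundedContinuousFunction.norm_le hC).2 h

lemma norm_phase_le (c t : ℝ) : ‖(phase c t : Space n →ᵇ ℂ)‖ ≤ 1 :=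
  norm_bddMul_le _ _ _ zero_le_one

lemma phase_mul_phase_neg (c t : ℝ) (ξ : Space n) : phase c t ξ * phase c (-t) ξ = 1 := by
  rw [phase_apply, phase_apply, ← Complex.exp_add]
  simp

lemma conj_phase (c t : ℝ) (ξ : Space n) :
    (starRingEnd ℂ) (phase c t (-ξ)) = phase c (-t) ξ := by
  rw [phase_apply, phase_apply, ← Complex.exp_conj, om_neg]
  simp

lemma mulOp_congr {m₁ m₂ : Space n →ᵇ ℂ} (h : ∀ ξ, m₁ ξ = m₂ ξ) (f : L2 n) :
    mulOp m₁ f = mulOp m₂ f := by rw [BoundedContinuousFunction.ext h]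

lemma mulOp_phase_phase_neg (c t : ℝ) (f : L2 n) :
    mulOp (phase c t) (mulOp (phase c (-t)) f) = f := by
  rw [mulOp_mulOp, mulOp_const 1 f (fun ξ => by
    rw [BoundedContinuousFunction.mul_apply, phase_mul_phase_neg]), one_smul]

lemma mulOp_phase_neg_phase (c t : ℝ) (f : L2 n) :
    mulOp (phase c (-t)) (mulOp (phase c t) f) = f := by
  simpa using mulOp_phase_phase_neg c (-t) f

/-- The multiplier `1/ω(ξ)`. -/
def omInv (c : ℝ) : Space n →ᵇ ℂ :=
  bddMul (fun ξ => (((om c ξ)⁻¹ : ℝ) : ℂ))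
    (Complex.continuous_ofReal.comp ((continuous_om c).inv₀ fun ξ => (om_pos c ξ).ne')) 1
    (fun ξ => by
      rw [Complex.norm_real, norm_inv, Real.norm_of_nonneg (om_pos c ξ).le]
      exact inv_le_one_of_one_le₀ (one_le_om c ξ))

lemma omInv_apply (c : ℝ) (ξ : Space n) : omInv c ξ = (om c ξ : ℂ)⁻¹ := by
  change (((om c ξ)⁻¹ : ℝ) : ℂ) = _
  push_cast
  rfl

lemma norm_omInv_le (c : ℝ) : ‖(omInv c : Space n →ᵇ ℂ)‖ ≤ 1 := norm_bddMul_le _ _ _ zero_le_one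

/-- The multiplier `ω(ξ) ⟨2πξ⟩^{-2}`. -/
def omJap (c : ℝ) : Space n →ᵇ ℂ :=
  bddMul (fun ξ => ((om c ξ * (jap ξ ^ 2)⁻¹ : ℝ) : ℂ))
    (Complex.continuous_ofReal.comp ((continuous_om c).mul ((continuous_jap.pow 2).inv₀
      fun ξ => (pow_pos (jap_pos ξ) 2).ne'))) (1 + |c|)
    (fun ξ => by
      have := jap_pos ξ
      have h0 := om_pos c ξ
      rw [Complex.norm_real, Real.norm_of_nonneg (by positivity), ← div_eq_mul_inv,
        div_le_iff₀ (by positivity)]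
      exact om_le c ξ)

lemma omJap_apply (c : ℝ) (ξ : Space n) :
    omJap c ξ = (om c ξ : ℂ) * ((jap ξ : ℂ) ^ 2)⁻¹ := by
  change ((om c ξ * (jap ξ ^ 2)⁻¹ : ℝ) : ℂ) = _
  push_cast
  rfl

/-- The multiplier `⟨2πξ⟩² / ω(ξ)`, which is bounded for `c ≠ 0`. -/
def japOm {c : ℝ} (hc : c ≠ 0) : Space n →ᵇ ℂ :=
  bddMul (fun ξ => ((jap ξ ^ 2 * (om c ξ)⁻¹ : ℝ) : ℂ))
    (Complex.continuous_ofReal.comp ((continuous_jap.pow 2).mul ((continuous_om c).inv₀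
      fun ξ => (om_pos c ξ).ne'))) (2 * (1 + |c|⁻¹))
    (fun ξ => by
      have := jap_pos ξ
      have h0 := om_pos c ξ
      rw [Complex.norm_real, Real.norm_of_nonneg (by positivity), ← div_eq_mul_inv,
        div_le_iff₀ (by positivity)]
      exact jap_sq_le hc ξ)

lemma japOm_apply {c : ℝ} (hc : c ≠ 0) (ξ : Space n) :
    japOm hc ξ = (jap ξ : ℂ) ^ 2 * (om c ξ : ℂ)⁻¹ := by
  change ((jap ξ ^ 2 * (om c ξ)⁻¹ : ℝ) : ℂ) = _
  push_cast
  rfl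

lemma japInv_apply' (k : ℕ) (ξ : Space n) : japInv n k ξ = ((jap ξ : ℂ) ^ k)⁻¹ := by
  rw [japInv_apply]
  push_cast
  rfl

lemma jap_ne_zero (ξ : Space n) : (jap ξ : ℂ) ≠ 0 := by exact_mod_cast (jap_pos ξ).ne'

lemma norm_exp_I_sub_le (a b : ℝ) :
    ‖Complex.exp (Complex.I * (a : ℂ)) - Complex.exp (Complex.I * (b : ℂ))‖ ≤ |a - b| := by
  have h : Complex.exp (Complex.I * (a : ℂ)) - Complex.exp (Complex.I * (b : ℂ)) =
      Complex.exp (Complex.I * (b : ℂ)) * (Complex.exp (Complex.I * ((a - b : ℝ) : ℂ)) - 1) := by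
    rw [mul_sub, ← Complex.exp_add, mul_one]
    congr 2
    push_cast
    ring
  rw [h, norm_mul, Complex.norm_exp_I_mul_ofReal, one_mul]
  exact Real.norm_exp_I_mul_ofReal_sub_one_le

/-- Product rule for `θ e^{i a r ω} f(r)`, where the multiplier `θ` compensates the loss of the factor
`ω`. -/
lemma hasDerivWithinAt_phase {c : ℝ} {θ θ' : Space n →ᵇ ℂ}
    (hθ : ∀ ξ, θ' ξ = Complex.I * om c ξ * θ ξ) (a : ℝ) {f : ℝ → L2 n} {f' : L2 n} {S : Set ℝ}
    {t : ℝ} (hf : HasDerivWithinAt f f' S t) :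
    HasDerivWithinAt (fun r => mulOp θ (mulOp (phase c (a * r)) (f r)))
      ((a : ℂ) • mulOp θ' (mulOp (phase c (a * t)) (f t)) + mulOp θ (mulOp (phase c (a * t)) f'))
      S t := by
  have h := hasDerivWithinAt_mulOp (m := fun r => θ * phase c (a * r))
    (m' := (a : ℂ) • (θ' * phase c (a * t))) (B := ‖θ'‖ * |a|) (C := ‖θ‖ * 1) (S := S) (t := t)
    (fun r => (norm_mul_le _ _).trans
      (mul_le_mul_of_nonneg_left (norm_phase_le _ _) (norm_nonneg _))) ?_ ?_ hf
  · simpa only [mulOp_smul, mulOp_mulOp] using h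
  · intro r ξ
    rw [BoundedContinuousFunction.mul_apply, BoundedContinuousFunction.mul_apply, ← mul_sub,
      norm_mul, phase_apply, phase_apply]
    have h1 := norm_exp_I_sub_le (om c ξ * (a * r)) (om c ξ * (a * t))
    have h2 : |om c ξ * (a * r) - om c ξ * (a * t)| = om c ξ * (|a| * |r - t|) := by
      rw [← mul_sub, ← mul_sub, abs_mul, abs_mul, abs_of_pos (om_pos c ξ)]
    have h3 : ‖θ' ξ‖ = om c ξ * ‖θ ξ‖ := by
      rw [hθ, norm_mul, norm_mul, Complex.norm_I, one_mul, Complex.norm_real,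
        Real.norm_of_nonneg (om_pos c ξ).le]
    calc _ ≤ ‖θ ξ‖ * (om c ξ * (|a| * |r - t|)) := by
          rw [← h2]; exact mul_le_mul_of_nonneg_left h1 (norm_nonneg _)
      _ = ‖θ' ξ‖ * (|a| * |r - t|) := by rw [h3]; ring
      _ ≤ ‖θ'‖ * (|a| * |r - t|) :=
          mul_le_mul_of_nonneg_right (θ'.norm_coe_le_norm ξ) (by positivity)
      _ = _ := by ring
  · intro ξ
    have h1 : HasDerivAt (fun r : ℝ => Complex.I * ((om c ξ * (a * r) : ℝ) : ℂ))
        (Complex.I * ((om c ξ * a : ℝ) : ℂ)) t := by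
      have h0 : HasDerivAt (fun r : ℝ => om c ξ * (a * r)) (om c ξ * a) t := by
        simpa using ((hasDerivAt_id t).const_mul a).const_mul (om c ξ)
      exact h0.ofReal_comp.const_mul _
    have h2 := h1.cexp.const_mul (θ ξ)
    refine h2.congr_deriv ?_
    simp only [BoundedContinuousFunction.coe_smul, BoundedContinuousFunction.mul_apply, hθ,
      phase_apply, smul_eq_mul]
    push_cast
    ring

/-- The Fourier transform of `Δ² φ`. -/
lemma fourierInv_bilaplacian (φ : 𝓢(Space n, ℂ)) (ξ : Space n) :
    (𝓕⁻ (Δ (Δ φ) : 𝓢(Space n, ℂ)) : 𝓢(Space n, ℂ)) ξ =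
      (((2 * Real.pi * ‖ξ‖) ^ 4 : ℝ) : ℂ) * (𝓕⁻ φ : 𝓢(Space n, ℂ)) ξ := by
  have h1 : ∀ (f : 𝓢(Space n, ℂ)) (η : Space n), (𝓕 (Δ f : 𝓢(Space n, ℂ)) : 𝓢(Space n, ℂ)) η =
      -(((2 * Real.pi * ‖η‖) ^ 2 : ℝ) : ℂ) * (𝓕 f : 𝓢(Space n, ℂ)) η := by
    intro f η
    have hg : (fun ξ : Space n => ‖ξ‖ ^ 2).HasTemperateGrowth := by fun_prop
    rw [SchwartzMap.laplacian_eq_fourierMultiplierCLM, FourierTransform.fourier_smul,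
      SchwartzMap.fourierMultiplierCLM_apply, FourierTransform.fourier_fourierInv_eq,
      smul_apply]
    rw [SchwartzMap.smulLeftCLM_apply_apply (by exact hg)]
    simp only [Complex.real_smul]
    push_cast
    ring
  have h2 : ∀ (f : 𝓢(Space n, ℂ)) (η : Space n), (𝓕⁻ f : 𝓢(Space n, ℂ)) η =
      (𝓕 f : 𝓢(Space n, ℂ)) (-η) := by
    intro f η
    rw [SchwartzMap.fourierInv_coe, SchwartzMap.fourier_coe, Real.fourierInv_eq_fourier_neg]
  rw [h2, h2, h1, h1, norm_neg]
  push_cast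
  ring

/-! ### The first order system for the profiles of the two half-waves -/

/-- The position `u = ω⁻¹ (e^{-itω} z₊ + e^{itω} z₋) / 2` of the state `z = (z₊, z₋)`. -/
def posOf (c t : ℝ) (z : L2 n × L2 n) : L2 n :=
  (1 / 2 : ℂ) • mulOp (omInv c) (mulOp (phase c (-t)) z.1 + mulOp (phase c t) z.2)

/-- The velocity `∂ₜu = (e^{-itω} z₊ - e^{itω} z₋) / (2i)` of the state `z = (z₊, z₋)`. -/
def velOf (c t : ℝ) (z : L2 n × L2 n) : L2 n :=
  (-Complex.I / 2) • (mulOp (phase c (-t)) z.1 - mulOp (phase c t) z.2)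

/-- The vector field of `∂ₜ²u + c² Δ² u + u = N(u)`, in the variables `(z₊, z₋)`. -/
def beamField (N : L2 n → L2 n) (c t : ℝ) (z : L2 n × L2 n) : L2 n × L2 n :=
  (Complex.I • mulOp (phase c t) (N (posOf c t z)),
    -(Complex.I • mulOp (phase c (-t)) (N (posOf c t z))))

lemma norm_mulOp_phase (c t : ℝ) (f : L2 n) : ‖mulOp (phase c t) f‖ ≤ ‖f‖ :=
  (norm_mulOp_le _ _).trans
    ((mul_le_mul_of_nonneg_right (norm_phase_le c t) (norm_nonneg _)).trans_eq (one_mul _))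

lemma norm_mulOp_omInv (c : ℝ) (f : L2 n) : ‖mulOp (omInv c) f‖ ≤ ‖f‖ :=
  (norm_mulOp_le _ _).trans
    ((mul_le_mul_of_nonneg_right (norm_omInv_le c) (norm_nonneg _)).trans_eq (one_mul _))

lemma posOf_sub (c t : ℝ) (z w : L2 n × L2 n) : posOf c t (z - w) = posOf c t z - posOf c t w := by
  simp only [posOf, Prod.fst_sub, Prod.snd_sub, map_sub, map_add, ← smul_sub]
  congr 1
  abel

lemma norm_posOf_le (c t : ℝ) (z : L2 n × L2 n) : ‖posOf c t z‖ ≤ ‖z‖ := by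
  rw [posOf, norm_smul]
  have h1 := norm_mulOp_omInv c (mulOp (phase c (-t)) z.1 + mulOp (phase c t) z.2)
  have h2 := norm_add_le (mulOp (phase c (-t)) z.1) (mulOp (phase c t) z.2)
  have h3 := (norm_mulOp_phase c (-t) z.1).trans (norm_fst_le z)
  have h4 := (norm_mulOp_phase c t z.2).trans (norm_snd_le z)
  have h5 : ‖(1 / 2 : ℂ)‖ = 1 / 2 := by norm_num
  rw [h5]
  linarith

lemma lipschitzOnWith_beamField {N : L2 n → L2 n}
    (hN : ∀ R : ℝ, ∃ C : ℝ≥0, LipschitzOnWith C N (Metric.closedBall 0 R)) (R : ℝ) :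
    ∃ K : ℝ≥0, ∀ c t, LipschitzOnWith K (beamField N c t) (Metric.closedBall 0 R) := by
  obtain ⟨K, hK⟩ := hN R
  refine ⟨K, fun c t => LipschitzOnWith.of_dist_le_mul fun z hz w hw => ?_⟩
  have hmem : ∀ z : L2 n × L2 n, z ∈ Metric.closedBall 0 R → posOf c t z ∈ Metric.closedBall 0 R :=
      by
    intro z hz
    simp only [mem_closedBall_zero_iff] at hz ⊢
    exact (norm_posOf_le c t z).trans hz
  have h1 : ‖N (posOf c t z) - N (posOf c t w)‖ ≤ K * ‖z - w‖ := by
    have := hK.dist_le_mul _ (hmem z hz) _ (hmem w hw)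
    rw [dist_eq_norm, dist_eq_norm, ← posOf_sub] at this
    exact this.trans (mul_le_mul_of_nonneg_left (norm_posOf_le c t _) K.2)
  rw [dist_eq_norm, dist_eq_norm]
  refine norm_prod_le_iff.2 ⟨?_, ?_⟩
  · rw [Prod.fst_sub]
    simp only [beamField]
    rw [← smul_sub, ← map_sub, norm_smul, Complex.norm_I, one_mul]
    exact (norm_mulOp_phase _ _ _).trans h1
  · rw [Prod.snd_sub]
    simp only [beamField]
    rw [neg_sub_neg, ← smul_sub, ← map_sub, norm_smul, Complex.norm_I, one_mul]
    refine (norm_mulOp_phase _ _ _).trans ?_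
    rwa [norm_sub_rev]

lemma continuous_of_lipschitz_balls {E F : Type*} [NormedAddCommGroup E] [NormedAddCommGroup F]
    {N : E → F} (hN : ∀ R : ℝ, ∃ C : ℝ≥0, LipschitzOnWith C N (Metric.closedBall 0 R)) :
    Continuous N := by
  refine continuous_iff_continuousAt.2 fun x => ?_
  obtain ⟨C, hC⟩ := hN (‖x‖ + 1)
  refine hC.continuousOn.continuousAt ?_
  refine Metric.mem_nhds_iff.2 ⟨1, one_pos, fun y hy => ?_⟩
  rw [mem_closedBall_zero_iff]
  have : ‖y - x‖ < 1 := by rwa [← dist_eq_norm]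
  linarith [norm_le_norm_add_norm_sub' y x]

lemma tendsto_mulOp_phase {ι : Type*} {l : Filter ι} [l.IsCountablyGenerated] {c t : ι → ℝ}
    {c₀ t₀ : ℝ} (hc : Tendsto c l (𝓝 c₀)) (ht : Tendsto t l (𝓝 t₀)) {f : ι → L2 n} {f₀ : L2 n}
    (hf : Tendsto f l (𝓝 f₀)) :
    Tendsto (fun p => mulOp (phase (c p) (t p)) (f p)) l (𝓝 (mulOp (phase c₀ t₀) f₀)) := by
  refine tendsto_mulOp (C := 1) (Eventually.of_forall fun p => norm_phase_le _ _) (fun ξ => ?_) hf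
  simp only [phase_apply]
  have h1 : Tendsto (fun p => om (c p) ξ * t p) l (𝓝 (om c₀ ξ * t₀)) :=
    (((continuous_om_left ξ).tendsto c₀).comp hc).mul ht
  have h2 : Continuous fun x : ℝ => Complex.exp (Complex.I * (x : ℂ)) := by fun_prop
  exact (h2.tendsto _).comp h1

lemma tendsto_posOf {ι : Type*} {l : Filter ι} [l.IsCountablyGenerated] {c t : ι → ℝ}
    {c₀ t₀ : ℝ} (hc : Tendsto c l (𝓝 c₀)) (ht : Tendsto t l (𝓝 t₀)) {z : ι → L2 n × L2 n}
    {z₀ : L2 n × L2 n} (hz : Tendsto z l (𝓝 z₀)) :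
    Tendsto (fun p => posOf (c p) (t p) (z p)) l (𝓝 (posOf c₀ t₀ z₀)) := by
  refine Tendsto.const_smul ?_ _
  have h1 := (continuous_fst.tendsto z₀).comp hz
  have h2 := (continuous_snd.tendsto z₀).comp hz
  refine tendsto_mulOp (C := 1) (Eventually.of_forall fun p => norm_omInv_le _) (fun ξ => ?_)
    ((tendsto_mulOp_phase hc ht.neg h1).add (tendsto_mulOp_phase hc ht h2))
  simp only [omInv_apply]
  refine Tendsto.inv₀ ?_ (om_ne_zero c₀ ξ)
  exact (Complex.continuous_ofReal.tendsto _).comp (((continuous_om_left ξ).tendsto c₀).comp hc)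

lemma tendsto_velOf {ι : Type*} {l : Filter ι} [l.IsCountablyGenerated] {c t : ι → ℝ}
    {c₀ t₀ : ℝ} (hc : Tendsto c l (𝓝 c₀)) (ht : Tendsto t l (𝓝 t₀)) {z : ι → L2 n × L2 n}
    {z₀ : L2 n × L2 n} (hz : Tendsto z l (𝓝 z₀)) :
    Tendsto (fun p => velOf (c p) (t p) (z p)) l (𝓝 (velOf c₀ t₀ z₀)) := by
  refine Tendsto.const_smul ?_ _
  have h1 := (continuous_fst.tendsto z₀).comp hz
  have h2 := (continuous_snd.tendsto z₀).comp hz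
  exact (tendsto_mulOp_phase hc ht.neg h1).sub (tendsto_mulOp_phase hc ht h2)

lemma tendsto_beamField {N : L2 n → L2 n} (hN : Continuous N) {ι : Type*} {l : Filter ι}
    [l.IsCountablyGenerated] {c t : ι → ℝ} {c₀ t₀ : ℝ} (hc : Tendsto c l (𝓝 c₀))
    (ht : Tendsto t l (𝓝 t₀)) {z : ι → L2 n × L2 n} {z₀ : L2 n × L2 n} (hz : Tendsto z l (𝓝 z₀)) :
    Tendsto (fun p => beamField N (c p) (t p) (z p)) l (𝓝 (beamField N c₀ t₀ z₀)) := by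
  have h := (hN.tendsto _).comp (tendsto_posOf hc ht hz)
  exact ((tendsto_mulOp_phase hc ht h).const_smul Complex.I).prodMk_nhds
    ((tendsto_mulOp_phase hc ht.neg h).const_smul Complex.I).neg

lemma continuousOn_beamField {N : L2 n → L2 n} (hN : Continuous N) {T : ℝ} {y : ℝ → L2 n × L2 n}
    (hy : ContinuousOn y (Set.Icc 0 T)) :
    ContinuousOn (fun p : ℝ × ℝ => beamField N p.1 p.2 (y p.2)) (Set.univ ×ˢ Set.Icc 0 T) := by
  intro p hp
  have h1 : Tendsto (fun q : ℝ × ℝ => q.2) (𝓝[Set.univ ×ˢ Set.Icc 0 T] p) (𝓝[Set.Icc 0 T] p.2) :=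
    tendsto_nhdsWithin_of_tendsto_nhds_of_eventually_within _
      ((continuous_snd.tendsto p).mono_left nhdsWithin_le_nhds)
      (by filter_upwards [self_mem_nhdsWithin] with q hq using hq.2)
  exact tendsto_beamField hN ((continuous_fst.tendsto p).mono_left nhdsWithin_le_nhds)
    (h1.mono_right nhdsWithin_le_nhds) ((hy p.2 hp.2).tendsto.comp h1)

/-- `z = (z₊, z₋)` solves the first order system on `[0, T]`. All operators in the vector field are
bounded on `L²`, uniformly in `c`, and the value `c = 0` is included; there, the system describes the
equation without dispersion. -/
def IsMild (N : L2 n → L2 n) (c T : ℝ) (z : ℝ → L2 n × L2 n) : Prop :=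
  ∀ t ∈ Set.Icc 0 T, HasDerivWithinAt z (beamField N c t (z t)) (Set.Icc 0 T) t

lemma IsMild.continuousOn {N : L2 n → L2 n} {c T : ℝ} {z : ℝ → L2 n × L2 n} (h : IsMild N c T z) :
    ContinuousOn z (Set.Icc 0 T) := fun t ht => (h t ht).continuousWithinAt

lemma IsMild.hasDeriv_fst {N : L2 n → L2 n} {c T : ℝ} {z : ℝ → L2 n × L2 n} (h : IsMild N c T z)
    {t : ℝ} (ht : t ∈ Set.Icc 0 T) : HasDerivWithinAt (fun r => (z r).1)
      (Complex.I • mulOp (phase c t) (N (posOf c t (z t)))) (Set.Icc 0 T) t :=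
  (ContinuousLinearMap.fst ℝ (L2 n) (L2 n)).hasFDerivAt.comp_hasDerivWithinAt t (h t ht)

lemma IsMild.hasDeriv_snd {N : L2 n → L2 n} {c T : ℝ} {z : ℝ → L2 n × L2 n} (h : IsMild N c T z)
    {t : ℝ} (ht : t ∈ Set.Icc 0 T) : HasDerivWithinAt (fun r => (z r).2)
      (-(Complex.I • mulOp (phase c (-t)) (N (posOf c t (z t))))) (Set.Icc 0 T) t :=
  (ContinuousLinearMap.snd ℝ (L2 n) (L2 n)).hasFDerivAt.comp_hasDerivWithinAt t (h t ht)

/-- The derivatives of the two half-waves, after application of a smoothing multiplier `θ`. -/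
lemma IsMild.hasDeriv_halfWaves {N : L2 n → L2 n} {c T : ℝ} {z : ℝ → L2 n × L2 n}
    (h : IsMild N c T z) {t : ℝ} (ht : t ∈ Set.Icc 0 T) {θ θ' : Space n →ᵇ ℂ}
    (hθ : ∀ ξ, θ' ξ = Complex.I * om c ξ * θ ξ) :
    HasDerivWithinAt (fun r => mulOp θ (mulOp (phase c (-r)) (z r).1))
      (-mulOp θ' (mulOp (phase c (-t)) (z t).1) + Complex.I • mulOp θ (N (posOf c t (z t))))
      (Set.Icc 0 T) t ∧
    HasDerivWithinAt (fun r => mulOp θ (mulOp (phase c r) (z r).2))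
      (mulOp θ' (mulOp (phase c t) (z t).2) - Complex.I • mulOp θ (N (posOf c t (z t))))
      (Set.Icc 0 T) t := by
  have h1 := hasDerivWithinAt_phase hθ (-1) (h.hasDeriv_fst ht)
  have h2 := hasDerivWithinAt_phase hθ 1 (h.hasDeriv_snd ht)
  simp only [neg_mul, one_mul, map_smul, mulOp_phase_neg_phase, mulOp_phase_phase_neg, map_neg,
    Complex.ofReal_neg, Complex.ofReal_one, neg_smul, one_smul] at h1 h2
  refine ⟨h1, ?_⟩
  rw [sub_eq_add_neg]
  exact h2

/-- The velocity is the derivative of the position, without loss: the factor `ω` from the phases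
cancels the factor `ω⁻¹` in the position. -/
lemma IsMild.hasDeriv_posOf {N : L2 n → L2 n} {c T : ℝ} {z : ℝ → L2 n × L2 n}
    (h : IsMild N c T z) {t : ℝ} (ht : t ∈ Set.Icc 0 T) :
    HasDerivWithinAt (fun r => posOf c r (z r)) (velOf c t (z t)) (Set.Icc 0 T) t := by
  set θ' : Space n →ᵇ ℂ := bddMul (fun _ => Complex.I) continuous_const 1 (by simp) with hθ'
  have hθ : ∀ ξ, θ' ξ = Complex.I * om c ξ * omInv c ξ := by
    intro ξ
    rw [omInv_apply, mul_assoc, mul_inv_cancel₀ (om_ne_zero c ξ), mul_one]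
    rfl
  obtain ⟨h1, h2⟩ := h.hasDeriv_halfWaves ht hθ
  have hI : ∀ f : L2 n, mulOp θ' f = Complex.I • f := fun f => mulOp_const _ _ fun ξ => rfl
  have h3 := (h1.add h2).const_smul (1 / 2 : ℂ)
  refine (h3.congr_deriv ?_).congr_of_mem (fun r _ => ?_) ht
  · rw [hI, hI, velOf]
    module
  · simp only [posOf, map_add, Pi.smul_apply, Pi.add_apply]

/-! ### Distributional solutions and solutions of the first order system -/

/-- Solutions of `∂ₜ²u + c² Δ² u = -|u|^{κ-1} u`, in the sense of `IsSolution`. -/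
structure IsCoeffSolution (c κ σ T : ℝ) (u v : ℝ → L2 n) : Prop where
  continuous_fst : ContinuousInSobolev σ T u
  continuous_snd : ContinuousInSobolev (σ - 2) T v
  deriv_eq : ∀ t ∈ Set.Icc 0 T, HasDerivWithinAt u (v t) (Set.Icc 0 T) t
  equation : ∀ φ : 𝓢(Space n, ℂ), ∀ t ∈ Set.Icc 0 T,
    HasDerivWithinAt (fun r => ∫ x, v r x * φ x)
      (-((c : ℂ) ^ 2 * ∫ x, u t x * (Δ (Δ φ) : 𝓢(Space n, ℂ)) x) -
        ∫ x, nonlinearity κ (u t x) * φ x)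
      (Set.Icc 0 T) t

lemma isSolution_iff {κ σ T : ℝ} {u v : ℝ → L2 n} :
    IsSolution (-1) κ σ T u v ↔ IsCoeffSolution 1 κ σ T u v := by
  constructor
  · rintro ⟨h1, h2, h3, h4⟩
    refine ⟨h1, h2, h3, fun φ t ht => (h4 φ t ht).congr_deriv ?_⟩
    push_cast
    ring
  · rintro ⟨h1, h2, h3, h4⟩
    refine ⟨h1, h2, h3, fun φ t ht => (h4 φ t ht).congr_deriv ?_⟩
    push_cast
    ring

lemma continuousInSobolev_ofWeighted (k : ℕ) {T : ℝ} {W : ℝ → L2 n}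
    (hW : ContinuousOn W (Set.Icc 0 T)) :
    ContinuousInSobolev (k : ℝ) T (fun r => ofWeighted k (W r)) := by
  refine ⟨fun t _ => ?_, fun t ht => ?_⟩
  · rw [sobolevNorm_ofWeighted]
    exact enorm_lt_top
  · simp only [← map_sub, sobolevNorm_ofWeighted]
    rw [← tendsto_zero_iff_enorm_tendsto_zero]
    have := (hW t ht).tendsto.sub_const (W t)
    rwa [sub_self] at this

/-- A continuous curve in `H^k` comes from a continuous curve in the parametrization by `L²`. -/
lemma ContinuousInSobolev.exists_ofWeighted {k : ℕ} {T : ℝ} {u : ℝ → L2 n}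
    (h : ContinuousInSobolev (k : ℝ) T u) :
    ∃ W : ℝ → L2 n, ContinuousOn W (Set.Icc 0 T) ∧ ∀ t ∈ Set.Icc 0 T, ofWeighted k (W t) = u t := by
  have hex : ∀ t, ∃ ψ : L2 n, t ∈ Set.Icc 0 T → ofWeighted k ψ = u t := by
    intro t
    by_cases ht : t ∈ Set.Icc 0 T
    · obtain ⟨ψ, hψ⟩ := NonlinearBeam.exists_ofWeighted (h.1 t ht)
      exact ⟨ψ, fun _ => hψ⟩
    · exact ⟨0, fun h => absurd h ht⟩
  choose W hW using hex
  refine ⟨W, fun t ht => ?_, hW⟩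
  have h1 : Tendsto (fun r => W r - W t) (𝓝[Set.Icc 0 T] t) (𝓝 0) := by
    rw [tendsto_zero_iff_enorm_tendsto_zero]
    refine (h.2 t ht).congr' ?_
    filter_upwards [self_mem_nhdsWithin] with r hr
    rw [← hW r hr, ← hW t ht, ← map_sub, sobolevNorm_ofWeighted]
  have h2 := h1.add_const (W t)
  simp only [sub_add_cancel, zero_add] at h2
  exact h2

/-- The test function `⟨2πξ⟩^{4-k} 𝓕⁻¹φ` on the Fourier side. -/
def testFun (k : ℕ) (φ : 𝓢(Space n, ℂ)) : 𝓢(Space n, ℂ) :=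
  SchwartzMap.smulLeftCLM ℂ (fun ξ : Space n => ((jap ξ ^ (4 - k : ℝ) : ℝ) : ℂ)) (𝓕⁻ φ)

lemma testFun_apply (k : ℕ) (φ : 𝓢(Space n, ℂ)) (ξ : Space n) :
    testFun k φ ξ = (jap ξ : ℂ) ^ 4 * ((jap ξ : ℂ) ^ k)⁻¹ * (𝓕⁻ φ : 𝓢(Space n, ℂ)) ξ := by
  rw [testFun, SchwartzMap.smulLeftCLM_apply_apply (hasTemperateGrowth_jap_rpow _),
    Real.rpow_sub (jap_pos ξ), Real.rpow_natCast, smul_eq_mul]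
  norm_cast

lemma exists_testFun_eq (k : ℕ) (g : 𝓢(Space n, ℂ)) : ∃ φ, testFun k φ = g := by
  refine ⟨𝓕 (SchwartzMap.smulLeftCLM ℂ
    (fun ξ : Space n => ((jap ξ ^ (k - 4 : ℝ) : ℝ) : ℂ)) g), ?_⟩
  ext ξ
  rw [testFun_apply, FourierTransform.fourierInv_fourier_eq,
    SchwartzMap.smulLeftCLM_apply_apply (hasTemperateGrowth_jap_rpow _),
    Real.rpow_sub (jap_pos ξ), Real.rpow_natCast, smul_eq_mul]
  have := jap_ne_zero ξ
  have h4 : jap ξ ^ (4 : ℝ) = jap ξ ^ 4 := by norm_cast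
  rw [h4]
  push_cast
  field_simp

lemma integral_ofWeighted_mul (k : ℕ) (ψ : L2 n) (φ : 𝓢(Space n, ℂ)) :
    ∫ x, ofWeighted k ψ x * φ x = pairL2 ((testFun k φ).toLp 2) (mulOp (japInv n 4) ψ) := by
  rw [integral_mul_schwartz_eq_fourier, fourier_ofWeighted, pairL2_apply]
  refine integral_congr_ae ?_
  filter_upwards [mulOp_coe (japInv n k) ψ, mulOp_coe (japInv n 4) ψ,
    (testFun k φ).coeFn_toLp 2] with ξ h1 h2 h3
  rw [h1, h2, h3, testFun_apply, japInv_apply', japInv_apply']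
  have := jap_ne_zero ξ
  field_simp

/-- The bilaplacian in the weak formulation, as the multiplier `c² (2π‖ξ‖)⁴ + 1 = ω²`. -/
lemma pairL2_mulOp_omJap (k : ℕ) (c : ℝ) (ψ : L2 n) (φ : 𝓢(Space n, ℂ)) :
    pairL2 ((testFun k φ).toLp 2) (mulOp (omJap c * omJap c) ψ) =
      (∫ x, ofWeighted k ψ x * φ x) +
        (c : ℂ) ^ 2 * ∫ x, ofWeighted k ψ x * (Δ (Δ φ) : 𝓢(Space n, ℂ)) x := by
  have i1 : ∀ θ : 𝓢(Space n, ℂ), Integrable fun ξ => mulOp (japInv n k) ψ ξ * θ ξ := fun θ =>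
    (Lp.memLp _).integrable_mul (θ.memLp 2)
  rw [integral_mul_schwartz_eq_fourier (ofWeighted k ψ) φ,
    integral_mul_schwartz_eq_fourier (ofWeighted k ψ) (Δ (Δ φ)), fourier_ofWeighted,
    pairL2_apply, ← integral_const_mul, ← integral_add (i1 _) ((i1 _).const_mul _)]
  refine integral_congr_ae ?_
  filter_upwards [mulOp_coe (japInv n k) ψ, mulOp_coe (omJap c * omJap c) ψ,
    (testFun k φ).coeFn_toLp 2] with ξ h1 h2 h3
  rw [h1, h2, h3, testFun_apply, japInv_apply', BoundedContinuousFunction.mul_apply, omJap_apply,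
    fourierInv_bilaplacian]
  have := jap_ne_zero ξ
  have h4 : (om c ξ : ℂ) ^ 2 = 1 + (c : ℂ) ^ 2 * (((2 * Real.pi * ‖ξ‖) ^ 4 : ℝ) : ℂ) := by
    have := om_sq c ξ
    exact_mod_cast this
  generalize (((2 * Real.pi * ‖ξ‖) ^ 4 : ℝ) : ℂ) = q at h4 ⊢
  generalize (𝓕⁻ φ : 𝓢(Space n, ℂ)) ξ = y
  generalize ψ ξ = w
  field_simp
  rw [h4]
  ring

/-- `N` represents `u ↦ u - |u|^{κ-1} u` on `H^k`. -/
def IsBeamNonlinearity {k : ℕ} (hk : (n : ℝ) / 2 < k) (κ : ℝ) (N : L2 n → L2 n) : Prop :=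
  ∀ ψ x, evalAt hk x (N ψ) = evalAt hk x ψ - nonlinearity κ (evalAt hk x ψ)

lemma IsBeamNonlinearity.integral {k : ℕ} {hk : (n : ℝ) / 2 < k} {κ : ℝ} {N : L2 n → L2 n}
    (hN : IsBeamNonlinearity hk κ N) (ψ : L2 n) (φ : 𝓢(Space n, ℂ)) :
    ∫ x, ofWeighted k (N ψ) x * φ x =
      (∫ x, ofWeighted k ψ x * φ x) - ∫ x, nonlinearity κ (ofWeighted k ψ x) * φ x := by
  have i1 : Integrable fun x => ofWeighted k ψ x * φ x :=
    (Lp.memLp _).integrable_mul (φ.memLp 2)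
  have i2 : Integrable fun x => ofWeighted k (N ψ) x * φ x :=
    (Lp.memLp _).integrable_mul (φ.memLp 2)
  have h : ∀ᵐ x, nonlinearity κ (ofWeighted k ψ x) * φ x =
      ofWeighted k ψ x * φ x - ofWeighted k (N ψ) x * φ x := by
    filter_upwards [ofWeighted_ae_eq hk ψ, ofWeighted_ae_eq hk (N ψ)] with x h1 h2
    rw [h1, h2, hN]
    ring
  rw [integral_congr_ae h, integral_sub i1 i2]
  ring

lemma omega_smul_eq (c : ℝ) : ∃ θ' : Space n →ᵇ ℂ, (∀ ξ, θ' ξ = Complex.I * om c ξ * japInv n 4 ξ) ∧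
    ∀ f, mulOp θ' f = Complex.I • mulOp (omJap c * japInv n 2) f := by
  refine ⟨Complex.I • (omJap c * japInv n 2), fun ξ => ?_, fun f => mulOp_smul _ _ _⟩
  simp only [BoundedContinuousFunction.coe_smul, BoundedContinuousFunction.mul_apply, omJap_apply,
    japInv_apply', smul_eq_mul]
  have := jap_ne_zero ξ
  field_simp

/-- The equation for the velocity, after smoothing by `⟨D⟩^{-4}`. -/
lemma IsMild.hasDeriv_velOf {N : L2 n → L2 n} {c T : ℝ} {z : ℝ → L2 n × L2 n}
    (h : IsMild N c T z) {t : ℝ} (ht : t ∈ Set.Icc 0 T) :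
    HasDerivWithinAt (fun r => mulOp (japInv n 4) (velOf c r (z r)))
      (-mulOp (omJap c * omJap c) (posOf c t (z t)) + mulOp (japInv n 4) (N (posOf c t (z t))))
      (Set.Icc 0 T) t := by
  obtain ⟨θ', hθ, hθ'⟩ := omega_smul_eq (n := n) c
  obtain ⟨h1, h2⟩ := h.hasDeriv_halfWaves ht hθ
  have h3 := (h1.sub h2).const_smul (-Complex.I / 2)
  refine (h3.congr_deriv ?_).congr_of_mem (fun r _ => ?_) ht
  · have e : ∀ f : L2 n, mulOp (omJap c * omJap c) (mulOp (omInv c) f) =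
        mulOp (omJap c * japInv n 2) f := by
      intro f
      rw [mulOp_mulOp]
      refine mulOp_congr (fun ξ => ?_) f
      simp only [BoundedContinuousFunction.mul_apply, omJap_apply, omInv_apply, japInv_apply']
      have := jap_ne_zero ξ
      have := om_ne_zero c ξ
      field_simp
    rw [hθ', hθ', posOf, map_smul, e, map_add (mulOp (omJap c * japInv n 2))]
    generalize mulOp (omJap c * japInv n 2) (mulOp (phase c (-t)) (z t).1) = A
    generalize mulOp (omJap c * japInv n 2) (mulOp (phase c t) (z t).2) = B
    generalize mulOp (japInv n 4) _ = M
    rw [← sub_eq_zero]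
    trans (Complex.I * Complex.I + 1) • ((1 / 2 : ℂ) • A + (1 / 2 : ℂ) • B - M)
    · module
    · rw [Complex.I_mul_I, neg_add_cancel, zero_smul]
  · simp only [velOf, map_smul, map_sub, Pi.smul_apply, Pi.sub_apply]

/-- For `c ≠ 0` the factor `ω⁻¹` gains two derivatives, so that positions are in `H^{k+2}`. -/
lemma ofWeighted_posOf_eq {c : ℝ} (hc : c ≠ 0) (k : ℕ) (t : ℝ) (z : L2 n × L2 n) :
    ofWeighted k (posOf c t z) = ofWeighted (k + 2)
      ((1 / 2 : ℂ) • mulOp (japOm hc) (mulOp (phase c (-t)) z.1 + mulOp (phase c t) z.2)) := by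
  rw [← ofWeighted_mulOp_japInv, posOf, map_smul (mulOp (japInv n 2)), mulOp_mulOp]
  congr 2
  refine mulOp_congr (fun ξ => ?_) _
  simp only [BoundedContinuousFunction.mul_apply, japOm_apply, omInv_apply, japInv_apply']
  have := jap_ne_zero ξ
  field_simp

/-- For `c ≠ 0`, solutions of the first order system solve the equation in the sense of
distributions, in the class `C([0,T]; H^{k+2} × H^k)`. -/
lemma IsMild.isCoeffSolution {k : ℕ} {hk : (n : ℝ) / 2 < k} {κ : ℝ} {N : L2 n → L2 n}
    (hN : IsBeamNonlinearity hk κ N) {c T : ℝ} (hc : c ≠ 0)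
    {z : ℝ → L2 n × L2 n} (h : IsMild N c T z) :
    IsCoeffSolution c κ ((k : ℝ) + 2) T (fun r => ofWeighted k (posOf c r (z r)))
      (fun r => ofWeighted k (velOf c r (z r))) := by
  have ht : ∀ t, Tendsto (fun r : ℝ => r) (𝓝[Set.Icc 0 T] t) (𝓝 t) := fun t => nhdsWithin_le_nhds
  refine ⟨?_, ?_, fun t ht => ?_, fun φ t ht => ?_⟩
  · have h1 : ContinuousOn (fun r => (1 / 2 : ℂ) • mulOp (japOm hc)
        (mulOp (phase c (-r)) (z r).1 + mulOp (phase c r) (z r).2)) (Set.Icc 0 T) := by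
      intro t htT
      have hz := (h.continuousOn t htT).tendsto
      refine Tendsto.const_smul (((mulOp (japOm hc)).continuous.tendsto _).comp ?_) _
      exact (tendsto_mulOp_phase tendsto_const_nhds (ht t).neg
        ((continuous_fst.tendsto _).comp hz)).add
        (tendsto_mulOp_phase tendsto_const_nhds (ht t) ((continuous_snd.tendsto _).comp hz))
    have h2 := continuousInSobolev_ofWeighted (k + 2) h1
    simp only [ofWeighted_posOf_eq hc]
    exact_mod_cast h2
  · have h2 := continuousInSobolev_ofWeighted k (T := T) (W := fun r => velOf c r (z r))
      (fun t htT => tendsto_velOf tendsto_const_nhds (ht t) (h.continuousOn t htT).tendsto)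
    simpa using h2
  · exact ((ofWeighted k).restrictScalars ℝ).hasFDerivAt.comp_hasDerivWithinAt t
      (h.hasDeriv_posOf ht)
  · have h1 := ((pairL2 ((testFun k φ).toLp 2)).restrictScalars ℝ).hasFDerivAt.comp_hasDerivWithinAt
      t (h.hasDeriv_velOf ht)
    simp only [integral_ofWeighted_mul k (velOf _ _ _)]
    refine h1.congr_deriv ?_
    simp only [ContinuousLinearMap.coe_restrictScalars', map_add, map_neg]
    rw [pairL2_mulOp_omJap, ← integral_ofWeighted_mul, hN.integral]
    ring

/-- The state `z± = e^{±itω} (ω u ± i ∂ₜu)` at time `t`. The velocity `∂ₜu` is given by `V`, in the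
parametrization of `H^k`, and the position `u` by `w`, in the parametrization of `H^{k+2}`; this
explains the multiplier `ω ⟨D⟩^{-2}` and makes the state depend continuously on `c`, also at
`c = 0`. -/
def stateOf (c t : ℝ) (w V : L2 n) : L2 n × L2 n :=
  (mulOp (phase c t) (mulOp (omJap c) w + Complex.I • V),
    mulOp (phase c (-t)) (mulOp (omJap c) w - Complex.I • V))

lemma posOf_stateOf (c t : ℝ) (w V : L2 n) :
    posOf c t (stateOf c t w V) = mulOp (japInv n 2) w := by
  rw [posOf, stateOf]
  simp only [mulOp_phase_neg_phase, mulOp_phase_phase_neg]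
  rw [show mulOp (omJap c) w + Complex.I • V + (mulOp (omJap c) w - Complex.I • V) =
    (2 : ℂ) • mulOp (omJap c) w by module, map_smul, smul_smul, mulOp_mulOp]
  norm_num
  refine mulOp_congr (fun ξ => ?_) w
  simp only [BoundedContinuousFunction.mul_apply, omJap_apply, omInv_apply, japInv_apply']
  have := om_ne_zero c ξ
  field_simp

lemma velOf_stateOf (c t : ℝ) (w V : L2 n) : velOf c t (stateOf c t w V) = V := by
  rw [velOf, stateOf]
  simp only [mulOp_phase_neg_phase, mulOp_phase_phase_neg]
  rw [show mulOp (omJap c) w + Complex.I • V - (mulOp (omJap c) w - Complex.I • V) =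
    (2 * Complex.I : ℂ) • V by module, smul_smul]
  rw [show -Complex.I / 2 * (2 * Complex.I) = 1 by linear_combination -Complex.I_mul_I, one_smul]

lemma eq_zero_of_pairL2_testFun (k : ℕ) (f : L2 n)
    (h : ∀ φ : 𝓢(Space n, ℂ), pairL2 ((testFun k φ).toLp 2) f = 0) : f = 0 := by
  refine Lp.ext ?_
  have h1 := ae_eq_zero_of_integral_schwartz (q := f) ((Lp.memLp f).locallyIntegrable (by norm_num))
    (fun g => by
      obtain ⟨φ, hφ⟩ := exists_testFun_eq k g
      rw [integral_mul_schwartz, ← hφ, h])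
  filter_upwards [h1, Lp.coeFn_zero ℂ 2 (volume : Measure (Space n))] with ξ h2 h3
  rw [h2, h3]
  rfl

lemma HasDerivWithinAt.clm_complex {E F : Type*} [NormedAddCommGroup E] [NormedSpace ℂ E]
    [NormedAddCommGroup F] [NormedSpace ℂ F] (L : E →L[ℂ] F) {f : ℝ → E} {f' : E} {S : Set ℝ}
    {t : ℝ} (hf : HasDerivWithinAt f f' S t) :
    HasDerivWithinAt (fun r => L (f r)) (L f') S t :=
  (L.restrictScalars ℝ).hasFDerivAt.comp_hasDerivWithinAt t hf

/-- The velocity of a distributional solution is strongly differentiable after smoothing. -/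
lemma IsCoeffSolution.hasDeriv_velocity {k : ℕ} {hk : (n : ℝ) / 2 < k} {κ : ℝ} {N : L2 n → L2 n}
    (hN : IsBeamNonlinearity hk κ N) (hNc : Continuous N) {c T : ℝ} (hT : 0 ≤ T)
    {u v : ℝ → L2 n} (h : IsCoeffSolution c κ ((k : ℝ) + 2) T u v) {U V : ℝ → L2 n}
    (hUc : ContinuousOn U (Set.Icc 0 T)) (hU : ∀ t ∈ Set.Icc 0 T, ofWeighted k (U t) = u t)
    (hV : ∀ t ∈ Set.Icc 0 T, ofWeighted k (V t) = v t) :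
    ∀ t ∈ Set.Icc 0 T, HasDerivWithinAt (fun r => mulOp (japInv n 4) (V r))
      (-mulOp (omJap c * omJap c) (U t) + mulOp (japInv n 4) (N (U t))) (Set.Icc 0 T) t := by
  have hGc : ContinuousOn (fun t => -mulOp (omJap c * omJap c) (U t) +
      mulOp (japInv n 4) (N (U t))) (Set.Icc 0 T) :=
    ((mulOp (omJap c * omJap c)).continuous.comp_continuousOn hUc).neg.add
      ((mulOp (japInv n 4)).continuous.comp_continuousOn (hNc.comp_continuousOn hUc))
  set L : 𝓢(Space n, ℂ) → L2 n →L[ℝ] ℂ := fun φ =>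
    (pairL2 ((testFun k φ).toLp 2)).restrictScalars ℝ with hL
  have hLe : ∀ φ f, L φ f = pairL2 ((testFun k φ).toLp 2) f := fun φ f => rfl
  have hsep : ∀ f, (∀ φ, L φ f = 0) → f = 0 := fun f hf => eq_zero_of_pairL2_testFun k f hf
  clear_value L
  have hd : ∀ φ, ∀ t ∈ Set.Icc 0 T, HasDerivWithinAt (fun r => L φ (mulOp (japInv n 4) (V r)))
      (L φ (-mulOp (omJap c * omJap c) (U t) + mulOp (japInv n 4) (N (U t)))) (Set.Icc 0 T) t := by
    intro φ t ht
    have e1 : ∀ r ∈ Set.Icc 0 T, L φ (mulOp (japInv n 4) (V r)) = ∫ x, v r x * φ x := fun r hr => by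
      rw [hLe, ← integral_ofWeighted_mul, hV r hr]
    have e2 : L φ (-mulOp (omJap c * omJap c) (U t) +
        mulOp (japInv n 4) (N (U t))) = -((c : ℂ) ^ 2 * ∫ x, u t x * (Δ (Δ φ) : 𝓢(Space n, ℂ)) x) -
          ∫ x, nonlinearity κ (u t x) * φ x := by
      rw [hLe, map_add, map_neg, pairL2_mulOp_omJap, ← integral_ofWeighted_mul, hN.integral,
          hU t ht]
      ring
    have h1 := h.equation φ t ht
    rw [← e2] at h1
    exact h1.congr_of_mem e1 ht
  exact hasDerivWithinAt_of_separating (ι := 𝓢(Space n, ℂ)) (E := L2 n) (F := ℂ) L hsep hT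
    (z := fun r => mulOp (japInv n 4) (V r)) hGc hd

/-- The equation for `z₊` (for `a = 1`) and for `z₋` (for `a = -1`). The derivatives of position and
velocity are only available after smoothing, by `⟨D⟩^{-k}` and `⟨D⟩^{-4}`; since the right-hand side is
continuous, the smoothing can be removed by `hasDerivWithinAt_of_separating`. -/
lemma hasDerivWithinAt_stateOf_component {k : ℕ} {c T : ℝ} (hT : 0 ≤ T) {a : ℝ} (ha : a * a = 1)
    {U V w M : ℝ → L2 n} (hw : ∀ t ∈ Set.Icc 0 T, mulOp (japInv n 2) (w t) = U t)
    (hMc : ContinuousOn M (Set.Icc 0 T))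
    (hU : ∀ t ∈ Set.Icc 0 T, HasDerivWithinAt (fun r => mulOp (japInv n k) (U r))
      (mulOp (japInv n k) (V t)) (Set.Icc 0 T) t)
    (hV : ∀ t ∈ Set.Icc 0 T, HasDerivWithinAt (fun r => mulOp (japInv n 4) (V r))
      (-mulOp (omJap c * omJap c) (U t) + mulOp (japInv n 4) (M t)) (Set.Icc 0 T) t) :
    ∀ t ∈ Set.Icc 0 T, HasDerivWithinAt
      (fun r => mulOp (phase c (a * r)) (mulOp (omJap c) (w r) + (a * Complex.I) • V r))
      ((a * Complex.I) • mulOp (phase c (a * t)) (M t)) (Set.Icc 0 T) t := by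
  have hinj : ∀ f : L2 n, mulOp (japInv n (k + 6)) f = 0 → f = 0 := fun f hf =>
    mulOp_injective (japInv_ne_zero (k + 6)) (by rw [hf, map_zero])
  refine hasDerivWithinAt_of_separating
    (fun _ : Unit => (mulOp (japInv n (k + 6))).restrictScalars ℝ)
    (fun f hf => hinj f (hf ())) hT ?_ fun _ t ht => ?_
  · intro t ht
    refine Tendsto.const_smul (tendsto_mulOp_phase tendsto_const_nhds ?_ (hMc t ht).tendsto) _
    exact ((continuous_const.mul continuous_id).tendsto t).mono_left nhdsWithin_le_nhds
  · have h1 := HasDerivWithinAt.clm_complex (mulOp (omJap c * japInv n 2)) (hU t ht)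
    have h2 := (HasDerivWithinAt.clm_complex (mulOp (japInv n k)) (hV t ht)).const_smul
      ((a : ℂ) * Complex.I)
    have hθ : ∀ ξ : Space n, (Complex.I • omJap c : Space n →ᵇ ℂ) ξ =
        Complex.I * om c ξ * japInv n 2 ξ := by
      intro ξ
      change Complex.I • omJap c ξ = _
      rw [omJap_apply, japInv_apply', smul_eq_mul, mul_assoc]
    have h3 := hasDerivWithinAt_phase hθ a (h1.add h2)
    have hj6 : (japInv n (k + 6)) = japInv n 2 * (japInv n k * japInv n 4) := by
      ext ξ
      simp only [BoundedContinuousFunction.mul_apply, japInv_apply']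
      ring
    have hj4 : (japInv n 4) = japInv n 2 * japInv n 2 := by
      ext ξ
      simp only [BoundedContinuousFunction.mul_apply, japInv_apply']
      ring
    refine (h3.congr_deriv ?_).congr_of_mem (fun r hr => ?_) ht
    · rw [mulOp_smul]
      simp only [ContinuousLinearMap.coe_restrictScalars', map_smul, map_add, map_neg,
          Pi.add_apply, Pi.smul_apply, mulOp_mulOp, hj6]
      rw [show omJap c * (phase c (a * t) * (omJap c * japInv n 2 * japInv n k)) =
          japInv n 2 * (phase c (a * t) * (japInv n k * (omJap c * omJap c))) by ring,
        show omJap c * (phase c (a * t) * (japInv n k * japInv n 4)) =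
          japInv n 2 * (phase c (a * t) * (omJap c * japInv n 2 * japInv n k)) by rw [hj4]; ring,
        show japInv n 2 * (japInv n k * japInv n 4) * phase c (a * t) =
          japInv n 2 * (phase c (a * t) * (japInv n k * japInv n 4)) by ring]
      have hI : (a : ℂ) * Complex.I * (a * Complex.I) = -1 := by
        have h4 : (a : ℂ) * a = 1 := by exact_mod_cast ha
        linear_combination Complex.I * Complex.I * h4 + Complex.I_mul_I
      generalize mulOp (japInv n 2 * (phase c (a * t) * (japInv n k * (omJap c * omJap c))))
          (U t) = X
      generalize mulOp (japInv n 2 * (phase c (a * t) * (omJap c * japInv n 2 * japInv n k)))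
          (V t) = Y
      generalize mulOp (japInv n 2 * (phase c (a * t) * (japInv n k * japInv n 4))) (M t) = Z
      rw [← sub_eq_zero]
      trans ((a : ℂ) * Complex.I * (a * Complex.I) + 1) • Y
      · module
      · rw [hI, neg_add_cancel, zero_smul]
    · simp only [ContinuousLinearMap.coe_restrictScalars', map_smul, map_add,
        Pi.add_apply, Pi.smul_apply, mulOp_mulOp, hj6, ← hw r hr]
      congr 1
      · refine mulOp_congr (fun ξ => ?_) _
        simp only [BoundedContinuousFunction.mul_apply, japInv_apply', omJap_apply]
        have := jap_ne_zero ξ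
        field_simp
      · congr 1
        refine mulOp_congr (fun ξ => ?_) _
        simp only [BoundedContinuousFunction.mul_apply, japInv_apply']
        have := jap_ne_zero ξ
        field_simp

/-- Distributional solutions come from solutions of the first order system. -/
lemma IsCoeffSolution.exists_isMild {k : ℕ} {hk : (n : ℝ) / 2 < k} {κ : ℝ} {N : L2 n → L2 n}
    (hN : IsBeamNonlinearity hk κ N) (hNc : Continuous N) {c T : ℝ} (hT : 0 ≤ T)
    {u v : ℝ → L2 n} (h : IsCoeffSolution c κ ((k : ℝ) + 2) T u v) :
    ∃ z, IsMild N c T z ∧ (∀ t ∈ Set.Icc 0 T, ofWeighted k (posOf c t (z t)) = u t ∧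
      ofWeighted k (velOf c t (z t)) = v t) ∧
      ∃ w V, ofWeighted (k + 2) w = u 0 ∧ ofWeighted k V = v 0 ∧ z 0 = stateOf c 0 w V := by
  have hu : ContinuousInSobolev ((k + 2 : ℕ) : ℝ) T u := by exact_mod_cast h.continuous_fst
  have hv : ContinuousInSobolev (k : ℝ) T v := by simpa using h.continuous_snd
  obtain ⟨w, hwc, hw⟩ := hu.exists_ofWeighted
  obtain ⟨V, hVc, hV⟩ := hv.exists_ofWeighted
  set U : ℝ → L2 n := fun r => mulOp (japInv n 2) (w r) with hUdef
  have hUc : ContinuousOn U (Set.Icc 0 T) := (mulOp (japInv n 2)).continuous.comp_continuousOn hwc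
  have hU : ∀ t ∈ Set.Icc 0 T, ofWeighted k (U t) = u t := fun t ht => by
    rw [hUdef, ofWeighted_mulOp_japInv, hw t ht]
  have hUd : ∀ t ∈ Set.Icc 0 T, HasDerivWithinAt (fun r => mulOp (japInv n k) (U r))
      (mulOp (japInv n k) (V t)) (Set.Icc 0 T) t := by
    intro t ht
    have h1 := HasDerivWithinAt.clm_complex (fourierL2 n) (h.deriv_eq t ht)
    refine (h1.congr_deriv ?_).congr_of_mem (fun r hr => ?_) ht
    · rw [fourierL2_apply, ← hV t ht, fourier_ofWeighted]
    · rw [fourierL2_apply, ← hU r hr, fourier_ofWeighted]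
  have hVd := h.hasDeriv_velocity hN hNc hT hUc hU hV
  have hMc : ContinuousOn (fun t => N (U t)) (Set.Icc 0 T) := hNc.comp_continuousOn hUc
  have h1 := hasDerivWithinAt_stateOf_component (a := 1) hT (by norm_num)
      (fun t _ => rfl) hMc hUd hVd
  have h2 := hasDerivWithinAt_stateOf_component (a := -1) hT (by norm_num) (fun t _ => rfl) hMc hUd
    hVd
  have hpos : ∀ t, posOf c t (stateOf c t (w t) (V t)) = U t := fun t => posOf_stateOf c t _ _
  refine ⟨fun t => stateOf c t (w t) (V t), fun t ht => ?_, fun t ht => ⟨?_, ?_⟩, w 0, V 0,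
    hw 0 ⟨le_rfl, hT⟩, hV 0 ⟨le_rfl, hT⟩, rfl⟩
  · have h3 := (h1 t ht).prodMk (h2 t ht)
    refine (h3.congr_deriv ?_).congr_of_mem (fun r _ => ?_) ht
    · simp only [beamField, hpos]
      simp
    · simp [stateOf, sub_eq_add_neg]
  · rw [hpos, hU t ht]
  · rw [velOf_stateOf, hV t ht]

/-! ### Uniqueness and continuous dependence -/

lemma IsMild.unique {N : L2 n → L2 n}
    (hN : ∀ R : ℝ, ∃ C : ℝ≥0, LipschitzOnWith C N (Metric.closedBall 0 R)) {c T : ℝ}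
    {z w : ℝ → L2 n × L2 n} (hz : IsMild N c T z) (hw : IsMild N c T w) (h0 : z 0 = w 0) :
    Set.EqOn z w (Set.Icc 0 T) :=
  solution_unique (f := beamField N c) (fun R =>
    let ⟨K, hK⟩ := lipschitzOnWith_beamField hN R
    ⟨K, fun t _ => hK c t⟩) hz hw h0

/-- Continuous dependence on the initial value and on the coefficient, including `c₀ = 0`. -/
lemma IsMild.exists_near {N : L2 n → L2 n}
    (hN : ∀ R : ℝ, ∃ C : ℝ≥0, LipschitzOnWith C N (Metric.closedBall 0 R)) {c₀ T : ℝ} (hT : 0 ≤ T)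
    {z₀ : ℝ → L2 n × L2 n} (hz₀ : IsMild N c₀ T z₀) {ε : ℝ} (hε : 0 < ε) :
    ∃ δ > 0, ∀ c, |c - c₀| < δ → ∀ a, ‖a - z₀ 0‖ < δ → ∃ z, z 0 = a ∧ IsMild N c T z ∧
      ∀ t ∈ Set.Icc 0 T, ‖z t - z₀ t‖ < ε := by
  obtain ⟨δ, hδ, h⟩ := exists_solution_near (f := beamField N) hT (fun R =>
    let ⟨K, hK⟩ := lipschitzOnWith_beamField hN R
    ⟨K, fun c t _ => hK c t⟩) (fun y hy =>
      continuousOn_beamField (continuous_of_lipschitz_balls hN) hy) hz₀ hε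
  refine ⟨δ, hδ, fun c hc a ha => ?_⟩
  obtain ⟨z, h0, hz⟩ := h c hc a ha
  exact ⟨z, h0, fun t ht => (hz t ht).1, fun t ht => (hz t ht).2⟩

/-! ### Real-valued solutions -/

/-- Complex conjugation of the solution, in the variables `(z₊, z₋)`. -/
def conjState (z : L2 n × L2 n) : L2 n × L2 n := (conjRefl z.2, conjRefl z.1)

lemma conjRefl_smul (a : ℂ) (f : L2 n) : conjRefl (a • f) = (starRingEnd ℂ) a • conjRefl f := by
  refine Lp.ext ?_
  filter_upwards [conjRefl_coe (a • f), conjRefl_coe f, ae_neg (Lp.coeFn_smul a f),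
    Lp.coeFn_smul ((starRingEnd ℂ) a) (conjRefl f)] with ξ h1 h2 h3 h4
  rw [h1, h3, h4, Pi.smul_apply, Pi.smul_apply, h2, smul_eq_mul, smul_eq_mul, map_mul]

lemma conjRefl_phase (c t : ℝ) (f : L2 n) :
    conjRefl (mulOp (phase c t) f) = mulOp (phase c (-t)) (conjRefl f) :=
  conjRefl_mulOp (conj_phase c t) f

lemma posOf_conjState (c t : ℝ) (z : L2 n × L2 n) :
    posOf c t (conjState z) = conjRefl (posOf c t z) := by
  have h : ∀ ξ : Space n, (starRingEnd ℂ) (omInv c (-ξ)) = omInv c ξ := by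
    intro ξ
    rw [omInv_apply, omInv_apply, om_neg, map_inv₀, Complex.conj_ofReal]
  rw [posOf, posOf, conjRefl_smul, conjRefl_mulOp h, map_add (conjRefl (n := n)), conjRefl_phase,
      conjRefl_phase,
    neg_neg, conjState]
  simp only [map_div₀, map_one, Complex.conj_ofNat]
  rw [add_comm]

lemma IsBeamNonlinearity.conjRefl {k : ℕ} {hk : (n : ℝ) / 2 < k} {κ : ℝ} {N : L2 n → L2 n}
    (hN : IsBeamNonlinearity hk κ N) (ψ : L2 n) :
    N (NonlinearBeam.conjRefl ψ) = NonlinearBeam.conjRefl (N ψ) := by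
  refine eq_of_evalAt_eq hk fun x => ?_
  rw [hN, evalAt_conjRefl, evalAt_conjRefl, hN, nonlinearity_conj, map_sub]

lemma IsMild.conjState {k : ℕ} {hk : (n : ℝ) / 2 < k} {κ : ℝ} {N : L2 n → L2 n}
    (hN : IsBeamNonlinearity hk κ N) {c T : ℝ} {z : ℝ → L2 n × L2 n} (h : IsMild N c T z) :
    IsMild N c T (fun t => NonlinearBeam.conjState (z t)) := by
  intro t ht
  have h1 := NonlinearBeam.conjRefl.hasFDerivAt.comp_hasDerivWithinAt t (h.hasDeriv_fst ht)
  have h2 := NonlinearBeam.conjRefl.hasFDerivAt.comp_hasDerivWithinAt t (h.hasDeriv_snd ht)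
  refine (h2.prodMk h1).congr_deriv ?_
  simp only [beamField, posOf_conjState, hN.conjRefl, map_neg, conjRefl_smul, conjRefl_phase,
    neg_neg, Complex.conj_I, neg_smul]

/-- Solutions with real data are real, by uniqueness. -/
lemma IsMild.real {k : ℕ} {hk : (n : ℝ) / 2 < k} {κ : ℝ} {N : L2 n → L2 n}
    (hN : IsBeamNonlinearity hk κ N)
    (hNL : ∀ R : ℝ, ∃ C : ℝ≥0, LipschitzOnWith C N (Metric.closedBall 0 R))
    {c T : ℝ} {z : ℝ → L2 n × L2 n} (h : IsMild N c T z)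
    (h0 : NonlinearBeam.conjState (z 0) = z 0) {t : ℝ} (ht : t ∈ Set.Icc 0 T) :
    ∀ᵐ x, (ofWeighted k (posOf c t (z t)) x).im = 0 := by
  have h1 := (h.conjState hN).unique hNL h h0 ht
  filter_upwards [ofWeighted_ae_eq hk (posOf c t (z t))] with x hx
  rw [hx, ← Complex.conj_eq_iff_im, ← evalAt_conjRefl, ← posOf_conjState]
  exact congrArg (fun w => evalAt hk x (posOf c t w)) h1

/-! ### Dilations -/

lemma map_smul_volume {b : ℝ} (hb : 0 < b) :
    Measure.map (fun x : Space n => b • x) volume = ENNReal.ofReal ((b ^ n)⁻¹) • volume := by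
  rw [Measure.map_addHaar_smul _ hb.ne', finrank_euclideanSpace_fin, abs_of_pos (by positivity)]

lemma aestronglyMeasurable_comp_smul {b : ℝ} (hb : 0 < b) {g : Space n → ℂ}
    (hg : AEStronglyMeasurable g volume) :
    AEStronglyMeasurable g (Measure.map (fun x : Space n => b • x) volume) := by
  rw [map_smul_volume hb]
  exact hg.smul_measure _

lemma eLpNorm_comp_smul {b : ℝ} (hb : 0 < b) {g : Space n → ℂ}
    (hg : AEStronglyMeasurable g volume) :
    eLpNorm (fun x => g (b • x)) 2 volume =
      ENNReal.ofReal (b ^ (-(n / 2 : ℝ))) * eLpNorm g 2 volume := by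
  have h1 := eLpNorm_map_measure (p := 2) (aestronglyMeasurable_comp_smul hb hg)
    (measurable_const_smul b).aemeasurable
  rw [map_smul_volume hb, eLpNorm_smul_measure_of_ne_top (by norm_num)] at h1
  refine h1.symm.trans ?_
  rw [smul_eq_mul, ENNReal.ofReal_rpow_of_pos (by positivity)]
  congr 2
  rw [← Real.rpow_natCast, ← Real.rpow_neg hb.le, ← Real.rpow_mul hb.le]
  congr 1
  simp
  ring

lemma ae_smul {b : ℝ} (hb : 0 < b) {p : Space n → Prop} (h : ∀ᵐ x, p x) : ∀ᵐ x : Space n, p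
    (b • x) := by
  have h1 : ∀ᵐ x ∂(Measure.map (fun x : Space n => b • x) volume), p x := by
    rw [map_smul_volume hb]
    exact Measure.ae_smul_measure h _
  exact ae_of_ae_map (measurable_const_smul b).aemeasurable h1

lemma memLp_comp_smul {b : ℝ} (hb : 0 < b) {g : Space n → ℂ} (hg : MemLp g 2 volume) :
    MemLp (fun x => g (b • x)) 2 volume := by
  refine ⟨(aestronglyMeasurable_comp_smul hb hg.1).comp_measurable (measurable_const_smul b), ?_⟩
  rw [eLpNorm_comp_smul hb hg.1]
  exact ENNReal.mul_lt_top ENNReal.ofReal_lt_top hg.2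

/-- The dilation `f ↦ f(b ·)` on `L²`. -/
def dil {b : ℝ} (hb : 0 < b) : L2 n →L[ℂ] L2 n :=
  LinearMap.mkContinuous
    { toFun := fun f => (memLp_comp_smul hb (Lp.memLp f)).toLp
      map_add' := fun f g => by
        rw [← MemLp.toLp_add]
        refine MemLp.toLp_congr _ _ ?_
        filter_upwards [ae_smul hb (Lp.coeFn_add f g)] with x h
        simp only [h, Pi.add_apply]
      map_smul' := fun c f => by
        rw [RingHom.id_apply, ← MemLp.toLp_const_smul]
        refine MemLp.toLp_congr _ _ ?_
        filter_upwards [ae_smul hb (Lp.coeFn_smul c f)] with x h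
        simp only [h, Pi.smul_apply] }
    (b ^ (-(n / 2 : ℝ))) (fun f => by
      refine le_of_eq ?_
      simp only [LinearMap.coe_mk, AddHom.coe_mk]
      rw [Lp.norm_toLp, eLpNorm_comp_smul hb (Lp.memLp f).1, ENNReal.toReal_mul,
        ENNReal.toReal_ofReal (by positivity), Lp.norm_def])

lemma dil_coe {b : ℝ} (hb : 0 < b) (f : L2 n) : dil hb f =ᵐ[volume] fun x => f (b • x) :=
  (memLp_comp_smul hb (Lp.memLp f)).coeFn_toLp

/-- The dilation `φ ↦ φ(b ·)` on Schwartz functions. -/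
def dilS {b : ℝ} (hb : 0 < b) : 𝓢(Space n, ℂ) →L[ℂ] 𝓢(Space n, ℂ) :=
  SchwartzMap.compCLMOfContinuousLinearEquiv ℂ
    (LinearEquiv.smulOfNeZero ℝ (Space n) b hb.ne').toContinuousLinearEquiv

lemma dilS_apply {b : ℝ} (hb : 0 < b) (φ : 𝓢(Space n, ℂ)) (x : Space n) :
    dilS hb φ x = φ (b • x) := rfl

lemma dil_toLp {b : ℝ} (hb : 0 < b) (φ : 𝓢(Space n, ℂ)) :
    dil hb (φ.toLp 2) = (dilS hb φ).toLp 2 := by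
  refine Lp.ext ?_
  filter_upwards [dil_coe hb (φ.toLp 2), ae_smul hb (p := fun x => (φ.toLp 2 volume : L2 n) x =
      φ x) (φ.coeFn_toLp 2 volume), (dilS hb φ).coeFn_toLp 2]
    with x h1 h2 h3
  rw [h1, h2, h3, dilS_apply]

lemma fourier_dilS {b : ℝ} (hb : 0 < b) (φ : 𝓢(Space n, ℂ)) :
    (𝓕 (dilS hb φ) : 𝓢(Space n, ℂ)) =
      (((b ^ n)⁻¹ : ℝ) : ℂ) • dilS (inv_pos.2 hb) (𝓕 φ : 𝓢(Space n, ℂ)) := by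
  ext ξ
  rw [smul_apply, dilS_apply, SchwartzMap.fourier_coe, SchwartzMap.fourier_coe,
    Real.fourier_eq, Real.fourier_eq]
  have h := Measure.integral_comp_smul (volume : Measure (Space n))
    (fun v => Real.fourierChar (-inner ℝ v (b⁻¹ • ξ)) • φ v) b
  rw [finrank_euclideanSpace_fin, abs_of_pos (by positivity)] at h
  rw [smul_eq_mul, ← Complex.real_smul, ← h]
  refine integral_congr_ae (ae_of_all _ fun v => ?_)
  simp only [dilS_apply]
  rw [inner_smul_left, inner_smul_right]
  simp [hb.ne']

lemma fourier_dil {b : ℝ} (hb : 0 < b) (f : L2 n) :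
    (𝓕 (dil hb f) : L2 n) = (((b ^ n)⁻¹ : ℝ) : ℂ) • dil (inv_pos.2 hb) (𝓕 f : L2 n) := by
  have heq : (fun f : L2 n => fourierL2 n (dil hb f)) =
      fun f => (((b ^ n)⁻¹ : ℝ) : ℂ) • dil (inv_pos.2 hb) (fourierL2 n f) := by
    refine (SchwartzMap.denseRange_toLpCLM (F := ℂ) (E := Space n) (p := 2) (μ := volume)
      ENNReal.ofNat_ne_top).equalizer
      (fourierL2 n ∘L dil hb).continuous
      (((((b ^ n)⁻¹ : ℝ) : ℂ) • dil (inv_pos.2 hb)) ∘L fourierL2 n).continuous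
      (funext fun φ => ?_)
    simp only [Function.comp_apply, SchwartzMap.toLpCLM_apply, fourierL2_apply]
    rw [dil_toLp, SchwartzMap.toLp_fourier_eq, SchwartzMap.toLp_fourier_eq, dil_toLp, fourier_dilS]
    exact (SchwartzMap.toLpCLM ℂ ℂ 2 volume).map_smul _ _
  exact congrFun heq f

lemma sobolevNorm_dil {b : ℝ} (hb : 0 < b) (σ : ℝ) (f : L2 n) :
    sobolevNorm σ (dil hb f) = ENNReal.ofReal (b ^ (-(n / 2 : ℝ))) *
      eLpNorm (fun ξ => ((jap (b • ξ) ^ σ : ℝ) : ℂ) * (𝓕 f : L2 n) ξ) 2 volume := by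
  have hm : AEStronglyMeasurable (fun ξ => ((jap (b • ξ) ^ σ : ℝ) : ℂ) * (𝓕 f : L2 n) ξ) volume :=
      by
    refine AEStronglyMeasurable.mul ?_ (Lp.memLp _).1
    exact (Complex.continuous_ofReal.comp ((continuous_jap.comp
        (continuous_const_smul b)).rpow_const
      fun ξ => Or.inl (jap_pos _).ne')).aestronglyMeasurable
  have h1 : sobolevNorm σ (dil hb f) = eLpNorm ((((b ^ n)⁻¹ : ℝ) : ℂ) • fun ξ : Space n =>
      (fun η => ((jap (b • η) ^ σ : ℝ) : ℂ) * (𝓕 f : L2 n) η) (b⁻¹ • ξ)) 2 volume := by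
    rw [sobolevNorm_eq, fourier_dil]
    refine eLpNorm_congr_ae ?_
    filter_upwards [Lp.coeFn_smul (((b ^ n)⁻¹ : ℝ) : ℂ) (dil (inv_pos.2 hb) (𝓕 f : L2 n)),
      dil_coe (inv_pos.2 hb) (𝓕 f : L2 n)] with ξ h1 h2
    rw [h1, Pi.smul_apply, h2, Pi.smul_apply]
    simp only [smul_eq_mul, smul_smul, mul_inv_cancel₀ hb.ne', one_smul]
    ring
  rw [h1, eLpNorm_const_smul, eLpNorm_comp_smul (inv_pos.2 hb) hm, ← mul_assoc]
  congr 1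
  rw [← ofReal_norm, Complex.norm_real, Real.norm_of_nonneg (by positivity), ← ENNReal.ofReal_mul
    (by positivity)]
  congr 1
  rw [Real.inv_rpow hb.le, ← Real.rpow_neg hb.le, ← Real.rpow_natCast b n, ← Real.rpow_neg hb.le,
    ← Real.rpow_add hb]
  congr 1
  ring

lemma jap_smul_rpow_le {b B : ℝ} (hb : 0 < b) (h1 : 1 ≤ B) (hB : b ≤ B) (hB' : b⁻¹ ≤ B) (σ : ℝ)
    (ξ : Space n) : jap (b • ξ) ^ σ ≤ B ^ |σ| * jap ξ ^ σ := by
  have key : ∀ (a : ℝ), 0 < a → a ≤ B → ∀ η : Space n, jap (a • η) ≤ B * jap η := by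
    intro a ha haB η
    have := jap_pos η
    refine Real.sqrt_le_iff.2 ⟨by positivity, ?_⟩
    rw [mul_pow B, jap_sq, norm_smul, Real.norm_of_nonneg ha.le]
    have h2 : a ^ 2 ≤ B ^ 2 := by gcongr
    have h3 : 1 ≤ B ^ 2 := one_le_pow₀ h1
    calc 1 + (2 * Real.pi * (a * ‖η‖)) ^ 2 = 1 + a ^ 2 * (2 * Real.pi * ‖η‖) ^ 2 := by ring
      _ ≤ B ^ 2 + B ^ 2 * (2 * Real.pi * ‖η‖) ^ 2 := by gcongr
      _ = _ := by ring
  have hj := jap_pos ξ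
  have hj' := jap_pos (b • ξ)
  have hB0 : 0 < B := by linarith
  rcases le_total 0 σ with hσ | hσ
  · rw [abs_of_nonneg hσ, ← Real.mul_rpow hB0.le hj.le]
    exact Real.rpow_le_rpow hj'.le (key b hb hB ξ) hσ
  · rw [abs_of_nonpos hσ, Real.rpow_neg hB0.le, ← Real.inv_rpow hB0.le,
      ← Real.mul_rpow (by positivity) hj.le]
    refine Real.rpow_le_rpow_of_nonpos (by positivity) ?_ hσ
    have h2 := key b⁻¹ (inv_pos.2 hb) hB' (b • ξ)
    rw [smul_smul, inv_mul_cancel₀ hb.ne', one_smul] at h2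
    rwa [inv_mul_le_iff₀ hB0]

lemma sobolevNorm_dil_le {b B : ℝ} (hb : 0 < b) (h1 : 1 ≤ B) (hB : b ≤ B) (hB' : b⁻¹ ≤ B) (σ : ℝ)
    (f : L2 n) : sobolevNorm σ (dil hb f) ≤
      ENNReal.ofReal (b ^ (-(n / 2 : ℝ)) * B ^ |σ|) * sobolevNorm σ f := by
  rw [sobolevNorm_dil, ENNReal.ofReal_mul (by positivity), mul_assoc]
  gcongr
  rw [sobolevNorm_eq]
  have hB0 : (0 : ℝ) ≤ B ^ |σ| := by positivity
  have := eLpNorm_le_nnreal_smul_eLpNorm_of_ae_le_mul (μ := volume) (c := (B ^ |σ|).toNNReal) (p :=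
      2)
    (f := fun ξ => ((jap (b • ξ) ^ σ : ℝ) : ℂ) * (𝓕 f : L2 n) ξ)
    (g := fun ξ => ((jap ξ ^ σ : ℝ) : ℂ) * (𝓕 f : L2 n) ξ) (ae_of_all _ fun ξ => ?_)
  · refine this.trans (le_of_eq ?_)
    rw [ENNReal.smul_def, smul_eq_mul, ENNReal.ofReal]
  · rw [← NNReal.coe_le_coe]
    simp only [coe_nnnorm, NNReal.coe_mul, Real.coe_toNNReal _ hB0, norm_mul, Complex.norm_real,
      Real.norm_eq_abs, abs_of_pos (Real.rpow_pos_of_pos (jap_pos _) _)]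
    rw [← mul_assoc]
    exact mul_le_mul_of_nonneg_right (jap_smul_rpow_le hb h1 hB hB' σ ξ) (norm_nonneg _)

/-- The homogeneous Sobolev norm `‖f‖_{Ḣ^s} = ‖|D|^s f‖_{L²}`, with values in `[0, ∞]`. -/
def homNorm (s : ℝ) (f : L2 n) : ℝ≥0∞ :=
  eLpNorm (fun ξ => (((2 * Real.pi * ‖ξ‖) ^ s : ℝ) : ℂ) * (𝓕 f : L2 n) ξ) 2 volume

lemma homNorm_le_sobolevNorm_dil {b : ℝ} (hb : 0 < b) {s : ℝ} (hs : 0 ≤ s) (f : L2 n) :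
    ENNReal.ofReal (b ^ (s - n / 2)) * homNorm s f ≤ sobolevNorm s (dil hb f) := by
  rw [sobolevNorm_dil, sub_eq_neg_add, Real.rpow_add hb, ENNReal.ofReal_mul (by positivity),
    mul_assoc]
  gcongr
  have h0 : ENNReal.ofReal (b ^ s) = ‖((b ^ s : ℝ) : ℂ)‖ₑ := by
    rw [← ofReal_norm, Complex.norm_real, Real.norm_of_nonneg (by positivity)]
  rw [homNorm, h0, ← eLpNorm_const_smul]
  refine eLpNorm_mono fun ξ => ?_
  simp only [Pi.smul_apply, smul_eq_mul, norm_mul, Complex.norm_real]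
  rw [← mul_assoc]
  refine mul_le_mul_of_nonneg_right ?_ (norm_nonneg _)
  rw [Real.norm_of_nonneg (by positivity), Real.norm_of_nonneg (by positivity),
    Real.norm_of_nonneg (Real.rpow_nonneg (jap_pos _).le _), ← Real.mul_rpow hb.le (by positivity)]
  refine Real.rpow_le_rpow (by positivity) ?_ hs
  refine Real.le_sqrt_of_sq_le ?_
  rw [norm_smul, Real.norm_of_nonneg hb.le]
  nlinarith

/-! ### Scaling of solutions -/

section

open scoped LineDeriv

lemma integral_dil_mul {b : ℝ} (hb : 0 < b) (g : ℂ → ℂ) (f : L2 n) (φ : 𝓢(Space n, ℂ)) :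
    ∫ x, g (dil hb f x) * φ x =
      (((b ^ n)⁻¹ : ℝ) : ℂ) * ∫ x, g (f x) * dilS (inv_pos.2 hb) φ x := by
  have h := Measure.integral_comp_smul (volume : Measure (Space n))
    (fun x => g (f x) * dilS (inv_pos.2 hb) φ x) b
  rw [finrank_euclideanSpace_fin, abs_of_pos (by positivity), Complex.real_smul] at h
  rw [← h]
  refine integral_congr_ae ?_
  filter_upwards [dil_coe hb f] with x hx
  rw [hx, dilS_apply, smul_smul, inv_mul_cancel₀ hb.ne', one_smul]

lemma lineDerivOp_dilS {b : ℝ} (hb : 0 < b) (m : Space n) (φ : 𝓢(Space n, ℂ)) :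
    ∂_{m} (dilS hb φ) = (b : ℂ) • dilS hb (∂_{m} φ) := by
  ext x
  rw [smul_apply, SchwartzMap.lineDerivOp_apply_eq_fderiv, dilS_apply,
    SchwartzMap.lineDerivOp_apply_eq_fderiv]
  have h : (dilS hb φ : Space n → ℂ) = fun x => φ (b • x) := rfl
  rw [h, fderiv_comp_smul]
  simp

lemma laplacian_dilS {b : ℝ} (hb : 0 < b) (φ : 𝓢(Space n, ℂ)) :
    (Δ (dilS hb φ) : 𝓢(Space n, ℂ)) = (b : ℂ) ^ 2 • dilS hb (Δ φ) := by
  rw [SchwartzMap.laplacian_eq_sum (EuclideanSpace.basisFun (Fin n) ℝ),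
    SchwartzMap.laplacian_eq_sum (EuclideanSpace.basisFun (Fin n) ℝ), map_sum, Finset.smul_sum]
  refine Finset.sum_congr rfl fun i _ => ?_
  rw [lineDerivOp_dilS, LineDeriv.lineDerivOp_smul, lineDerivOp_dilS, smul_smul, pow_two]

lemma bilaplacian_dilS {b : ℝ} (hb : 0 < b) (φ : 𝓢(Space n, ℂ)) :
    (Δ (Δ (dilS hb φ)) : 𝓢(Space n, ℂ)) = (b : ℂ) ^ 4 • dilS hb (Δ (Δ φ)) := by
  have h : ∀ (c : ℂ) (f : 𝓢(Space n, ℂ)), (Δ (c • f) : 𝓢(Space n, ℂ)) = c • Δ f := by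
    intro c f
    rw [← SchwartzMap.laplacianCLM_eq (𝕜 := ℂ), ← SchwartzMap.laplacianCLM_eq (𝕜 := ℂ), map_smul]
  rw [laplacian_dilS, h, laplacian_dilS, smul_smul]
  ring_nf

lemma tendsto_div_Icc {τ : ℝ} (hτ : 0 < τ) (T t : ℝ) :
    Tendsto (fun r : ℝ => r / τ) (𝓝[Set.Icc 0 (τ * T)] t) (𝓝[Set.Icc 0 T] (t / τ)) := by
  refine tendsto_nhdsWithin_iff.2
    ⟨(tendsto_id.div_const τ).mono_left nhdsWithin_le_nhds, ?_⟩
  filter_upwards [self_mem_nhdsWithin] with r hr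
  exact ⟨div_nonneg hr.1 hτ.le, (div_le_iff₀' hτ).2 hr.2⟩

lemma div_mem_Icc {τ : ℝ} (hτ : 0 < τ) {T t : ℝ} (ht : t ∈ Set.Icc 0 (τ * T)) :
    t / τ ∈ Set.Icc 0 T :=
  ⟨div_nonneg ht.1 hτ.le, (div_le_iff₀' hτ).2 ht.2⟩

lemma ContinuousInSobolev.scale {σ T : ℝ} {u : ℝ → L2 n} (h : ContinuousInSobolev σ T u)
    {b τ : ℝ} (hb : 0 < b) (hτ : 0 < τ) (a : ℂ) :
    ContinuousInSobolev σ (τ * T) (fun t => a • dil hb (u (t / τ))) := by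
  set B : ℝ := max 1 (max b b⁻¹)
  have hB : ∀ f : L2 n, sobolevNorm σ (a • dil hb f) ≤
      (‖a‖ₑ * ENNReal.ofReal (b ^ (-(n / 2 : ℝ)) * B ^ |σ|)) * sobolevNorm σ f := by
    intro f
    rw [sobolevNorm_smul, mul_assoc]
    gcongr
    exact sobolevNorm_dil_le hb (le_max_left _ _) (le_max_of_le_right (le_max_left _ _))
      (le_max_of_le_right (le_max_right _ _)) σ f
  have hfin : ‖a‖ₑ * ENNReal.ofReal (b ^ (-(n / 2 : ℝ)) * B ^ |σ|) ≠ ∞ :=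
    ENNReal.mul_ne_top enorm_ne_top ENNReal.ofReal_ne_top
  refine ⟨fun t ht => (hB _).trans_lt (ENNReal.mul_lt_top hfin.lt_top (h.1 _ (div_mem_Icc hτ ht))),
    fun t ht => ?_⟩
  have h1 := (ENNReal.Tendsto.const_mul ((h.2 _ (div_mem_Icc hτ ht)).comp (tendsto_div_Icc hτ T t))
    (Or.inr hfin))
  rw [mul_zero] at h1
  refine tendsto_of_tendsto_of_tendsto_of_le_of_le tendsto_const_nhds h1 (fun _ => zero_le)
    fun r => ?_
  simp only [← smul_sub, ← map_sub]
  exact hB _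

/-- If `a^{κ-1} τ² = 1` then `a u(t/τ, bx)` solves the equation with dispersion coefficient
`c' = c / (τ b²)`. -/
lemma IsCoeffSolution.scale {c c' κ σ T : ℝ} {u v : ℝ → L2 n} (h : IsCoeffSolution c κ σ T u v)
    {a b τ : ℝ} (ha : 0 < a) (hb : 0 < b) (hτ : 0 < τ) (haτ : a ^ (κ - 1) * τ ^ 2 = 1)
    (hc : c' * τ * b ^ 2 = c) :
    IsCoeffSolution c' κ σ (τ * T) (fun t => (a : ℂ) • dil hb (u (t / τ)))
      (fun t => ((a / τ : ℝ) : ℂ) • dil hb (v (t / τ))) where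
  continuous_fst := h.continuous_fst.scale hb hτ _
  continuous_snd := h.continuous_snd.scale hb hτ _
  deriv_eq t ht := by
    have h1 := h.deriv_eq _ (div_mem_Icc hτ ht)
    have h2 : HasDerivWithinAt (fun r : ℝ => r / τ) (1 / τ) (Set.Icc 0 (τ * T)) t :=
      ((hasDerivAt_id t).div_const τ).hasDerivWithinAt
    have h3 := HasDerivWithinAt.clm_complex ((a : ℂ) • dil hb)
      (h1.scomp t h2 fun r hr => div_mem_Icc hτ hr)
    refine h3.congr_deriv ?_
    rw [real_smul_L2, map_smul, smul_apply, smul_smul]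
    congr 1
    push_cast
    ring
  equation φ t ht := by
    have hab := hb.ne'
    have hτ0 := hτ.ne'
    have h1 := h.equation (dilS (inv_pos.2 hb) φ) _ (div_mem_Icc hτ ht)
    have h2 : HasDerivWithinAt (fun r : ℝ => r / τ) (1 / τ) (Set.Icc 0 (τ * T)) t :=
      ((hasDerivAt_id t).div_const τ).hasDerivWithinAt
    have h3 := ((h1.scomp t h2 fun r hr => div_mem_Icc hτ hr).const_mul
      (((a / τ : ℝ) : ℂ) * (((b ^ n)⁻¹ : ℝ) : ℂ)))
    have hs : ∀ (A : ℂ) (f : L2 n) (θ : 𝓢(Space n, ℂ)),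
        ∫ x, (A • dil hb f) x * θ x = A * ((((b ^ n)⁻¹ : ℝ) : ℂ) *
          ∫ x, f x * dilS (inv_pos.2 hb) θ x) := by
      intro A f θ
      rw [← integral_dil_mul hb (fun z => z), ← integral_const_mul]
      refine integral_congr_ae ?_
      filter_upwards [Lp.coeFn_smul A (dil hb f)] with x hx
      rw [hx, Pi.smul_apply, smul_eq_mul, mul_assoc]
    have hN : ∫ x, nonlinearity κ (((a : ℂ) • dil hb (u (t / τ))) x) * φ x =
        ((a ^ κ : ℝ) : ℂ) * ((((b ^ n)⁻¹ : ℝ) : ℂ) *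
          ∫ x, nonlinearity κ (u (t / τ) x) * dilS (inv_pos.2 hb) φ x) := by
      rw [← integral_dil_mul hb (nonlinearity κ), ← integral_const_mul]
      refine integral_congr_ae ?_
      filter_upwards [Lp.coeFn_smul (a : ℂ) (dil hb (u (t / τ)))] with x hx
      rw [hx, Pi.smul_apply, smul_eq_mul, nonlinearity_ofReal_mul κ ha, mul_assoc]
    have hL : ∫ x, u (t / τ) x * (Δ (Δ (dilS (inv_pos.2 hb) φ)) : 𝓢(Space n, ℂ)) x =
        ((b⁻¹ : ℝ) : ℂ) ^ 4 * ∫ x, u (t / τ) x * dilS (inv_pos.2 hb) (Δ (Δ φ)) x := by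
      rw [bilaplacian_dilS, ← integral_const_mul]
      refine integral_congr_ae (ae_of_all _ fun x => ?_)
      simp only [smul_apply, smul_eq_mul]
      ring
    simp only [hs]
    refine (h3.congr_deriv ?_).congr (fun r _ => ?_) ?_
    · rw [hN, hL, ← hc, Complex.real_smul]
      have haκ : a ^ κ = a / τ ^ 2 := by
        rw [Real.rpow_sub_one ha.ne'] at haτ
        field_simp at haτ ⊢
        exact haτ
      rw [haκ]
      push_cast
      have h4 : (b : ℂ) ≠ 0 := by exact_mod_cast hab
      have h5 : (τ : ℂ) ≠ 0 := by exact_mod_cast hτ0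
      field_simp
    · exact (mul_assoc _ _ _).symm
    · exact (mul_assoc _ _ _).symm

end

/-! ### The nonlinear oscillator -/

section

open scoped ContDiff

/-- A bounded, globally Lipschitz autonomous vector field has a solution on the whole real line: the
solutions on the intervals `(-(m+1), m+1)` agree. -/
lemma exists_global_solution {E : Type*} [NormedAddCommGroup E] [NormedSpace ℝ E] [CompleteSpace E]
    {v : E → E} {K L : ℝ≥0} (hv : LipschitzWith K v) (hb : ∀ x, ‖v x‖ ≤ L) (x₀ : E) :
    ∃ α : ℝ → E, α 0 = x₀ ∧ ∀ t, HasDerivAt α (v (α t)) t := by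
  have hloc : ∀ m : ℕ, ∃ α : ℝ → E, α 0 = x₀ ∧
      ∀ t ∈ Set.Ioo (-(m + 1 : ℝ)) (m + 1), HasDerivAt α (v (α t)) t := by
    intro m
    have hm : (0 : ℝ) ∈ Set.Icc (-(m + 1 : ℝ)) (m + 1) := by constructor <;> linarith
        [(m.cast_nonneg : (0 : ℝ) ≤ m)]
    have hP : IsPicardLindelof (fun _ => v) (⟨0, hm⟩ : Set.Icc (-(m + 1 : ℝ)) (m + 1)) x₀
        (L * (m + 1)) 0 L K :=
      { lipschitzOnWith := fun t _ => hv.lipschitzOnWith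
        continuousOn := fun x _ => continuousOn_const
        norm_le := fun t _ x _ => hb x
        mul_max_le := by simp }
    obtain ⟨α, h0, hα⟩ := hP.exists_eq_forall_mem_Icc_hasDerivWithinAt₀
    exact ⟨α, h0, fun t ht => (hα t (Set.Ioo_subset_Icc_self ht)).hasDerivAt
      (Icc_mem_nhds ht.1 ht.2)⟩
  choose α h0 hα using hloc
  have hagree : ∀ m l : ℕ, m ≤ l → Set.EqOn (α m) (α l) (Set.Ioo (-(m + 1 : ℝ)) (m + 1)) := by
    intro m l hml
    have hml' : (m : ℝ) ≤ l := by exact_mod_cast hml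
    refine ODE_solution_unique_of_mem_Ioo (v := fun _ => v) (s := fun _ => Set.univ) (K := K)
      (t₀ := 0) (fun t _ => hv.lipschitzOnWith) ?_ (fun t ht => ⟨hα m t ht, trivial⟩)
      (fun t ht => ⟨hα l t ?_, trivial⟩) ((h0 m).trans (h0 l).symm)
    · constructor <;> linarith [(m.cast_nonneg : (0 : ℝ) ≤ m)]
    · exact ⟨by linarith [ht.1], by linarith [ht.2]⟩
  have hfl : ∀ t : ℝ, t ∈ Set.Ioo (-((⌊|t|⌋₊ : ℝ) + 1)) (⌊|t|⌋₊ + 1) := fun t =>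
    abs_lt.1 (Nat.lt_floor_add_one |t|)
  refine ⟨fun t => α ⌊|t|⌋₊ t, h0 _, fun t => ?_⟩
  have ht := hfl t
  refine (hα _ t ht).congr_of_eventuallyEq ?_
  filter_upwards [Ioo_mem_nhds ht.1 ht.2] with r hr
  refine hagree _ _ ?_ (hfl r)
  exact Nat.lt_succ_iff.1 ((Nat.floor_lt (abs_nonneg r)).2 (by exact_mod_cast abs_lt.2 hr))

/-- The primitive of an odd function that is positive on `(0, ∞)` is even and strictly increasing
in `|x|`. -/
lemma abs_le_of_primitive_le {h : ℝ → ℝ} (hc : Continuous h) (hodd : ∀ r, h (-r) = -h r)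
    (hpos : ∀ r, 0 < r → 0 < h r) {x y : ℝ} (hy : 0 ≤ y)
    (hxy : ∫ r in (0 : ℝ)..x, h r ≤ ∫ r in (0 : ℝ)..y, h r) : |x| ≤ y := by
  have heven : ∀ x, ∫ r in (0 : ℝ)..(-x), h r = ∫ r in (0 : ℝ)..x, h r := by
    intro x
    have := intervalIntegral.integral_comp_neg (a := 0) (b := x) h
    simp only [hodd, intervalIntegral.integral_neg, neg_zero] at this
    rw [intervalIntegral.integral_symm, ← this, neg_neg]
  have habs : ∫ r in (0 : ℝ)..|x|, h r = ∫ r in (0 : ℝ)..x, h r := by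
    rcases abs_choice x with e | e <;> rw [e]
    exact heven x
  by_contra! hlt
  have hpos' : 0 < ∫ r in y..|x|, h r :=
    intervalIntegral.intervalIntegral_pos_of_pos_on (hc.intervalIntegrable y |x|)
      (fun r hr => hpos r (hy.trans_lt hr.1)) hlt
  have := intervalIntegral.integral_add_adjacent_intervals (μ := volume) (hc.intervalIntegrable 0 y)
    (hc.intervalIntegrable y |x|)
  linarith

/-- The oscillator `G'' = -g(G)` with `G(0) = 1`, `G'(0) = 0`. Cutting off the vector field at
height `1` does not change the energy estimate, and makes the solution global. -/
lemma exists_oscillator {g : ℝ → ℝ} (hg : ContDiff ℝ 1 g) (hodd : ∀ r, g (-r) = -g r)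
    (hpos : ∀ r, 0 < r → 0 < g r) (hle : ∀ r ∈ Set.Icc (0 : ℝ) 1, g r ≤ r) :
    ∃ G H : ℝ → ℝ, G 0 = 1 ∧ H 0 = 0 ∧ (∀ t, HasDerivAt G (H t) t) ∧
      (∀ t, HasDerivAt H (-g (G t)) t) ∧ ∀ t, |G t| ≤ 1 ∧ |H t| ≤ 1 := by
  set clip : ℝ → ℝ := fun r => max (-1) (min r 1) with hclip
  have hcL : LipschitzWith 1 clip := (LipschitzWith.id.min_const 1).const_max (-1)
  have hcc : Continuous clip := hcL.continuous
  have hcm : ∀ r, clip r ∈ Set.Icc (-1 : ℝ) 1 := fun r =>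
    ⟨le_max_left _ _, max_le (by norm_num) (min_le_right _ _)⟩
  have hce : ∀ r, |r| ≤ 1 → clip r = r := fun r hr => by
    rw [hclip]
    simp only [min_eq_left (abs_le.1 hr).2, max_eq_right (abs_le.1 hr).1]
  have hcodd : ∀ r, clip (-r) = -clip r := fun r => by
    simp only [hclip, max_def, min_def]
    split_ifs <;> linarith
  have hcpos : ∀ r, 0 < r → 0 < clip r := fun r hr => lt_max_of_lt_right (lt_min hr one_pos)
  obtain ⟨K, hK⟩ := hg.contDiffOn.exists_lipschitzOnWith one_ne_zero (convex_Icc (-1 : ℝ) 1)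
    isCompact_Icc
  have hgcL : LipschitzWith K (fun r => g (clip r)) := by
    have := hK.comp hcL.lipschitzOnWith (s := Set.univ) fun r _ => hcm r
    rw [mul_one] at this
    exact lipschitzOnWith_univ.1 this
  have hgcc : Continuous (fun r => g (clip r)) := hgcL.continuous
  have hgb : ∀ r, |g (clip r)| ≤ 1 := by
    have h1 : ∀ r ∈ Set.Icc (0 : ℝ) 1, |g r| ≤ 1 := by
      intro r hr
      have h0 : 0 ≤ g r := by
        rcases hr.1.eq_or_lt with e | e
        · have := hodd 0
          rw [neg_zero] at this
          rw [← e]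
          linarith
        · exact (hpos r e).le
      rw [abs_of_nonneg h0]
      exact (hle r hr).trans hr.2
    intro r
    rcases le_total 0 (clip r) with h | h
    · exact h1 _ ⟨h, (hcm r).2⟩
    · have := h1 (-clip r) ⟨by linarith, by linarith [(hcm r).1]⟩
      rwa [hodd, abs_neg] at this
  have hL : LipschitzWith (max 1 K) (fun z : ℝ × ℝ => (clip z.2, -g (clip z.1))) := by
    have h1 : LipschitzWith 1 (fun z : ℝ × ℝ => clip z.2) := by
      simpa [Function.comp_def] using hcL.comp LipschitzWith.prod_snd
    have h2 : LipschitzWith K (fun z : ℝ × ℝ => -g (clip z.1)) := by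
      have := (hgcL.comp LipschitzWith.prod_fst).neg (α := ℝ × ℝ)
      rwa [mul_one] at this
    exact h1.prodMk h2
  obtain ⟨α, h0, hα⟩ := exists_global_solution (L := 1) hL (fun z => by
    refine norm_prod_le_iff.2 ⟨?_, ?_⟩
    · exact abs_le.2 (hcm _)
    · rw [norm_neg]
      exact hgb _) ((1 : ℝ), (0 : ℝ))
  have hG : ∀ t, HasDerivAt (fun t => (α t).1) (clip (α t).2) t := fun t =>
    (hasFDerivAt_fst (p := α t)).comp_hasDerivAt t (hα t)
  have hH : ∀ t, HasDerivAt (fun t => (α t).2) (-g (clip (α t).1)) t := fun t =>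
    (hasFDerivAt_snd (p := α t)).comp_hasDerivAt t (hα t)
  have hgcpos : ∀ r, 0 < r → 0 < g (clip r) := fun r hr => hpos _ (hcpos r hr)
  have hgcodd : ∀ r, g (clip (-r)) = -g (clip r) := fun r => by rw [hcodd, hodd]
  have hprim : ∀ {h : ℝ → ℝ}, Continuous h → ∀ x, HasDerivAt (fun x => ∫ r in (0 : ℝ)..x, h r)
      (h x) x :=
    fun hc x => intervalIntegral.integral_hasDerivAt_right (hc.intervalIntegrable _ _)
      (hc.stronglyMeasurableAtFilter _ _) hc.continuousAt
  have hprim0 : ∀ {h : ℝ → ℝ}, Continuous h → (∀ r, h (-r) = -h r) → (∀ r, 0 < r → 0 < h r) →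
      ∀ x, 0 ≤ ∫ r in (0 : ℝ)..x, h r := by
    intro h hc ho hp x
    by_contra! hlt
    have := abs_le_of_primitive_le hc ho hp (x := x) le_rfl (by simpa using hlt.le)
    have hx : x = 0 := abs_nonpos_iff.1 this
    simp [hx] at hlt
  -- conservation of energy for the cut off vector field
  have hE : ∀ t, (∫ r in (0 : ℝ)..(α t).2, clip r) + ∫ r in (0 : ℝ)..(α t).1, g (clip r) =
      ∫ r in (0 : ℝ)..1, g (clip r) := by
    have hd : ∀ t, HasDerivAt (fun t => (∫ r in (0 : ℝ)..(α t).2, clip r) +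
        ∫ r in (0 : ℝ)..(α t).1, g (clip r)) 0 t := by
      intro t
      refine (((hprim hcc _).comp t (hH t)).add ((hprim hgcc _).comp t (hG t))).congr_deriv ?_
      ring
    intro t
    have := is_const_of_deriv_eq_zero (fun t => (hd t).differentiableAt) (fun t => (hd t).deriv) t 0
    rw [this, h0]
    simp
  have hG1 : ∀ t, |(α t).1| ≤ 1 := fun t =>
    abs_le_of_primitive_le hgcc hgcodd hgcpos zero_le_one
      (by linarith [hE t, hprim0 hcc hcodd hcpos (α t).2])
  have hH1 : ∀ t, |(α t).2| ≤ 1 := fun t => by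
    refine abs_le_of_primitive_le hcc hcodd hcpos zero_le_one ?_
    have h1 : ∫ r in (0 : ℝ)..1, g (clip r) ≤ ∫ r in (0 : ℝ)..1, clip r := by
      refine intervalIntegral.integral_mono_on zero_le_one (hgcc.intervalIntegrable _ _)
        (hcc.intervalIntegrable _ _) fun r hr => ?_
      rw [hce r (by rw [abs_of_nonneg hr.1]; exact hr.2)]
      exact hle r hr
    linarith [hE t, hprim0 hgcc hgcodd hgcpos (α t).1]
  refine ⟨fun t => (α t).1, fun t => (α t).2, by simp [h0], by simp [h0], fun t => ?_, fun t => ?_,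
    fun t => ⟨hG1 t, hH1 t⟩⟩
  · simpa only [hce _ (hH1 t)] using hG t
  · simpa only [hce _ (hG1 t)] using hH t

/-- The restriction to the real line of the power nonlinearity. -/
def powerReal (κ r : ℝ) : ℝ := |r| ^ (κ - 1) * r

lemma nonlinearity_ofReal (κ r : ℝ) : nonlinearity κ (r : ℂ) = (powerReal κ r : ℂ) := by
  rw [nonlinearity, powerReal, Complex.norm_real, Real.norm_eq_abs]
  push_cast
  ring

lemma contDiff_powerReal {κ : ℝ} (hκ : 1 < κ) {k : ℕ}
    (hsmooth : (∃ m : ℕ, Odd m ∧ κ = m) ∨ (k : ℝ) + 2 ≤ κ) :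
    ContDiff ℝ (k + 1 : ℕ) (powerReal κ) := by
  have h : powerReal κ = fun r : ℝ => (nonlinearity κ (r : ℂ)).re := by
    ext r
    rw [nonlinearity_ofReal, Complex.ofReal_re]
  rw [h]
  exact Complex.reCLM.contDiff.comp ((contDiff_nonlinearity hκ hsmooth).comp
    Complex.ofRealCLM.contDiff)

lemma powerReal_mul_self {κ : ℝ} (h : κ + 1 ≠ 0) (r : ℝ) : powerReal κ r * r = |r| ^ (κ + 1) := by
  rcases eq_or_ne r 0 with rfl | hr
  · simp [Real.zero_rpow h]
  · have := abs_pos.2 hr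
    rw [powerReal, mul_assoc, ← sq, ← sq_abs, ← Real.rpow_natCast, ← Real.rpow_add this]
    congr 1
    push_cast
    ring

/-- A solution of `G'' = -|G|^{κ-1} G` with `G(0) = 1`, `G'(0) = 0`; `H = G'`. -/
structure IsOscillator (κ : ℝ) (G H : ℝ → ℝ) : Prop where
  zero_fst : G 0 = 1
  zero_snd : H 0 = 0
  hasDeriv_fst : ∀ t, HasDerivAt G (H t) t
  hasDeriv_snd : ∀ t, HasDerivAt H (-powerReal κ (G t)) t
  abs_fst_le : ∀ t, |G t| ≤ 1
  abs_snd_le : ∀ t, |H t| ≤ 1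

lemma exists_isOscillator {κ : ℝ} (hκ : 1 < κ) {k : ℕ}
    (hsmooth : (∃ m : ℕ, Odd m ∧ κ = m) ∨ (k : ℝ) + 2 ≤ κ) : ∃ G H, IsOscillator κ G H := by
  obtain ⟨G, H, h1, h2, h3, h4, h5⟩ := exists_oscillator (g := powerReal κ)
    ((contDiff_powerReal hκ hsmooth).of_le (by norm_cast; omega))
    (fun r => by rw [powerReal, powerReal, abs_neg]; ring)
    (fun r hr => mul_pos (Real.rpow_pos_of_pos (abs_pos.2 hr.ne') _) hr)
    (fun r hr => by
      rw [powerReal, abs_of_nonneg hr.1]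
      exact mul_le_of_le_one_left hr.1 (Real.rpow_le_one hr.1 hr.2 (by linarith)))
  exact ⟨G, H, h1, h2, h3, h4, fun t => (h5 t).1, fun t => (h5 t).2⟩

namespace IsOscillator

variable {κ : ℝ} {G H : ℝ → ℝ} (h : IsOscillator κ G H)

lemma deriv_fst (h : IsOscillator κ G H) : deriv G = H := funext fun t => (h.hasDeriv_fst t).deriv

lemma contDiff (h : IsOscillator κ G H) {k : ℕ} (hp : ContDiff ℝ (k + 1 : ℕ) (powerReal κ)) :
    ContDiff ℝ (k + 1 : ℕ) G ∧ ContDiff ℝ (k + 1 : ℕ) H := by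
  have hGd : Differentiable ℝ G := fun t => (h.hasDeriv_fst t).differentiableAt
  have hHd : Differentiable ℝ H := fun t => (h.hasDeriv_snd t).differentiableAt
  have hH : deriv H = fun t => -powerReal κ (G t) := funext fun t => (h.hasDeriv_snd t).deriv
  have key : ∀ j : ℕ, j ≤ k + 1 → ContDiff ℝ j G ∧ ContDiff ℝ j H := by
    intro j
    induction j with
    | zero => exact fun _ => ⟨contDiff_zero.2 hGd.continuous, contDiff_zero.2 hHd.continuous⟩
    | succ j ih =>
      intro hj
      obtain ⟨i1, i2⟩ := ih (by omega)
      have hpj : ContDiff ℝ j (powerReal κ) := hp.of_le (by exact_mod_cast (by omega : j ≤ k + 1))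
      constructor
      · have := (contDiff_succ_iff_deriv (n := j) (f := G)).2 ⟨hGd, by simp, by rwa [h.deriv_fst]⟩
        exact_mod_cast this
      · have := (contDiff_succ_iff_deriv (n := j) (f := H)).2
          ⟨hHd, by simp, by rw [hH]; exact (hpj.comp i1).neg⟩
        exact_mod_cast this
  exact key _ le_rfl

/-- The energy identity, combined with the equation. -/
lemma abs_rpow_eq (h : IsOscillator κ G H) (hκ : 1 < κ) (t : ℝ) :
    |G t| ^ (κ + 1) = 2 / (κ + 3) -
      (κ + 1) / (κ + 3) * (H t ^ 2 - G t * powerReal κ (G t)) := by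
  have hd : ∀ t, HasDerivAt (fun t => H t ^ 2 / 2 + |G t| ^ (κ + 1) / (κ + 1)) 0 t := by
    intro t
    have h1 := ((hasDerivAt_abs_rpow (G t) (p := κ + 1) (by linarith)).comp t
      (h.hasDeriv_fst t)).div_const (κ + 1)
    refine ((((h.hasDeriv_snd t).pow 2).div_const 2).add h1).congr_deriv ?_
    have : κ + 1 ≠ 0 := by linarith
    rw [powerReal, show κ + 1 - 2 = κ - 1 by ring]
    field_simp
    ring
  have := is_const_of_deriv_eq_zero (fun t => (hd t).differentiableAt) (fun t => (hd t).deriv) t 0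
  simp only [h.zero_fst, h.zero_snd] at this
  have h1 : κ + 1 ≠ 0 := by linarith
  have h3 : κ + 3 ≠ 0 := by linarith
  rw [mul_comm (G t), powerReal_mul_self h1]
  rw [abs_one, Real.one_rpow] at this
  field_simp at this ⊢
  linarith

end IsOscillator

/-! ### The solution of the dispersionless equation -/

lemma weighted_smul (k : ℕ) (c : ℂ) (f : 𝓢(Space n, ℂ)) :
    weighted k (c • f) = c • weighted k f := by
  apply ofWeighted_injective k
  rw [map_smul, ofWeighted_weighted, ofWeighted_weighted]
  exact (SchwartzMap.toLpCLM ℂ ℂ 2 volume).map_smul c f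

lemma hNorm_eq_ofReal (k : ℕ) (f : 𝓢(Space n, ℂ)) : hNorm k f = ENNReal.ofReal ‖weighted k f‖ := by
  rw [hNorm_schwartz, ofReal_norm]

/-- Superposition with a dilated profile: `t ↦ F(t y) ψ` is a continuous curve in `H^k`. -/
lemma exists_continuous_comp_mul {k : ℕ} (hk : (n : ℝ) / 2 < k) {F : ℝ → ℝ}
    (hF : ContDiff ℝ (k + 1 : ℕ) F) (y ψ : 𝓢(Space n, ℂ)) :
    ∃ p : ℝ → L2 n, Continuous p ∧ ∀ t x, evalAt hk x (p t) = F (t * (y x).re) * ψ x := by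
  set Fc : ℂ → ℂ := fun z => (F z.re : ℂ) with hFc
  have hFcd : ContDiff ℝ (k + 1 : ℕ) Fc :=
    Complex.ofRealCLM.contDiff.comp (hF.comp Complex.reCLM.contDiff)
  have hFc1 : ContDiff ℝ 1 Fc := hFcd.of_le (by norm_cast; omega)
  have hty : ∀ (t : ℝ) x, Fc (((t : ℂ) • y) x) = F (t * (y x).re) := fun t x => by
    simp [hFc]
  have hnty : ∀ t : ℝ, hNorm k ((t : ℂ) • y : 𝓢(Space n, ℂ)) = ENNReal.ofReal (|t| *
      ‖weighted k y‖) :=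
    fun t => by rw [hNorm_eq_ofReal, weighted_smul, norm_smul, Complex.norm_real, Real.norm_eq_abs]
  -- the local Lipschitz bound, with a representative of the difference
  have key : ∀ T : ℝ, 0 ≤ T → ∃ C : ℝ, 0 ≤ C ∧ ∀ t r : ℝ, |t| ≤ T → |r| ≤ T → ∃ χ : L2 n,
      (∀ x, evalAt hk x χ = (F (t * (y x).re) - F (r * (y x).re)) * ψ x) ∧
      ‖χ‖ ≤ C * |t - r| := by
    intro T hT
    obtain ⟨C, hC⟩ := exists_hNorm_sub_comp_mul_le hk (T * ‖weighted k y‖).toNNReal k le_rfl Fc hFcd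
    refine ⟨C * ‖weighted k y‖ * ‖weighted k ψ‖, by positivity, fun t r ht hr => ?_⟩
    have hR : ∀ t : ℝ, |t| ≤ T → hNorm k ((t : ℂ) • y : 𝓢(Space n, ℂ)) ≤
        ((T * ‖weighted k y‖).toNNReal : ℝ≥0∞) := by
      intro t ht
      rw [hnty]
      exact ENNReal.ofReal_le_ofReal (by gcongr)
    have h1 := hC _ _ ψ (hR t ht) (hR r hr)
    rw [← sub_smul, ← Complex.ofReal_sub, hnty, hNorm_eq_ofReal k ψ, ← ENNReal.ofReal_coe_nnreal,
      ← ENNReal.ofReal_mul C.coe_nonneg, ← ENNReal.ofReal_mul (by positivity)] at h1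
    have hn := nice_sub_comp_mul hFc1 ((t : ℂ) • y) ((r : ℂ) • y) ψ
    obtain ⟨χ, hχ, hχn⟩ := exists_evalAt_eq hk hn.contDiff.continuous hn.integrable
      (h1.trans_lt ENNReal.ofReal_lt_top)
    refine ⟨χ, fun x => by rw [hχ, hty, hty], ?_⟩
    rw [← hχn, ← ofReal_norm, ENNReal.ofReal_le_ofReal_iff (by positivity)] at h1
    linarith
  have hex : ∀ t, ∃ χ : L2 n, ∀ x, evalAt hk x χ = F (t * (y x).re) * ψ x := by
    intro t
    obtain ⟨C, -, hC⟩ := key |t| (abs_nonneg t)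
    obtain ⟨χ, hχ, -⟩ := hC t 0 le_rfl (by simp)
    refine ⟨χ + (F 0 : ℂ) • weighted k ψ, fun x => ?_⟩
    rw [map_add, map_smul, hχ, evalAt_weighted, zero_mul, smul_eq_mul]
    ring
  choose p hp using hex
  refine ⟨p, continuous_iff_continuousAt.2 fun t => ?_, hp⟩
  obtain ⟨C, hC0, hC⟩ := key (|t| + 1) (by positivity)
  refine tendsto_iff_norm_sub_tendsto_zero.2 ?_
  have hlim : Tendsto (fun r => C * |r - t|) (𝓝 t) (𝓝 0) := by
    have : Continuous fun r => C * |r - t| := by fun_prop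
    simpa using this.tendsto t
  refine squeeze_zero' (Eventually.of_forall fun _ => norm_nonneg _) ?_ hlim
  filter_upwards [Metric.ball_mem_nhds t one_pos] with r hr
  rw [Metric.mem_ball, Real.dist_eq] at hr
  have hr' : |r| ≤ |t| + 1 := by
    have := abs_sub_abs_le_abs_sub r t
    linarith
  obtain ⟨χ, hχ, hχn⟩ := hC r t hr' (by linarith)
  have e : p r - p t = χ := eq_of_evalAt_eq hk fun x => by rw [map_sub, hp, hp, hχ]; ring
  rw [e]
  exact hχn

/-- Initial data `f` and the frequency `η = f^{(κ-1)/2}` of the corresponding oscillations; the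
frequency is not constant in the direction `i`. -/
structure IsProfile (κ : ℝ) (i : Fin n) (f η : Space n → ℝ) : Prop where
  contDiff_fst : ContDiff ℝ ∞ f
  contDiff_snd : ContDiff ℝ ∞ η
  compact_fst : HasCompactSupport f
  compact_snd : HasCompactSupport η
  nonneg : ∀ x, 0 ≤ f x
  power_eq : ∀ x, powerReal κ (f x) = η x ^ 2 * f x
  exists_ne : ∃ x, f x * fderiv ℝ η x (stdVec i) ^ 2 ≠ 0

lemma powerReal_mul (κ a r : ℝ) :
    powerReal κ (a * r) = powerReal κ a * powerReal κ r := by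
  rw [powerReal, powerReal, powerReal, abs_mul, Real.mul_rpow (abs_nonneg _) (abs_nonneg _)]
  ring

lemma norm_stdVec (i : Fin n) : ‖(stdVec i : Space n)‖ = 1 := by
  simp [stdVec]

/-- With `E x = exp (-1 / (1 - ‖x‖²))` inside the unit ball, `f = E^{2/(κ-1)}` and `η = E`. If
`f (∂ᵢη)²` vanished identically, `η` would be constant along a line that leaves the ball. -/
lemma exists_isProfile {κ : ℝ} (hκ : 1 < κ) (i : Fin n) : ∃ f η, IsProfile (n := n) κ i f η := by
  have hq : 0 < (κ - 1) / 2 := by linarith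
  set b : ℝ → Space n → ℝ := fun c x => expNegInvGlue (c * (1 - ‖x‖ ^ 2)) with hb
  have hsmooth : ∀ c, ContDiff ℝ ∞ (b c) := fun c =>
    expNegInvGlue.contDiff.comp (contDiff_const.mul (contDiff_const.sub (contDiff_norm_sq ℝ)))
  have hzero : ∀ c, 0 < c → ∀ x : Space n, 1 ≤ ‖x‖ → b c x = 0 := fun c hc x hx =>
    expNegInvGlue.zero_of_nonpos (mul_nonpos_of_nonneg_of_nonpos hc.le
      (by linarith [one_le_pow₀ hx (n := 2)]))
  have hpos : ∀ c, 0 < c → ∀ x : Space n, ‖x‖ < 1 → 0 < b c x := fun c hc x hx =>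
    expNegInvGlue.pos_of_pos (mul_pos hc (by nlinarith [norm_nonneg x]))
  have hcomp : ∀ c, 0 < c → HasCompactSupport (b c) := fun c hc =>
    HasCompactSupport.intro (isCompact_closedBall (0 : Space n) 1) fun x hx =>
      hzero c hc x (by simpa using (not_le.1 fun h => hx (mem_closedBall_zero_iff.2 h)).le)
  refine ⟨b ((κ - 1) / 2), b 1, hsmooth _, hsmooth _, hcomp _ hq, hcomp _ one_pos,
    fun x => expNegInvGlue.nonneg _, fun x => ?_, ?_⟩
  · rcases lt_or_ge ‖x‖ 1 with hx | hx
    · have hu : 0 < 1 - ‖x‖ ^ 2 := by nlinarith [norm_nonneg x]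
      have hne : ∀ c : ℝ, 0 < c → b c x = Real.exp (-(c * (1 - ‖x‖ ^ 2))⁻¹) := fun c hc => by
        simp only [hb, expNegInvGlue, if_neg (mul_pos hc hu).not_ge]
      rw [powerReal, abs_of_pos (hpos _ hq x hx), hne _ hq, hne _ one_pos, ← Real.exp_mul,
        ← Real.exp_nat_mul]
      congr 2
      have : κ - 1 ≠ 0 := by linarith
      field_simp
      push_cast
      ring
    · rw [hzero _ hq x hx, powerReal]
      simp
  · by_contra! h
    have hd : ∀ x, DifferentiableAt ℝ (b 1) x := fun x => (hsmooth 1).contDiffAt.differentiableAt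
        (by simp)
    have h0 : ∀ x, fderiv ℝ (b 1) x (stdVec i) = 0 := by
      intro x
      rcases lt_or_ge ‖x‖ 1 with hx | hx
      · have := (mul_eq_zero.1 (h x)).resolve_left (hpos _ hq x hx).ne'
        exact pow_eq_zero_iff (two_ne_zero) |>.1 this
      · have hmin : IsLocalMin (b 1) x := Eventually.of_forall fun z => by
          rw [hzero 1 one_pos x hx]
          exact expNegInvGlue.nonneg _
        rw [hmin.fderiv_eq_zero]
        rfl
    have hline : ∀ r : ℝ, HasDerivAt (fun r : ℝ => b 1 (r • stdVec i)) 0 r := by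
      intro r
      have h1 : HasDerivAt (fun r : ℝ => r • (stdVec i : Space n)) (stdVec i) r := by
        simpa using (hasDerivAt_id r).smul_const (stdVec i : Space n)
      have := (hd (r • stdVec i)).hasFDerivAt.comp_hasDerivAt r h1
      rwa [h0] at this
    have h2 := is_const_of_deriv_eq_zero (fun r => (hline r).differentiableAt)
      (fun r => (hline r).deriv) 0 1
    simp only [zero_smul, one_smul] at h2
    rw [hzero 1 one_pos (stdVec i) (norm_stdVec i).ge] at h2
    exact (hpos 1 one_pos 0 (by simp)).ne' h2

/-- The complex valued Schwartz function given by a real valued test function. -/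
def schwartzOf {f : Space n → ℝ} (h1 : HasCompactSupport f) (h2 : ContDiff ℝ ∞ f) :
    𝓢(Space n, ℂ) :=
  (h1.comp_left (g := ((↑) : ℝ → ℂ)) Complex.ofReal_zero).toSchwartzMap
    (Complex.ofRealCLM.contDiff.comp h2)

lemma schwartzOf_apply {f : Space n → ℝ} (h1 : HasCompactSupport f) (h2 : ContDiff ℝ ∞ f)
    (x : Space n) : schwartzOf h1 h2 x = f x := rfl

lemma mulOp_phase_zero_coeff (t : ℝ) (f : L2 n) :
    mulOp (phase 0 t) f = Complex.exp (Complex.I * t) • f :=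
  mulOp_const _ _ fun ξ => by simp [phase_apply, om]

/-- The explicit solution `f G(t η)` of `∂ₜ²u = -|u|^{κ-1} u`, as a solution of the first order
system with vanishing dispersion; there `ω = 1`. -/
lemma IsProfile.exists_isMild {k : ℕ} {hk : (n : ℝ) / 2 < k} {κ : ℝ} {N : L2 n → L2 n}
    (hN : IsBeamNonlinearity hk κ N) (hNc : Continuous N)
    (hκ : ContDiff ℝ (k + 1 : ℕ) (powerReal κ)) {G H : ℝ → ℝ} (hG : IsOscillator κ G H)
    {i : Fin n} {f η : Space n → ℝ} (h : IsProfile κ i f η) (T : ℝ) (hT : 0 ≤ T) :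
    ∃ z, IsMild N 0 T z ∧
      z 0 = stateOf 0 0 (weighted (k + 2) (schwartzOf h.compact_fst h.contDiff_fst)) 0 ∧
      ∀ t x, evalAt hk x (posOf 0 t (z t)) = ((f x * G (t * η x) : ℝ) : ℂ) := by
  set φ := schwartzOf h.compact_fst h.contDiff_fst with hφ
  set y := schwartzOf h.compact_snd h.contDiff_snd with hy
  obtain ⟨p, hpc, hp⟩ := exists_continuous_comp_mul hk (hG.contDiff hκ).1 y φ
  obtain ⟨q, hqc, hq⟩ := exists_continuous_comp_mul hk (hG.contDiff hκ).2 y (mulS y φ)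
  have hsep : ∀ ψ : L2 n, (∀ x, (evalAt hk x).restrictScalars ℝ ψ = 0) → ψ = 0 := fun ψ hψ =>
    eq_of_evalAt_eq hk fun x => by rw [map_zero]; exact hψ x
  have hyr : ∀ x, (y x).re = η x := fun x => Complex.ofReal_re _
  have hp' : ∀ t x, evalAt hk x (p t) = ((f x * G (t * η x) : ℝ) : ℂ) := fun t x => by
    rw [hp, hyr, hφ, schwartzOf_apply]
    push_cast
    ring
  have hq' : ∀ t x, evalAt hk x (q t) = ((f x * (H (t * η x) * η x) : ℝ) : ℂ) := fun t x => by
    have : mulS y φ x = y x * φ x := rfl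
    rw [hq, hyr, this, hφ, hy, schwartzOf_apply, schwartzOf_apply]
    push_cast
    ring
  have hr' : ∀ t x, evalAt hk x (N (p t) - p t) =
      ((f x * (-powerReal κ (G (t * η x)) * η x * η x) : ℝ) : ℂ) := fun t x => by
    rw [map_sub, hN, hp', nonlinearity_ofReal, powerReal_mul, h.power_eq]
    push_cast
    ring
  -- `p = f G(tη)` and its time derivative `q = f η G'(tη)`; pointwise differentiability suffices
  have hpd := hasDerivWithinAt_of_separating (ι := Space n) (E := L2 n) (F := ℂ)
    (fun x => (evalAt hk x).restrictScalars ℝ) hsep hT (z := p) (G := q) hqc.continuousOn (by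
      intro x t _
      simp only [ContinuousLinearMap.coe_restrictScalars', hp', hq']
      have h1 : HasDerivAt (fun r : ℝ => r * η x) (η x) t := by
        simpa using (hasDerivAt_id t).mul_const (η x)
      exact ((((hG.hasDeriv_fst _).comp t h1).const_mul (f x)).ofReal_comp).hasDerivWithinAt)
  have hqd := hasDerivWithinAt_of_separating (ι := Space n) (E := L2 n) (F := ℂ)
    (fun x => (evalAt hk x).restrictScalars ℝ) hsep hT (z := q) (G := fun t => N (p t) - p t)
    ((hNc.comp hpc).sub hpc).continuousOn (by
      intro x t _
      simp only [ContinuousLinearMap.coe_restrictScalars', hq', hr']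
      have h1 : HasDerivAt (fun r : ℝ => r * η x) (η x) t := by
        simpa using (hasDerivAt_id t).mul_const (η x)
      exact (((((hG.hasDeriv_snd _).comp t h1).mul_const (η x)).const_mul
        (f x)).ofReal_comp).hasDerivWithinAt)
  have hexp : ∀ (a t : ℝ), HasDerivAt (fun r : ℝ => Complex.exp (Complex.I * ((a * r : ℝ) : ℂ)))
      (Complex.exp (Complex.I * ((a * t : ℝ) : ℂ)) * (Complex.I * a)) t := by
    intro a t
    have h1 : HasDerivAt (fun r : ℝ => ((a * r : ℝ) : ℂ)) (a : ℂ) t := by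
      simpa using ((hasDerivAt_id t).const_mul a).ofReal_comp
    exact (h1.const_mul Complex.I).cexp
  have hwave : ∀ a : ℝ, a * a = 1 → ∀ t ∈ Set.Icc 0 T, HasDerivWithinAt
      (fun r : ℝ => Complex.exp (Complex.I * ((a * r : ℝ) : ℂ)) • (p r + (a * Complex.I) • q r))
      ((a * Complex.I) • Complex.exp (Complex.I * ((a * t : ℝ) : ℂ)) • N (p t)) (Set.Icc 0 T) t :=
          by
    intro a ha t ht
    have h1 := (hexp a t).hasDerivWithinAt (s := Set.Icc 0 T) |>.fun_smul
      ((hpd t ht).add (HasDerivWithinAt.clm_complex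
        (((a : ℂ) * Complex.I) • ContinuousLinearMap.id ℂ (L2 n)) (hqd t ht)))
    refine h1.congr_deriv ?_
    have ha' : (a : ℂ) * a = 1 := by exact_mod_cast ha
    simp only [smul_apply, ContinuousLinearMap.id_apply, Pi.add_apply]
    rw [← sub_eq_zero]
    trans (Complex.exp (Complex.I * ((a * t : ℝ) : ℂ)) *
      (Complex.I * Complex.I * (a * a) + 1)) • q t
    · module
    · rw [ha', Complex.I_mul_I]
      simp
  have hpos : ∀ t, posOf 0 t (Complex.exp (Complex.I * t) • (p t + Complex.I • q t),
      Complex.exp (Complex.I * ((-t : ℝ) : ℂ)) • (p t - Complex.I • q t)) = p t := by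
    intro t
    rw [posOf]
    simp only [mulOp_phase_zero_coeff, smul_smul, ← Complex.exp_add]
    have h1 : ∀ g : L2 n, mulOp (omInv 0) g = (1 : ℂ) • g := fun g =>
      mulOp_const _ _ fun ξ => by simp [omInv_apply, om]
    rw [h1]
    have e1 : Complex.I * ((-t : ℝ) : ℂ) + Complex.I * t = 0 := by push_cast; ring
    have e2 : Complex.I * (t : ℂ) + Complex.I * ((-t : ℝ) : ℂ) = 0 := by push_cast; ring
    rw [e1, e2, Complex.exp_zero]
    module
  refine ⟨fun t => (Complex.exp (Complex.I * t) • (p t + Complex.I • q t),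
    Complex.exp (Complex.I * ((-t : ℝ) : ℂ)) • (p t - Complex.I • q t)), fun t ht => ?_, ?_,
    fun t x => by rw [hpos, hp']⟩
  · have h1 := hwave 1 (by norm_num) t ht
    have h2 := hwave (-1) (by norm_num) t ht
    refine ((h1.prodMk h2).congr_deriv ?_).congr_of_mem (fun r _ => ?_) ht
    · simp only [beamField, hpos, mulOp_phase_zero_coeff]
      simp
    · simp [sub_eq_add_neg]
  · have hp0 : p 0 = mulOp (omJap 0) (weighted (k + 2) φ) := by
      have h1 : mulOp (omJap 0) (weighted (k + 2) φ) = mulOp (japInv n 2) (weighted (k + 2) φ) :=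
        mulOp_congr (fun ξ => by rw [omJap_apply, japInv_apply']; simp [om]) _
      rw [h1, mulOp_japInv_weighted_add]
      refine eq_of_evalAt_eq hk fun x => ?_
      rw [hp', evalAt_weighted, hφ, schwartzOf_apply, zero_mul, hG.zero_fst, mul_one]
    have hq0 : q 0 = 0 := eq_of_evalAt_eq hk fun x => by
      rw [hq', zero_mul, hG.zero_snd, map_zero]
      simp
    rw [stateOf]
    simp only [mulOp_phase_zero_coeff, hp0, hq0]

/-! ### Growth of the homogeneous norm -/

lemma eLpNorm_fourier {h : Space n → ℂ} (h1 : Integrable h) (h2 : MemLp h 2) :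
    eLpNorm (𝓕 h) 2 volume = eLpNorm h 2 volume := by
  rw [← eLpNorm_congr_ae (fourier_toLp_ae_eq h1 h2), ← eLpNorm_congr_ae h2.coeFn_toLp,
    ← Lp.enorm_def, ← Lp.enorm_def, ← ofReal_norm, ← ofReal_norm, Lp.norm_fourier_eq]

/-- If `h = (∂ᵢA + B) / t` with `t` large, then `h` has little mass at frequencies below `ρ`, and the
pairing with `g` is controlled by the homogeneous norm of `g`. -/
lemma enorm_inner_le_homNorm {i : Fin n} {A B h : Space n → ℂ} (hA : Integrable A)
    (hAd : Differentiable ℝ A) (hA' : Integrable (fderiv ℝ A)) (hA2 : MemLp A 2)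
    (hB : Integrable B) (hB2 : MemLp B 2) (hh2 : MemLp h 2) {t : ℝ} (ht : 0 < t)
    (hrel : ∀ x, h x = (t : ℂ)⁻¹ * (fderiv ℝ A x (stdVec i) + B x)) {ρ s : ℝ} (hρ : 0 < ρ)
    (hs : 0 < s) (g : L2 n) :
    ‖inner ℂ g (hh2.toLp h)‖ₑ ≤ ENNReal.ofReal (ρ / t) * (‖g‖ₑ * eLpNorm A 2) +
      ENNReal.ofReal (1 / t) * (‖g‖ₑ * eLpNorm B 2) +
      ENNReal.ofReal (ρ ^ (-s)) * (homNorm s g * eLpNorm h 2) := by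
  have hA'' : Integrable fun x => fderiv ℝ A x (stdVec i) :=
    (ContinuousLinearMap.apply ℝ ℂ (stdVec i : Space n)).integrable_comp hA'
  have hhe : h = (t : ℂ)⁻¹ • ((fun x => fderiv ℝ A x (stdVec i)) + B) := funext fun x => by
    rw [hrel]
    rfl
  have hh1 : Integrable h := by
    rw [hhe]
    exact (hA''.add hB).smul _
  have hF : ∀ ξ, 𝓕 h ξ = (t : ℂ)⁻¹ * ((2 * Real.pi * Complex.I * (ξ i : ℝ)) * 𝓕 A ξ + 𝓕 B ξ) := by
    intro ξ
    have h1 : 𝓕 h ξ = (t : ℂ)⁻¹ * 𝓕 ((fun x => fderiv ℝ A x (stdVec i)) + B) ξ := by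
      rw [hhe, Real.fourier_eq, Real.fourier_eq, ← integral_const_mul]
      refine integral_congr_ae (ae_of_all _ fun x => ?_)
      simp only [Pi.smul_apply, smul_eq_mul]
      rw [mul_smul_comm]
    rw [h1]
    have h2 := fourier_add_apply hA'' hB ξ
    have h3 := fourier_fderiv_apply hA hAd hA' (stdVec i) ξ
    rw [inner_stdVec] at h3
    rw [← h3, ← h2]
    rfl
  -- frequencies below and above `ρ`
  have hpt : ∀ ξ, ‖(𝓕 g : L2 n) ξ‖ₑ * ‖𝓕 h ξ‖ₑ ≤
      ENNReal.ofReal (ρ / t) * (‖(𝓕 g : L2 n) ξ‖ₑ * ‖𝓕 A ξ‖ₑ) +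
      ENNReal.ofReal (1 / t) * (‖(𝓕 g : L2 n) ξ‖ₑ * ‖𝓕 B ξ‖ₑ) +
      ENNReal.ofReal (ρ ^ (-s)) *
        (‖(((2 * Real.pi * ‖ξ‖) ^ s : ℝ) : ℂ) * (𝓕 g : L2 n) ξ‖ₑ * ‖𝓕 h ξ‖ₑ) := by
    intro ξ
    rcases le_total (2 * Real.pi * ‖ξ‖) ρ with hξ | hξ
    · refine le_add_right ?_
      have h1 : ‖𝓕 h ξ‖ ≤ ρ / t * ‖𝓕 A ξ‖ + 1 / t * ‖𝓕 B ξ‖ := by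
        rw [hF, norm_mul, norm_inv, Complex.norm_real, Real.norm_of_nonneg ht.le]
        have h2 := norm_add_le ((2 * Real.pi * Complex.I * (ξ i : ℝ)) * 𝓕 A ξ) (𝓕 B ξ)
        have h3 : ‖(2 * Real.pi * Complex.I * (ξ i : ℝ)) * 𝓕 A ξ‖ ≤ ρ * ‖𝓕 A ξ‖ := by
          rw [norm_mul]
          refine mul_le_mul_of_nonneg_right ?_ (norm_nonneg _)
          have h4 : |ξ i| ≤ ‖ξ‖ := PiLp.norm_apply_le ξ i
          have h5 : ‖(2 * Real.pi * Complex.I * (ξ i : ℝ) : ℂ)‖ = 2 * Real.pi * |ξ i| := by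
            simp [abs_of_pos Real.pi_pos]
          rw [h5]
          refine le_trans ?_ hξ
          gcongr
        calc t⁻¹ * _ ≤ t⁻¹ * (ρ * ‖𝓕 A ξ‖ + ‖𝓕 B ξ‖) := by gcongr; linarith
          _ = _ := by ring
      have h2 : ‖𝓕 h ξ‖ₑ ≤ ENNReal.ofReal (ρ / t) * ‖𝓕 A ξ‖ₑ + ENNReal.ofReal (1 / t) * ‖𝓕 B ξ‖ₑ :=
          by
        rw [← ofReal_norm, ← ofReal_norm, ← ofReal_norm, ← ENNReal.ofReal_mul (by positivity),
          ← ENNReal.ofReal_mul (by positivity), ← ENNReal.ofReal_add (by positivity)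
              (by positivity)]
        exact ENNReal.ofReal_le_ofReal h1
      calc ‖(𝓕 g : L2 n) ξ‖ₑ * ‖𝓕 h ξ‖ₑ ≤ ‖(𝓕 g : L2 n) ξ‖ₑ * _ := mul_le_mul_right h2 _
        _ = _ := by ring
    · refine le_add_left ?_
      rw [enorm_mul, ← mul_assoc, ← mul_assoc, ← ofReal_norm (((2 * Real.pi * ‖ξ‖) ^ s : ℝ) : ℂ),
        Complex.norm_real, Real.norm_of_nonneg (by positivity), ← ENNReal.ofReal_mul
            (by positivity)]
      have h1 : 1 ≤ ρ ^ (-s) * (2 * Real.pi * ‖ξ‖) ^ s := by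
        rw [Real.rpow_neg hρ.le, inv_mul_eq_div, one_le_div (by positivity)]
        exact Real.rpow_le_rpow hρ.le hξ hs.le
      calc ‖(𝓕 g : L2 n) ξ‖ₑ * ‖𝓕 h ξ‖ₑ = 1 * ‖(𝓕 g : L2 n) ξ‖ₑ * ‖𝓕 h ξ‖ₑ := by rw [one_mul]
        _ ≤ _ := by
          gcongr
          rw [← ENNReal.ofReal_one]
          exact ENNReal.ofReal_le_ofReal h1
  have hgm : AEMeasurable (fun ξ => ‖(𝓕 g : L2 n) ξ‖ₑ) volume := (Lp.memLp (𝓕 g : L2 n)).1.enorm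
  have hKm : AEStronglyMeasurable
      (fun ξ => (((2 * Real.pi * ‖ξ‖) ^ s : ℝ) : ℂ) * (𝓕 g : L2 n) ξ) volume := by
    refine AEStronglyMeasurable.mul ?_ (Lp.memLp _).1
    exact (Complex.continuous_ofReal.comp ((continuous_const.mul continuous_norm).rpow_const
      fun ξ => Or.inr hs.le)).aestronglyMeasurable
  have hFm : ∀ {q : Space n → ℂ}, Integrable q → AEMeasurable (fun ξ => ‖𝓕 q ξ‖ₑ) volume :=
    fun hq => (continuous_fourier hq).aestronglyMeasurable.enorm
  have hHol : ∀ {p q : Space n → ℂ}, AEMeasurable (fun ξ => ‖p ξ‖ₑ) volume →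
      AEMeasurable (fun ξ => ‖q ξ‖ₑ) volume →
      ∫⁻ ξ, ‖p ξ‖ₑ * ‖q ξ‖ₑ ≤ eLpNorm p 2 * eLpNorm q 2 := fun hp hq => by
    have := lintegral_mul_le_eLpNorm_two hp hq
    rwa [eLpNorm_enorm, eLpNorm_enorm] at this
  have hgn : eLpNorm (𝓕 g : L2 n) 2 volume = ‖g‖ₑ := by
    rw [← Lp.enorm_def, ← ofReal_norm, ← ofReal_norm, Lp.norm_fourier_eq]
  have hinner : ‖inner ℂ g (hh2.toLp h)‖ₑ ≤ ∫⁻ ξ, ‖(𝓕 g : L2 n) ξ‖ₑ * ‖𝓕 h ξ‖ₑ := by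
    rw [← Lp.inner_fourier_eq, L2.inner_def]
    refine (enorm_integral_le_lintegral_enorm _).trans (le_of_eq (lintegral_congr_ae ?_))
    filter_upwards [fourier_toLp_ae_eq hh1 hh2] with ξ e
    rw [e, RCLike.inner_apply, enorm_mul, mul_comm]
    simp
  refine hinner.trans ((lintegral_mono hpt).trans ?_)
  have m1 : AEMeasurable (fun ξ => ENNReal.ofReal (ρ / t) * (‖(𝓕 g : L2 n) ξ‖ₑ * ‖𝓕 A ξ‖ₑ))
      volume := (hgm.mul (hFm hA)).const_mul _
  have m2 : AEMeasurable (fun ξ => ENNReal.ofReal (1 / t) * (‖(𝓕 g : L2 n) ξ‖ₑ * ‖𝓕 B ξ‖ₑ))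
      volume := (hgm.mul (hFm hB)).const_mul _
  have m12 : AEMeasurable (fun ξ => ENNReal.ofReal (ρ / t) * (‖(𝓕 g : L2 n) ξ‖ₑ * ‖𝓕 A ξ‖ₑ) +
      ENNReal.ofReal (1 / t) * (‖(𝓕 g : L2 n) ξ‖ₑ * ‖𝓕 B ξ‖ₑ)) volume := m1.add m2
  rw [lintegral_add_left' m12, lintegral_add_left' m1,
    lintegral_const_mul' _ _ ENNReal.ofReal_ne_top,
    lintegral_const_mul' _ _ ENNReal.ofReal_ne_top, lintegral_const_mul' _ _ ENNReal.ofReal_ne_top]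
  have e1 := hHol hgm (hFm hA)
  have e2 := hHol hgm (hFm hB)
  have e3 := hHol hKm.enorm (hFm hh1)
  rw [hgn, eLpNorm_fourier hA hA2] at e1
  rw [hgn, eLpNorm_fourier hB hB2] at e2
  rw [eLpNorm_fourier hh1 hh2] at e3
  gcongr
  exact e3

lemma eLpNorm_ofReal_le {p q : Space n → ℝ} (h : ∀ x, |p x| ≤ |q x|) :
    eLpNorm (fun x => (p x : ℂ)) 2 volume ≤ eLpNorm q 2 volume :=
  eLpNorm_mono fun x => by simpa using h x

section Pairing

variable {κ : ℝ} {G H : ℝ → ℝ} {i : Fin n} {η e : Space n → ℝ}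

lemma continuous_fderiv_apply {p : Space n → ℝ} (hp : ContDiff ℝ 1 p) (v : Space n) :
    Continuous fun x => fderiv ℝ p x v :=
  (hp.continuous_fderiv one_ne_zero).clm_apply continuous_const

lemma hasCompactSupport_fderiv_apply {p : Space n → ℝ} (hp : HasCompactSupport p) (v : Space n) :
    HasCompactSupport fun x => fderiv ℝ p x v :=
  (hp.fderiv ℝ).comp_left (g := fun L : Space n →L[ℝ] ℝ => L v) (by simp)

lemma hasCompactSupport_sq {p : Space n → ℝ} (hp : HasCompactSupport p) :
    HasCompactSupport fun x => p x ^ 2 := by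
  simp only [sq]
  exact hp.mul_right

lemma HasCompactSupport.ofReal_comp {p : Space n → ℝ} (hp : HasCompactSupport p) :
    HasCompactSupport fun x => (p x : ℂ) :=
  hp.comp_left (g := ((↑) : ℝ → ℂ)) Complex.ofReal_zero

lemma hasFDerivAt_const_mul (hη : ContDiff ℝ 1 η) (T : ℝ) (x : Space n) :
    HasFDerivAt (fun x => T * η x) (T • fderiv ℝ η x) x :=
  (hη.differentiable one_ne_zero x).hasFDerivAt.const_mul T

lemma IsOscillator.contDiff_one (hG : IsOscillator κ G H) (hp : ContDiff ℝ 1 (powerReal κ)) :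
    ContDiff ℝ 1 G ∧ ContDiff ℝ 1 H := by
  simpa using hG.contDiff (k := 0) (by simpa using hp)

lemma IsOscillator.abs_powerReal_le (hG : IsOscillator κ G H) (hκ : 1 < κ) (t : ℝ) :
    |powerReal κ (G t)| ≤ 1 := by
  rw [powerReal, abs_mul, abs_of_nonneg (by positivity)]
  exact mul_le_one₀ (Real.rpow_le_one (abs_nonneg _) (hG.abs_fst_le t) (by linarith))
    (abs_nonneg _) (hG.abs_fst_le t)

/-- The average of `|G(T η)|^{κ+1}` tends to the time average of `|G|^{κ+1}`. -/
lemma IsOscillator.exists_le_integral (hG : IsOscillator κ G H) (hκ : 1 < κ)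
    (hp : ContDiff ℝ 1 (powerReal κ)) {f : Space n → ℝ} (hf : ContDiff ℝ 1 f) (hη : ContDiff ℝ 1 η)
    (hed : ContDiff ℝ 1 e) (hec : HasCompactSupport e)
    (he : ∀ x, fderiv ℝ η x (stdVec i) = e x) : ∃ C : ℝ, ∀ T : ℝ, 0 < T →
      2 / (κ + 3) * (∫ x, f x * e x ^ 2) - C / T ≤
        ∫ x, f x * e x ^ 2 * |G (T * η x)| ^ (κ + 1) := by
  obtain ⟨hG1, hH1⟩ := hG.contDiff_one hp
  have hwd : ContDiff ℝ 1 fun x => f x * e x := hf.mul hed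
  have hwc : HasCompactSupport fun x => f x * e x := hec.mul_left
  have hwc' := hasCompactSupport_fderiv_apply hwc (stdVec i)
  have hwcont' := continuous_fderiv_apply hwd (stdVec i)
  refine ⟨(κ + 1) / (κ + 3) * ∫ x, |fderiv ℝ (fun x => f x * e x) x (stdVec i)|, fun T hT => ?_⟩
  have hQd : ContDiff ℝ 1 fun x => G (T * η x) * H (T * η x) := by fun_prop
  have hQfd : ∀ x, fderiv ℝ (fun x => G (T * η x) * H (T * η x)) x (stdVec i) =
      T * e x * (H (T * η x) ^ 2 - G (T * η x) * powerReal κ (G (T * η x))) := by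
    intro x
    have h1 : HasFDerivAt (fun x => G (T * η x) * H (T * η x)) _ x :=
      ((hG.hasDeriv_fst (T * η x)).comp_hasFDerivAt x (hasFDerivAt_const_mul hη T x)).mul
        ((hG.hasDeriv_snd (T * η x)).comp_hasFDerivAt x (hasFDerivAt_const_mul hη T x))
    rw [h1.fderiv]
    simp only [add_apply, smul_apply, smul_eq_mul, Function.comp_apply, he]
    ring
  have hQc' := continuous_fderiv_apply hQd (stdVec i)
  have iwQ : Integrable (fun x => f x * e x *
      fderiv ℝ (fun x => G (T * η x) * H (T * η x)) x (stdVec i)) (volume : Measure (Space n)) :=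
    (hwd.continuous.mul hQc').integrable_of_hasCompactSupport hwc.mul_right
  -- `∂ᵢ (G G')(Tη)` has a factor `T`, which integration by parts turns into the gain `1 / T`
  have hparts := integral_mul_fderiv_eq_neg_fderiv_mul_of_integrable (𝕜 := ℝ)
    (μ := (volume : Measure (Space n))) (f := fun x => f x * e x)
    (g := fun x => G (T * η x) * H (T * η x)) (v := stdVec i)
    ((hwcont'.mul hQd.continuous).integrable_of_hasCompactSupport hwc'.mul_right) iwQ
    ((hwd.continuous.mul hQd.continuous).integrable_of_hasCompactSupport hwc.mul_right)
    (fun x _ => hwd.differentiable one_ne_zero x) (fun x _ => hQd.differentiable one_ne_zero x)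
  have hbound : ∫ x, f x * e x * fderiv ℝ (fun x => G (T * η x) * H (T * η x)) x (stdVec i) ≤
      ∫ x, |fderiv ℝ (fun x => f x * e x) x (stdVec i)| := by
    rw [hparts]
    refine (neg_le_abs _).trans ((abs_integral_le_integral_abs).trans ?_)
    refine integral_mono_of_nonneg (ae_of_all _ fun x => abs_nonneg _)
      (hwcont'.integrable_of_hasCompactSupport hwc').abs (ae_of_all _ fun x => ?_)
    simp only [abs_mul]
    refine mul_le_of_le_one_right (abs_nonneg _) ?_
    exact mul_le_one₀ (hG.abs_fst_le _) (abs_nonneg _) (hG.abs_snd_le _)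
  have hsplit : ∫ x, f x * e x ^ 2 * |G (T * η x)| ^ (κ + 1) =
      2 / (κ + 3) * (∫ x, f x * e x ^ 2) - (κ + 1) / (κ + 3) / T *
        ∫ x, f x * e x * fderiv ℝ (fun x => G (T * η x) * H (T * η x)) x (stdVec i) := by
    rw [← integral_const_mul, ← integral_const_mul, ← integral_sub _ (iwQ.const_mul _)]
    · refine integral_congr_ae (ae_of_all _ fun x => ?_)
      simp only
      rw [hG.abs_rpow_eq hκ, hQfd]
      field_simp
    · refine Integrable.const_mul ?_ _
      refine (hf.continuous.mul (hed.continuous.pow 2)).integrable_of_hasCompactSupport ?_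
      exact (hasCompactSupport_sq hec).mul_left
  rw [hsplit]
  have h2 : 0 ≤ (κ + 1) / (κ + 3) / T := by
    have : 0 < κ + 3 := by linarith
    have : 0 < κ + 1 := by linarith
    positivity
  have h3 := mul_le_mul_of_nonneg_left hbound h2
  rw [mul_div_right_comm]
  linarith

/-- The function `(∂ᵢη)² g(G(T η)) = T⁻¹ (∂ᵢ(-∂ᵢη G'(T η)) + ∂ᵢ²η G'(T η))`, and its pairing with
functions of bounded homogeneous norm. -/
lemma IsOscillator.exists_pairing_bounds (hG : IsOscillator κ G H) (hκ : 1 < κ)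
    (hp : ContDiff ℝ 1 (powerReal κ)) (hη : ContDiff ℝ 1 η) (hed : ContDiff ℝ 1 e)
    (hec : HasCompactSupport e) (he : ∀ x, fderiv ℝ η x (stdVec i) = e x) {s : ℝ} (hs : 0 < s) :
    ∃ a₀ a₁ b₀ : ℝ, 0 ≤ a₀ ∧ 0 ≤ a₁ ∧ 0 ≤ b₀ ∧ ∀ T : ℝ, 0 < T → ∃ q : L2 n,
      (q =ᵐ[volume] fun x => ((e x ^ 2 * powerReal κ (G (T * η x)) : ℝ) : ℂ)) ∧ ‖q‖ ≤ b₀ ∧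
      ∀ ρ : ℝ, 0 < ρ → ∀ M : ℝ, 0 ≤ M → ∀ g : L2 n, homNorm s g ≤ ENNReal.ofReal M →
        ‖inner ℂ g q‖ ≤ ρ / T * (‖g‖ * a₀) + 1 / T * (‖g‖ * a₁) + ρ ^ (-s) * (M * b₀) := by
  obtain ⟨hG1, hH1⟩ := hG.contDiff_one hp
  have hpc := hp.continuous
  have hGc := hG1.continuous
  have hηc := hη.continuous
  have hecont := hed.continuous
  have hec' := hasCompactSupport_fderiv_apply hec (stdVec i)
  have hecont' := continuous_fderiv_apply hed (stdVec i)
  have me : MemLp e 2 := hecont.memLp_of_hasCompactSupport hec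
  have me' : MemLp (fun x => fderiv ℝ e x (stdVec i)) 2 := hecont'.memLp_of_hasCompactSupport hec'
  have me2 : MemLp (fun x => e x ^ 2) 2 :=
    (hecont.pow 2).memLp_of_hasCompactSupport (hasCompactSupport_sq hec)
  refine ⟨(eLpNorm e 2 volume).toReal, (eLpNorm (fun x => fderiv ℝ e x (stdVec i)) 2 volume).toReal,
    (eLpNorm (fun x => e x ^ 2) 2 volume).toReal, ENNReal.toReal_nonneg, ENNReal.toReal_nonneg,
    ENNReal.toReal_nonneg, fun T hT => ?_⟩
  have hqc : Continuous fun x => e x ^ 2 * powerReal κ (G (T * η x)) := by fun_prop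
  have hqs : HasCompactSupport fun x => e x ^ 2 * powerReal κ (G (T * η x)) :=
    (hasCompactSupport_sq hec).mul_right
  have hAd : ContDiff ℝ 1 fun x => -(e x * H (T * η x)) := by fun_prop
  have hAs : HasCompactSupport fun x => -(e x * H (T * η x)) :=
    (hec.mul_right (f' := fun x => H (T * η x))).neg
  have hBc : Continuous fun x => fderiv ℝ e x (stdVec i) * H (T * η x) :=
    hecont'.mul (hH1.continuous.comp (continuous_const.mul hηc))
  have hBs : HasCompactSupport fun x => fderiv ℝ e x (stdVec i) * H (T * η x) := hec'.mul_right
  have hAcd : ContDiff ℝ 1 fun x => ((-(e x * H (T * η x)) : ℝ) : ℂ) :=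
    Complex.ofRealCLM.contDiff.comp hAd
  have hq2 : MemLp (fun x => ((e x ^ 2 * powerReal κ (G (T * η x)) : ℝ) : ℂ)) 2 :=
    (Complex.continuous_ofReal.comp hqc).memLp_of_hasCompactSupport
      (HasCompactSupport.ofReal_comp hqs)
  have hB2 : MemLp (fun x => ((fderiv ℝ e x (stdVec i) * H (T * η x) : ℝ) : ℂ)) 2 :=
    (Complex.continuous_ofReal.comp hBc).memLp_of_hasCompactSupport
      (HasCompactSupport.ofReal_comp hBs)
  have hrel : ∀ x, ((e x ^ 2 * powerReal κ (G (T * η x)) : ℝ) : ℂ) = (T : ℂ)⁻¹ *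
      (fderiv ℝ (fun x => ((-(e x * H (T * η x)) : ℝ) : ℂ)) x (stdVec i) +
        ((fderiv ℝ e x (stdVec i) * H (T * η x) : ℝ) : ℂ)) := by
    intro x
    have h1 : HasFDerivAt (fun x => -(e x * H (T * η x))) _ x :=
      ((hed.differentiable one_ne_zero x).hasFDerivAt.mul
        ((hG.hasDeriv_snd (T * η x)).comp_hasFDerivAt x (hasFDerivAt_const_mul hη T x))).neg
    have h2 : HasFDerivAt (fun x => ((-(e x * H (T * η x)) : ℝ) : ℂ)) _ x :=
      Complex.ofRealCLM.hasFDerivAt.comp x h1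
    rw [h2.fderiv]
    have : (T : ℂ) ≠ 0 := by exact_mod_cast hT.ne'
    simp only [ContinuousLinearMap.comp_apply, neg_apply, add_apply, smul_apply, smul_eq_mul,
      Function.comp_apply, Complex.ofRealCLM_apply, he]
    push_cast
    field_simp
    ring
  have nq : eLpNorm (fun x => ((e x ^ 2 * powerReal κ (G (T * η x)) : ℝ) : ℂ)) 2 volume ≤
      eLpNorm (fun x => e x ^ 2) 2 volume := by
    refine eLpNorm_ofReal_le fun x => ?_
    rw [abs_mul]
    exact mul_le_of_le_one_right (abs_nonneg _) (hG.abs_powerReal_le hκ _)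
  refine ⟨hq2.toLp _, hq2.coeFn_toLp, ?_, fun ρ hρ M hM g hg => ?_⟩
  · rw [Lp.norm_toLp]
    exact ENNReal.toReal_mono me2.2.ne nq
  have hupper := enorm_inner_le_homNorm (i := i)
    (hAcd.continuous.integrable_of_hasCompactSupport (HasCompactSupport.ofReal_comp hAs))
    (hAcd.differentiable one_ne_zero)
    ((hAcd.continuous_fderiv one_ne_zero).integrable_of_hasCompactSupport
      ((HasCompactSupport.ofReal_comp hAs).fderiv ℝ))
    (hAcd.continuous.memLp_of_hasCompactSupport (HasCompactSupport.ofReal_comp hAs))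
    ((Complex.continuous_ofReal.comp hBc).integrable_of_hasCompactSupport
      (HasCompactSupport.ofReal_comp hBs)) hB2 hq2 hT hrel hρ hs g
  have nA : eLpNorm (fun x => ((-(e x * H (T * η x)) : ℝ) : ℂ)) 2 volume ≤ eLpNorm e 2 volume := by
    refine eLpNorm_ofReal_le fun x => ?_
    rw [abs_neg, abs_mul]
    exact mul_le_of_le_one_right (abs_nonneg _) (hG.abs_snd_le _)
  have nB : eLpNorm (fun x => ((fderiv ℝ e x (stdVec i) * H (T * η x) : ℝ) : ℂ)) 2 volume ≤
      eLpNorm (fun x => fderiv ℝ e x (stdVec i)) 2 volume := by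
    refine eLpNorm_ofReal_le fun x => ?_
    rw [abs_mul]
    exact mul_le_of_le_one_right (abs_nonneg _) (hG.abs_snd_le _)
  have h2 : ‖inner ℂ g (hq2.toLp _)‖ₑ ≤
      ENNReal.ofReal (ρ / T) * (‖g‖ₑ * eLpNorm e 2 volume) +
      ENNReal.ofReal (1 / T) * (‖g‖ₑ * eLpNorm (fun x => fderiv ℝ e x (stdVec i)) 2 volume) +
      ENNReal.ofReal (ρ ^ (-s)) * (ENNReal.ofReal M * eLpNorm (fun x => e x ^ 2) 2 volume) :=
    hupper.trans (by gcongr; exact nB)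
  rw [← ENNReal.ofReal_toReal me.2.ne, ← ENNReal.ofReal_toReal me'.2.ne,
    ← ENNReal.ofReal_toReal me2.2.ne, ← ofReal_norm, ← ofReal_norm,
    ← ENNReal.ofReal_mul (by positivity), ← ENNReal.ofReal_mul (by positivity),
    ← ENNReal.ofReal_mul (by positivity), ← ENNReal.ofReal_mul (by positivity),
    ← ENNReal.ofReal_mul (by positivity), ← ENNReal.ofReal_mul (by positivity),
    ← ENNReal.ofReal_add (by positivity) (by positivity),
    ← ENNReal.ofReal_add (by positivity) (by positivity),
    ENNReal.ofReal_le_ofReal_iff (by positivity)] at h2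
  exact h2

/-- The solution `f G(t η)` of the dispersionless equation grows in every homogeneous Sobolev norm of
positive order, in a way that is stable under perturbations in `L²`. -/
lemma IsProfile.exists_lt_homNorm {f : Space n → ℝ} (h : IsProfile κ i f η) (hκ : 1 < κ)
    (hp : ContDiff ℝ 1 (powerReal κ)) (hG : IsOscillator κ G H) {s : ℝ} (hs : 0 < s) {M : ℝ}
    (hM : 0 ≤ M) :
    ∃ T > 0, ∃ δ > 0, ∀ P g : L2 n, (P =ᵐ[volume] fun x => ((f x * G (T * η x) : ℝ) : ℂ)) →
      ‖g - P‖ ≤ δ → ENNReal.ofReal M < homNorm s g := by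
  have hη2 : ContDiff ℝ 2 η := by exact_mod_cast contDiff_infty.1 h.contDiff_snd 2
  have hη1 : ContDiff ℝ 1 η := by exact_mod_cast contDiff_infty.1 h.contDiff_snd 1
  have hf1 : ContDiff ℝ 1 f := by exact_mod_cast contDiff_infty.1 h.contDiff_fst 1
  obtain ⟨e, he⟩ : ∃ e : Space n → ℝ, ∀ x, fderiv ℝ η x (stdVec i) = e x := ⟨_, fun _ => rfl⟩
  have hee : e = fun x => fderiv ℝ η x (stdVec i) := funext fun x => (he x).symm
  have hed : ContDiff ℝ 1 e := by
    rw [hee]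
    exact (hη2.fderiv_right (m := 1) (by norm_num)).clm_apply contDiff_const
  have hec : HasCompactSupport e := hee ▸ hasCompactSupport_fderiv_apply h.compact_snd (stdVec i)
  have hecont := hed.continuous
  have hfcont := hf1.continuous
  obtain ⟨C₁, hC₁⟩ := hG.exists_le_integral hκ hp hf1 hη1 hed hec he
  obtain ⟨a₀, a₁, b₀, ha₀, ha₁, hb₀, hpair⟩ := hG.exists_pairing_bounds hκ hp hη1 hed hec he hs
  have hI₀ : 0 < ∫ x, f x * e x ^ 2 := by
    obtain ⟨x, hx⟩ := h.exists_ne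
    rw [he] at hx
    exact Continuous.integral_pos_of_hasCompactSupport_nonneg_nonzero (x := x) (by fun_prop)
      h.compact_fst.mul_right (fun z => mul_nonneg (h.nonneg z) (sq_nonneg _)) hx
  obtain ⟨c, hc⟩ : ∃ c, c = 2 / (κ + 3) * ∫ x, f x * e x ^ 2 := ⟨_, rfl⟩
  have hc0 : 0 < c := hc ▸ mul_pos (div_pos two_pos (by linarith)) hI₀
  rw [← hc] at hC₁
  obtain ⟨f₀, hf₀⟩ : ∃ f₀, f₀ = (eLpNorm f 2 volume).toReal := ⟨_, rfl⟩
  have hf₀0 : 0 ≤ f₀ := hf₀ ▸ ENNReal.toReal_nonneg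
  have mf : MemLp f 2 := hfcont.memLp_of_hasCompactSupport h.compact_fst
  -- the parameters: first the size of the perturbation, then the frequency, then the time
  obtain ⟨δ, hδ0, hδ1, hδ⟩ : ∃ δ : ℝ, 0 < δ ∧ δ ≤ 1 ∧ δ * b₀ ≤ c / 4 := by
    refine ⟨min 1 (c / 4 / (b₀ + 1)), lt_min one_pos (by positivity), min_le_left _ _, ?_⟩
    calc min 1 (c / 4 / (b₀ + 1)) * b₀ ≤ (c / 4 / (b₀ + 1)) * (b₀ + 1) :=
          mul_le_mul (min_le_right _ _) (by linarith) hb₀ (by positivity)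
      _ = c / 4 := by field_simp
  obtain ⟨ρ, hρ0, hρ⟩ : ∃ ρ : ℝ, 0 < ρ ∧ ρ ^ (-s) * (M * b₀) < c / 4 := by
    have h1 : Tendsto (fun ρ : ℝ => ρ ^ (-s) * (M * b₀)) atTop (𝓝 0) := by
      simpa using (tendsto_rpow_neg_atTop hs).mul_const (M * b₀)
    obtain ⟨ρ, h2, h3⟩ := ((h1.eventually (gt_mem_nhds (by positivity : 0 < c / 4))).and
      (eventually_gt_atTop 0)).exists
    exact ⟨ρ, h3, h2⟩
  obtain ⟨T, hT0, hT⟩ : ∃ T : ℝ, 0 < T ∧ (C₁ + (ρ * a₀ + a₁) * (f₀ + 1)) / T < c / 4 := by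
    obtain ⟨T, h2, h3⟩ := (((tendsto_const_nhds (x := C₁ + (ρ * a₀ + a₁) * (f₀ + 1))).div_atTop
      tendsto_id).eventually (gt_mem_nhds (by positivity : 0 < c / 4))|>.and
      (eventually_gt_atTop 0)).exists
    exact ⟨T, h3, h2⟩
  refine ⟨T, hT0, δ, hδ0, fun P g hP hgP => ?_⟩
  by_contra! hcon
  obtain ⟨q, hq, hqn, hqb⟩ := hpair T hT0
  have hup := hqb ρ hρ0 M hM g hcon
  have nP : ‖P‖ ≤ f₀ := by
    rw [hf₀, Lp.norm_def, eLpNorm_congr_ae hP]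
    refine ENNReal.toReal_mono mf.2.ne (eLpNorm_ofReal_le fun x => ?_)
    rw [abs_mul]
    exact mul_le_of_le_one_right (abs_nonneg _) (hG.abs_fst_le _)
  have ng : ‖g‖ ≤ f₀ + 1 := by
    have := norm_add_le (g - P) P
    rw [sub_add_cancel] at this
    linarith
  have hI : inner ℂ P q = ((∫ x, f x * e x ^ 2 * |G (T * η x)| ^ (κ + 1) : ℝ) : ℂ) := by
    rw [L2.inner_def, ← integral_complex_ofReal]
    refine integral_congr_ae ?_
    filter_upwards [hP, hq] with x h1 h2
    rw [h1, h2, RCLike.inner_apply, Complex.conj_ofReal, ← powerReal_mul_self (by linarith)]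
    push_cast
    ring
  have hlow : c - C₁ / T - δ * b₀ ≤ ‖inner ℂ g q‖ := by
    have h1 : inner ℂ g q = inner ℂ P q + inner ℂ (g - P) q := by
      rw [inner_sub_left]
      ring
    have h2 : ‖inner ℂ (g - P) q‖ ≤ δ * b₀ :=
      (norm_inner_le_norm _ _).trans (mul_le_mul hgP hqn (norm_nonneg _) hδ0.le)
    have h3 : c - C₁ / T ≤ ‖inner ℂ P q‖ := by
      rw [hI, Complex.norm_real]
      exact (hC₁ T hT0).trans (le_abs_self _)
    rw [h1]
    have h4 := norm_sub_le_norm_add (inner ℂ P q) (inner ℂ (g - P) q)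
    linarith
  have hup' : ρ / T * (‖g‖ * a₀) + 1 / T * (‖g‖ * a₁) ≤ (ρ * a₀ + a₁) * (f₀ + 1) / T := by
    have h1 : ρ / T * (‖g‖ * a₀) + 1 / T * (‖g‖ * a₁) = (ρ * a₀ + a₁) * ‖g‖ / T := by
      field_simp
    rw [h1]
    gcongr
  rw [add_div] at hT
  linarith

end Pairing

end

/-! ### Norm inflation -/

lemma exists_isBeamNonlinearity {k : ℕ} (hk : (n : ℝ) / 2 < k) {κ : ℝ} (hκ : 1 < κ)
    (hsmooth : (∃ m : ℕ, Odd m ∧ κ = m) ∨ (k : ℝ) + 2 ≤ κ) :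
    ∃ N : L2 n → L2 n, IsBeamNonlinearity hk κ N ∧
      ∀ R : ℝ, ∃ C : ℝ≥0, LipschitzOnWith C N (Metric.closedBall 0 R) := by
  obtain ⟨N, hN, hL⟩ := exists_compositionOperator hk (F := fun z => z - nonlinearity κ z)
    (contDiff_id.sub (contDiff_nonlinearity hκ hsmooth)) (by simp [nonlinearity_zero])
  exact ⟨N, hN, hL⟩

lemma norm_ofWeighted_le (k : ℕ) (ψ : L2 n) : ‖ofWeighted k ψ‖ ≤ ‖ψ‖ := by
  have h0 : sobolevNorm 0 (ofWeighted k ψ) = ‖ofWeighted k ψ‖ₑ := by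
    rw [sobolevNorm_eq]
    simp only [Real.rpow_zero, Complex.ofReal_one, one_mul]
    rw [← Lp.enorm_def, ← ofReal_norm, ← ofReal_norm, Lp.norm_fourier_eq]
  have h1 := sobolevNorm_mono (σ := 0) (τ := k) k.cast_nonneg (ofWeighted k ψ)
  rw [h0, sobolevNorm_ofWeighted, ← ofReal_norm, ← ofReal_norm,
    ENNReal.ofReal_le_ofReal_iff (norm_nonneg _)] at h1
  exact h1

lemma sobolevNorm_schwartz_lt_top (σ : ℝ) (f : 𝓢(Space n, ℂ)) : sobolevNorm σ (f.toLp 2) < ∞ := by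
  obtain ⟨m, hm⟩ := exists_nat_ge σ
  refine (sobolevNorm_mono hm _).trans_lt ?_
  rw [sobolevNorm_toLp]
  exact enorm_lt_top

lemma tendsto_stateOf (c₀ : ℝ) (w V : L2 n) :
    Tendsto (fun c => stateOf c 0 w V) (𝓝 c₀) (𝓝 (stateOf c₀ 0 w V)) := by
  have h1 : Tendsto (fun c => mulOp (omJap c) w) (𝓝 c₀) (𝓝 (mulOp (omJap c₀) w)) := by
    refine tendsto_mulOp (C := 2 + |c₀|) ?_ (fun ξ => ?_) tendsto_const_nhds
    · filter_upwards [Metric.ball_mem_nhds c₀ one_pos] with c hc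
      rw [Metric.mem_ball, Real.dist_eq] at hc
      refine (norm_bddMul_le _ _ _ (by positivity)).trans ?_
      have := abs_sub_abs_le_abs_sub c c₀
      linarith
    · simp only [omJap_apply]
      exact ((Complex.continuous_ofReal.comp
          (continuous_om_left ξ)).mul continuous_const).tendsto c₀
  exact (tendsto_mulOp_phase tendsto_id tendsto_const_nhds (h1.add_const _)).prodMk_nhds
    (tendsto_mulOp_phase tendsto_id tendsto_const_nhds (h1.sub_const _))

lemma conjState_stateOf {k : ℕ} (hk : (n : ℝ) / 2 < k) (c : ℝ) {φ : 𝓢(Space n, ℂ)}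
    (hφ : ∀ x, (φ x).im = 0) :
    conjState (stateOf c 0 (weighted k φ) 0) = stateOf c 0 (weighted k φ) 0 := by
  have h1 : conjRefl (weighted k φ) = weighted k φ := eq_of_evalAt_eq hk fun x => by
    rw [evalAt_conjRefl, evalAt_weighted, Complex.conj_eq_iff_im]
    exact hφ x
  have h2 : ∀ ξ : Space n, (starRingEnd ℂ) (omJap c (-ξ)) = omJap c ξ := by
    intro ξ
    have hj : jap (-ξ) = jap ξ := by simp [jap]
    rw [omJap_apply, omJap_apply, om_neg, hj]
    simp
  rw [conjState, stateOf]
  simp only [smul_zero, add_zero, sub_zero, conjRefl_phase, conjRefl_mulOp h2, h1, neg_zero]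

lemma posOf_stateOf_weighted (k : ℕ) (c : ℝ) (φ : 𝓢(Space n, ℂ)) (V : L2 n) :
    ofWeighted k (posOf c 0 (stateOf c 0 (weighted (k + 2) φ) V)) = φ.toLp 2 := by
  rw [posOf_stateOf, mulOp_japInv_weighted_add, ofWeighted_weighted]

/-- Solutions with small dispersion, with fixed data, whose homogeneous norm at a fixed time is
large. -/
lemma exists_large_smallDispersion (hn : 1 ≤ n) {k : ℕ} (hk : (n : ℝ) / 2 < k) {κ : ℝ} (hκ : 1 < κ)
    (hsmooth : (∃ m : ℕ, Odd m ∧ κ = m) ∨ (k : ℝ) + 2 ≤ κ) {s : ℝ} (hs : 0 < s) :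
    ∃ φ : 𝓢(Space n, ℂ), ∀ M : ℝ, 0 ≤ M → ∃ T > 0, ∀ᶠ c in 𝓝[>] (0 : ℝ), ∃ u v : ℝ → L2 n,
      IsCoeffSolution c κ ((k : ℝ) + 2) T u v ∧ (∀ r ∈ Set.Icc 0 T, ∀ᵐ x, (u r x).im = 0) ∧
      u 0 = φ.toLp 2 ∧ v 0 = 0 ∧ ENNReal.ofReal M < homNorm s (u T) := by
  obtain ⟨N, hN, hNL⟩ := exists_isBeamNonlinearity hk hκ hsmooth
  have hNc : Continuous N := continuous_of_lipschitz_balls hNL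
  have hp := contDiff_powerReal hκ hsmooth
  have hp1 : ContDiff ℝ 1 (powerReal κ) := hp.of_le (by norm_cast; omega)
  obtain ⟨G, H, hG⟩ := exists_isOscillator hκ hsmooth
  obtain ⟨f, η, h⟩ := exists_isProfile hκ (⟨0, hn⟩ : Fin n)
  set φ := schwartzOf h.compact_fst h.contDiff_fst with hφ
  refine ⟨φ, fun M hM => ?_⟩
  obtain ⟨T, hT, δ, hδ, hgrow⟩ := h.exists_lt_homNorm hκ hp1 hG hs hM
  refine ⟨T, hT, ?_⟩
  obtain ⟨z₀, hz₀, hz₀0, hz₀e⟩ := h.exists_isMild (hk := hk) hN hNc hp hG T hT.le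
  -- the solution without dispersion is perturbed to solutions with small coefficient `c > 0` and the
  -- same data
  obtain ⟨δ', hδ', hnear⟩ := IsMild.exists_near hNL hT.le hz₀ (half_pos hδ)
  have e1 : ∀ᶠ c in 𝓝 (0 : ℝ), ‖stateOf c 0 (weighted (k + 2) φ) 0 - z₀ 0‖ < δ' := by
    rw [hz₀0]
    have := tendsto_iff_norm_sub_tendsto_zero.1 (tendsto_stateOf 0 (weighted (k + 2) φ) 0)
    exact this.eventually (gt_mem_nhds hδ')
  have e2 : ∀ᶠ c in 𝓝 (0 : ℝ), ‖posOf c T (z₀ T) - posOf 0 T (z₀ T)‖ < δ / 2 := by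
    have := tendsto_iff_norm_sub_tendsto_zero.1 (tendsto_posOf (c := fun c : ℝ => c)
      (t := fun _ => T) (z := fun _ => z₀ T) (l := 𝓝 (0 : ℝ)) tendsto_id tendsto_const_nhds
      tendsto_const_nhds)
    exact this.eventually (gt_mem_nhds (half_pos hδ))
  have e3 : ∀ᶠ c in 𝓝 (0 : ℝ), |c - 0| < δ' := Metric.ball_mem_nhds _ hδ'
  filter_upwards [nhdsWithin_le_nhds e1, nhdsWithin_le_nhds e2, nhdsWithin_le_nhds e3,
    self_mem_nhdsWithin] with c h1 h2 h3 hc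
  obtain ⟨z, hz0, hz, hzn⟩ := hnear c h3 _ h1
  refine ⟨_, _, hz.isCoeffSolution hN (ne_of_gt hc), fun r hr => hz.real hN hNL ?_ hr, ?_, ?_, ?_⟩
  · rw [hz0]
    refine conjState_stateOf (k := k + 2) (by push_cast; linarith) c fun x => ?_
    rw [hφ, schwartzOf_apply, Complex.ofReal_im]
  · simp only [hz0]
    exact posOf_stateOf_weighted k c φ 0
  · simp only [hz0]
    rw [velOf_stateOf, map_zero]
  · refine hgrow (ofWeighted k (posOf 0 T (z₀ T))) _ ?_ ?_
    · filter_upwards [ofWeighted_ae_eq hk (posOf 0 T (z₀ T))] with x hx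
      rw [hx, hz₀e]
    · rw [← map_sub]
      refine (norm_ofWeighted_le _ _).trans ?_
      have h4 : posOf c T (z T) - posOf 0 T (z₀ T) =
          posOf c T (z T - z₀ T) + (posOf c T (z₀ T) - posOf 0 T (z₀ T)) := by
        rw [posOf_sub]
        abel
      rw [h4]
      have h5 := norm_add_le (posOf c T (z T - z₀ T)) (posOf c T (z₀ T) - posOf 0 T (z₀ T))
      have h6 := (norm_posOf_le c T (z T - z₀ T)).trans_lt (hzn T ⟨hT.le, le_rfl⟩)
      linarith

/-- The parameters of the scaling `a u(t/τ, bx)`: at high frequency `b` and fixed size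
`ε' = a b^{-γ}` of the data, both the time scale `τ = a^{-(κ-1)/2}` and the dispersion coefficient
`τ b²` tend to zero, the latter because `γ > 4/(κ-1)`. -/
lemma exists_scaling_parameters {κ γ : ℝ} (hκ : 1 < κ) (hγ : 4 / (κ - 1) < γ) {ε ε' T : ℝ}
    (hε : 0 < ε) (hε' : 0 < ε') {P : ℝ → Prop} (hP : ∀ᶠ c in 𝓝[>] (0 : ℝ), P c) :
    ∃ a b τ : ℝ, 0 < a ∧ 1 ≤ b ∧ 0 < τ ∧ a ^ (κ - 1) * τ ^ 2 = 1 ∧ a * b ^ (-γ) = ε' ∧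
      τ * T < ε ∧ P (τ * b ^ 2) := by
  -- `a = ε' b^γ` and `τ = a^{-p}`, so that `τ b² = ε'^{-p} b^{2 - γp}` with `γp > 2`
  obtain ⟨p, hp⟩ : ∃ p, p = (κ - 1) / 2 := ⟨_, rfl⟩
  have hκp : κ - 1 = p * 2 := by linarith
  have hp0 : 0 < p := by linarith
  have hγp : 2 < γ * p := by
    rw [div_lt_iff₀ (by linarith), hκp] at hγ
    linarith
  have hτ : ∀ b : ℝ, 0 < b → (ε' * b ^ γ) ^ (-p) = ε' ^ (-p) * b ^ (-(γ * p)) := by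
    intro b hb
    rw [Real.mul_rpow hε'.le (by positivity), ← Real.rpow_mul hb.le, mul_neg]
  have t1 : Tendsto (fun b : ℝ => ε' ^ (-p) * b ^ (-(γ * p)) * T) atTop (𝓝 0) := by
    simpa using ((tendsto_rpow_neg_atTop (by linarith : 0 < γ * p)).const_mul (ε' ^
        (-p))).mul_const T
  have t2 : Tendsto (fun b : ℝ => ε' ^ (-p) * b ^ (-(γ * p - 2))) atTop (𝓝[>] 0) := by
    refine tendsto_nhdsWithin_iff.2 ⟨?_, ?_⟩
    · simpa using (tendsto_rpow_neg_atTop (by linarith : 0 < γ * p - 2)).const_mul (ε' ^ (-p))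
    · filter_upwards [eventually_gt_atTop 0] with b hb
      exact mul_pos (Real.rpow_pos_of_pos hε' _) (Real.rpow_pos_of_pos hb _)
  obtain ⟨b, ⟨⟨h1, h2⟩, hb1⟩⟩ := (((t1.eventually (gt_mem_nhds hε)).and (t2.eventually hP)).and
    (eventually_ge_atTop 1)).exists
  have hb : 0 < b := by linarith
  have ha : 0 < ε' * b ^ γ := by positivity
  refine ⟨ε' * b ^ γ, b, (ε' * b ^ γ) ^ (-p), ha, hb1, Real.rpow_pos_of_pos ha _, ?_, ?_, ?_, ?_⟩
  · rw [hκp, Real.rpow_mul ha.le, ← Real.rpow_natCast _ 2, ← Real.rpow_mul ha.le,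
      ← Real.rpow_mul ha.le, ← Real.rpow_add ha]
    push_cast
    rw [neg_mul, add_neg_cancel, Real.rpow_zero]
  · rw [mul_assoc, ← Real.rpow_add hb, add_neg_cancel, Real.rpow_zero, mul_one]
  · rwa [hτ b hb]
  · have h3 : ε' ^ (-p) * b ^ (-(γ * p)) * b ^ 2 = ε' ^ (-p) * b ^ (-(γ * p - 2)) := by
      rw [← Real.rpow_natCast b 2, mul_assoc, ← Real.rpow_add hb]
      congr 2
      push_cast
      ring
    rwa [hτ b hb, h3]

lemma enorm_ofReal_of_nonneg {a : ℝ} (ha : 0 ≤ a) : ‖(a : ℂ)‖ₑ = ENNReal.ofReal a := by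
  rw [← ofReal_norm, Complex.norm_real, Real.norm_of_nonneg ha]

lemma sobolevNorm_smul_dil_le {a b : ℝ} (ha : 0 ≤ a) (hb : 0 < b) (hb1 : 1 ≤ b) {s : ℝ}
    (hs : 0 ≤ s) (f : L2 n) :
    sobolevNorm s ((a : ℂ) • dil hb f) ≤
      ENNReal.ofReal (a * b ^ (s - n / 2)) * sobolevNorm s f := by
  have h := sobolevNorm_dil_le hb hb1 le_rfl ((inv_le_one_of_one_le₀ hb1).trans hb1) s f
  rw [abs_of_nonneg hs, ← Real.rpow_add hb, neg_add_eq_sub] at h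
  rw [sobolevNorm_smul, enorm_ofReal_of_nonneg ha, ENNReal.ofReal_mul ha, mul_assoc]
  gcongr

lemma homNorm_le_sobolevNorm_smul_dil {a b : ℝ} (ha : 0 ≤ a) (hb : 0 < b) {s : ℝ}
    (hs : 0 ≤ s) (f : L2 n) :
    ENNReal.ofReal (a * b ^ (s - n / 2)) * homNorm s f ≤ sobolevNorm s ((a : ℂ) • dil hb f) := by
  rw [sobolevNorm_smul, enorm_ofReal_of_nonneg ha, ENNReal.ofReal_mul ha, mul_assoc]
  gcongr
  exact homNorm_le_sobolevNorm_dil hb hs f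

lemma smul_dil_toLp (a : ℂ) {b : ℝ} (hb : 0 < b) (φ : 𝓢(Space n, ℂ)) :
    a • dil hb (φ.toLp 2) = (a • dilS hb φ).toLp 2 := by
  rw [dil_toLp]
  exact ((SchwartzMap.toLpCLM ℂ ℂ 2 volume).map_smul _ _).symm

lemma smul_dil_ae_im_eq_zero (a : ℝ) {b : ℝ} (hb : 0 < b) {f : L2 n}
    (hf : ∀ᵐ x, (f x).im = 0) : ∀ᵐ x, (((a : ℂ) • dil hb f : L2 n) x).im = 0 := by
  filter_upwards [Lp.coeFn_smul (a : ℂ) (dil hb f), dil_coe hb f, ae_smul hb hf] with x h3 h4 h5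
  rw [h3, Pi.smul_apply, h4, smul_eq_mul, Complex.mul_im, h5]
  simp

lemma exists_eq_ofReal_of_lt_top {x : ℝ≥0∞} (hx : x < ∞) :
    ∃ K : ℝ, 0 ≤ K ∧ x = ENNReal.ofReal K :=
  ⟨x.toReal, ENNReal.toReal_nonneg, (ENNReal.ofReal_toReal hx.ne).symm⟩

/-- Norm inflation at zero in `H^s` below the critical exponent. -/
theorem exists_norm_inflation (hn : 1 ≤ n) {k : ℕ} (hk : (n : ℝ) / 2 < k) {κ : ℝ} (hκ : 1 < κ)
    (hsmooth : (∃ m : ℕ, Odd m ∧ κ = m) ∨ (k : ℝ) + 2 ≤ κ) {s : ℝ} (hs : 0 < s)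
    (hsc : s < (n : ℝ) / 2 - 4 / (κ - 1)) {ε : ℝ} (hε : 0 < ε) :
    ∃ (u v : ℝ → L2 n) (t : ℝ), 0 < t ∧ t < ε ∧ IsSolution (-1) κ ((k : ℝ) + 2) t u v ∧
      (∀ r ∈ Set.Icc 0 t, ∀ᵐ x, (u r x).im = 0) ∧ (∃ f : 𝓢(Space n, ℂ), u 0 = f.toLp 2) ∧
      sobolevNorm s (u 0) < ENNReal.ofReal ε ∧ v 0 = 0 ∧
      ENNReal.ofReal ε⁻¹ < sobolevNorm s (u t) := by
  obtain ⟨φ, hφ⟩ := exists_large_smallDispersion hn hk hκ hsmooth hs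
  -- the rescaled data have the size of `ε'` times that of `φ`
  obtain ⟨K, hK0, hK⟩ := exists_eq_ofReal_of_lt_top (sobolevNorm_schwartz_lt_top s φ)
  obtain ⟨ε', hε', hε'K⟩ : ∃ ε' : ℝ, 0 < ε' ∧ ε' * K < ε := by
    refine ⟨ε / (K + 1), by positivity, ?_⟩
    rw [div_mul_eq_mul_div, div_lt_iff₀ (by positivity)]
    nlinarith
  obtain ⟨T, hT, hc⟩ := hφ (ε⁻¹ / ε') (by positivity)
  obtain ⟨a, b, τ, ha, hb1, hτ0, haτ, hab, hτT, u, v, hsol, hreal, hu0, hv0, hlarge⟩ :=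
    exists_scaling_parameters (T := T) (γ := n / 2 - s) hκ (by linarith) hε hε' hc
  have hb : 0 < b := by linarith
  rw [neg_sub] at hab
  obtain ⟨U, V, hUV, hU, hV⟩ : ∃ U V : ℝ → L2 n, IsCoeffSolution 1 κ ((k : ℝ) + 2) (τ * T) U V ∧
      (∀ t, U t = (a : ℂ) • dil hb (u (t / τ))) ∧
      ∀ t, V t = ((a / τ : ℝ) : ℂ) • dil hb (v (t / τ)) :=
    ⟨_, _, hsol.scale ha hb hτ0 haτ (by rw [one_mul]), fun _ => rfl, fun _ => rfl⟩
  refine ⟨U, V, τ * T, mul_pos hτ0 hT, hτT, isSolution_iff.2 hUV, fun r hr => ?_,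
    ⟨(a : ℂ) • dilS hb φ, ?_⟩, ?_, ?_, ?_⟩
  · rw [hU]
    exact smul_dil_ae_im_eq_zero a hb (hreal _ (div_mem_Icc hτ0 hr))
  · rw [hU, zero_div, hu0, smul_dil_toLp]
  · rw [hU, zero_div, hu0]
    refine (sobolevNorm_smul_dil_le ha.le hb hb1 hs.le _).trans_lt ?_
    rw [hab, hK, ← ENNReal.ofReal_mul hε'.le]
    exact (ENNReal.ofReal_lt_ofReal_iff hε).2 hε'K
  · rw [hV, zero_div, hv0, map_zero, smul_zero]
  · rw [hU, mul_div_cancel_left₀ _ hτ0.ne']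
    refine lt_of_lt_of_le ?_ (homNorm_le_sobolevNorm_smul_dil ha.le hb hs.le (u T))
    have h3 : ε⁻¹ = ε' * (ε⁻¹ / ε') := by field_simp
    rw [hab, h3, ENNReal.ofReal_mul hε'.le]
    exact (ENNReal.mul_lt_mul_iff_right (by simpa using hε') ENNReal.ofReal_ne_top).2 hlarge

/-! ### Discontinuity of the solution map -/

lemma ContinuousInSobolev.mono {σ T T' : ℝ} {u : ℝ → L2 n} (h : ContinuousInSobolev σ T u)
    (hT : T' ≤ T) : ContinuousInSobolev σ T' u :=
  ⟨fun t ht => h.1 t ⟨ht.1, ht.2.trans hT⟩, fun t ht => (h.2 t ⟨ht.1, ht.2.trans hT⟩).mono_left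
    (nhdsWithin_mono _ (Set.Icc_subset_Icc_right hT))⟩

lemma IsCoeffSolution.mono {c κ σ T T' : ℝ} {u v : ℝ → L2 n} (h : IsCoeffSolution c κ σ T u v)
    (hT : T' ≤ T) : IsCoeffSolution c κ σ T' u v where
  continuous_fst := h.continuous_fst.mono hT
  continuous_snd := h.continuous_snd.mono hT
  deriv_eq t ht := (h.deriv_eq t ⟨ht.1, ht.2.trans hT⟩).mono (Set.Icc_subset_Icc_right hT)
  equation φ t ht := (h.equation φ t ⟨ht.1, ht.2.trans hT⟩).mono (Set.Icc_subset_Icc_right hT)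

lemma sub_mem_Icc {T T' t : ℝ} (hT : T' ≤ T) (ht : t ∈ Set.Icc 0 T') : T - t ∈ Set.Icc 0 T :=
  ⟨by linarith [ht.2], by linarith [ht.1]⟩

lemma ContinuousInSobolev.reverse {σ T T' : ℝ} {u : ℝ → L2 n} (h : ContinuousInSobolev σ T u)
    (hT : T' ≤ T) : ContinuousInSobolev σ T' (fun r => u (T - r)) := by
  refine ⟨fun t ht => h.1 _ (sub_mem_Icc hT ht), fun t ht => (h.2 _ (sub_mem_Icc hT ht)).comp
    (f := fun r => T - r) (tendsto_nhdsWithin_iff.2 ⟨?_, ?_⟩)⟩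
  · exact ((continuous_const.sub continuous_id).tendsto t).mono_left nhdsWithin_le_nhds
  · filter_upwards [self_mem_nhdsWithin] with r hr using sub_mem_Icc hT hr

lemma ContinuousInSobolev.neg {σ T : ℝ} {u : ℝ → L2 n} (h : ContinuousInSobolev σ T u) :
    ContinuousInSobolev σ T (fun r => -u r) := by
  refine ⟨fun t ht => ?_, fun t ht => ?_⟩
  · rw [sobolevNorm_neg]
    exact h.1 t ht
  · refine (h.2 t ht).congr fun r => ?_
    rw [← sobolevNorm_neg, neg_sub, sub_neg_eq_add, neg_add_eq_sub]

/-- The equation is invariant under reversal of time. -/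
lemma IsCoeffSolution.reverse {c κ σ T T' : ℝ} {u v : ℝ → L2 n} (h : IsCoeffSolution c κ σ T u v)
    (hT : T' ≤ T) : IsCoeffSolution c κ σ T' (fun r => u (T - r)) (fun r => -v (T - r)) where
  continuous_fst := h.continuous_fst.reverse hT
  continuous_snd := (h.continuous_snd.reverse hT).neg
  deriv_eq t ht := by
    have h1 : HasDerivWithinAt (fun r : ℝ => T - r) (-1) (Set.Icc 0 T') t :=
      ((hasDerivAt_id t).const_sub T).hasDerivWithinAt
    refine ((h.deriv_eq _ (sub_mem_Icc hT ht)).scomp t h1 fun r hr =>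
      sub_mem_Icc hT hr).congr_deriv ?_
    rw [neg_smul, one_smul]
  equation φ t ht := by
    have h1 : HasDerivWithinAt (fun r : ℝ => T - r) (-1) (Set.Icc 0 T') t :=
      ((hasDerivAt_id t).const_sub T).hasDerivWithinAt
    have h2 := ((h.equation φ _ (sub_mem_Icc hT ht)).scomp t h1 fun r hr => sub_mem_Icc hT hr).neg
    have h3 : ∀ r, ∫ x, (-v (T - r) : L2 n) x * φ x = -∫ x, v (T - r) x * φ x := fun r => by
      rw [← integral_neg]
      refine integral_congr_ae ?_
      filter_upwards [Lp.coeFn_neg (v (T - r))] with x hx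
      rw [hx, Pi.neg_apply, neg_mul]
    simp only [h3]
    refine h2.congr_deriv ?_
    rw [neg_smul, one_smul, neg_neg]

lemma dil_inv_dil {b : ℝ} (hb : 0 < b) (f : L2 n) : dil (inv_pos.2 hb) (dil hb f) = f := by
  refine Lp.ext ?_
  filter_upwards [dil_coe (inv_pos.2 hb) (dil hb f), ae_smul (inv_pos.2 hb) (dil_coe hb f)]
    with x h1 h2
  rw [h1, h2, smul_smul, mul_inv_cancel₀ hb.ne', one_smul]

lemma sobolevNorm_dil_le_of_mem {b : ℝ} (hb : 0 < b) (h1 : b ≤ 2) (h2 : b⁻¹ ≤ 2) (σ : ℝ)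
    (f : L2 n) :
    sobolevNorm σ (dil hb f) ≤ ENNReal.ofReal (2 ^ (n / 2 : ℝ) * 2 ^ |σ|) * sobolevNorm σ f := by
  refine (sobolevNorm_dil_le hb one_le_two h1 h2 σ f).trans ?_
  rw [Real.rpow_neg hb.le, ← Real.inv_rpow hb.le]
  gcongr

lemma continuous_sobolevNorm_ofWeighted {σ : ℝ} {k : ℕ} (h : σ ≤ k) :
    Continuous fun ψ : L2 n => sobolevNorm σ (ofWeighted k ψ) := by
  refine continuous_of_le_add_edist 1 ENNReal.one_ne_top fun ψ φ => ?_
  have h1 := sobolevNorm_add_le σ (ofWeighted k φ) (ofWeighted k (ψ - φ))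
  have h2 := sobolevNorm_mono h (ofWeighted k (ψ - φ))
  rw [← map_add, add_sub_cancel] at h1
  rw [sobolevNorm_ofWeighted] at h2
  rw [one_mul, edist_eq_enorm_sub]
  exact h1.trans (by gcongr)

lemma continuous_stateOf (c t : ℝ) :
    Continuous fun p : L2 n × L2 n => stateOf c t p.1 p.2 := by
  unfold stateOf
  fun_prop

lemma continuous_posOf (c t : ℝ) : Continuous (posOf c t : L2 n × L2 n → L2 n) := by
  unfold posOf
  fun_prop

/-- Uniqueness in the class `C([0,T]; H^{k+2} × H^k)`. -/
lemma IsCoeffSolution.unique {k : ℕ} (hk : (n : ℝ) / 2 < k) {κ : ℝ} (hκ : 1 < κ)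
    (hsmooth : (∃ m : ℕ, Odd m ∧ κ = m) ∨ (k : ℝ) + 2 ≤ κ) {c T : ℝ} (hT : 0 ≤ T)
    {u v u' v' : ℝ → L2 n} (h : IsCoeffSolution c κ ((k : ℝ) + 2) T u v)
    (h' : IsCoeffSolution c κ ((k : ℝ) + 2) T u' v') (h0 : u 0 = u' 0) (h1 : v 0 = v' 0) :
    Set.EqOn u u' (Set.Icc 0 T) := by
  obtain ⟨N, hN, hNL⟩ := exists_isBeamNonlinearity hk hκ hsmooth
  have hNc : Continuous N := continuous_of_lipschitz_balls hNL
  obtain ⟨z, hz, hzu, w, V, hw, hV, hz0⟩ := h.exists_isMild hN hNc hT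
  obtain ⟨z', hz', hzu', w', V', hw', hV', hz0'⟩ := h'.exists_isMild hN hNc hT
  have e1 : w = w' := ofWeighted_injective _ (by rw [hw, hw', h0])
  have e2 : V = V' := ofWeighted_injective _ (by rw [hV, hV', h1])
  have e := hz.unique hNL hz' (by rw [hz0, hz0', e1, e2])
  intro t ht
  rw [← (hzu t ht).1, ← (hzu' t ht).1, e ht]

/-- The data of a state are approximated by Schwartz functions, with control of the `H^s × H^{s-2}`
norm, because `s ≤ k`. -/
lemma exists_schwartz_near {k : ℕ} {s : ℝ} (hs : s ≤ k) {δ : ℝ≥0∞} {w V : L2 n}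
    (hw : sobolevNorm s (ofWeighted (k + 2) w) < δ) (hV : sobolevNorm (s - 2) (ofWeighted k V) < δ)
    {d : ℝ} (hd : 0 < d) :
    ∃ f g : 𝓢(Space n, ℂ), sobolevNorm s (f.toLp 2) < δ ∧ sobolevNorm (s - 2) (g.toLp 2) < δ ∧
      ‖stateOf 1 0 (weighted (k + 2) f) (weighted k g) - stateOf 1 0 w V‖ < d := by
  have c1 : Continuous fun p : L2 n × L2 n => sobolevNorm s (ofWeighted (k + 2) p.1) :=
    (continuous_sobolevNorm_ofWeighted (by push_cast; linarith)).comp continuous_fst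
  have c2 : Continuous fun p : L2 n × L2 n => sobolevNorm (s - 2) (ofWeighted k p.2) :=
    (continuous_sobolevNorm_ofWeighted (by linarith)).comp continuous_snd
  have e1 := (c1.tendsto (w, V)).eventually (gt_mem_nhds hw)
  have e2 := (c2.tendsto (w, V)).eventually (gt_mem_nhds hV)
  have e3 := ((continuous_stateOf 1 0).tendsto (w, V)).eventually (Metric.ball_mem_nhds _ hd)
  obtain ⟨p, hp, ⟨f, g⟩, rfl⟩ := mem_closure_iff_nhds.1 (((denseRange_weighted (n := n)
    (k + 2)).prodMap (denseRange_weighted (n := n) k)) (w, V)) _ (e1.and (e2.and e3))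
  obtain ⟨h1, h2, h3⟩ := hp
  rw [Prod.map_apply, ofWeighted_weighted] at h1 h2
  exact ⟨f, g, h1, h2, mem_ball_iff_norm.1 h3⟩

/-- A solution with small data and large value at a later time can be approximated by solutions
with Schwartz data having the same property. -/
lemma IsCoeffSolution.exists_schwartz_data {k : ℕ} (hk : (n : ℝ) / 2 < k) {κ : ℝ} (hκ : 1 < κ)
    (hsmooth : (∃ m : ℕ, Odd m ∧ κ = m) ∨ (k : ℝ) + 2 ≤ κ) {T : ℝ} (hT : 0 ≤ T)
    {u v : ℝ → L2 n} (h : IsCoeffSolution 1 κ ((k : ℝ) + 2) T u v) {s : ℝ} (hs : s ≤ k)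
    {δ M : ℝ≥0∞} (hu : sobolevNorm s (u 0) < δ) (hv : sobolevNorm (s - 2) (v 0) < δ)
    (hM : M < sobolevNorm s (u T)) :
    ∃ f g : 𝓢(Space n, ℂ), sobolevNorm s (f.toLp 2) < δ ∧ sobolevNorm (s - 2) (g.toLp 2) < δ ∧
      ∃ u' v' : ℝ → L2 n, IsCoeffSolution 1 κ ((k : ℝ) + 2) T u' v' ∧ u' 0 = f.toLp 2 ∧
        v' 0 = g.toLp 2 ∧ M < sobolevNorm s (u' T) := by
  obtain ⟨N, hN, hNL⟩ := exists_isBeamNonlinearity hk hκ hsmooth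
  have hNc : Continuous N := continuous_of_lipschitz_balls hNL
  obtain ⟨z, hz, hzu, w, V, hw, hV, hz0⟩ := h.exists_isMild hN hNc hT
  have hTT : T ∈ Set.Icc 0 T := ⟨hT, le_rfl⟩
  have o1 : IsOpen {Z : L2 n × L2 n | M < sobolevNorm s (ofWeighted k (posOf 1 T Z))} :=
    isOpen_lt continuous_const ((continuous_sobolevNorm_ofWeighted hs).comp (continuous_posOf 1 T))
  obtain ⟨ε, hε, hball⟩ := Metric.isOpen_iff.1 o1 (z T) (by
    rw [Set.mem_ofPred_eq, (hzu T hTT).1]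
    exact hM)
  obtain ⟨d, hd, hnear⟩ := IsMild.exists_near hNL hT hz hε
  rw [← hw] at hu
  rw [← hV] at hv
  rw [hz0] at hnear
  obtain ⟨f, g, hf, hg, hfg⟩ := exists_schwartz_near hs hu hv hd
  obtain ⟨z', hz0', hz', hzz⟩ := hnear 1 (by rwa [sub_self, abs_zero]) _ hfg
  refine ⟨f, g, hf, hg, _, _, hz'.isCoeffSolution hN one_ne_zero, ?_, ?_, ?_⟩
  · simp only [hz0']
    exact posOf_stateOf_weighted k 1 f _
  · simp only [hz0']
    rw [velOf_stateOf, ofWeighted_weighted]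
  · refine hball ?_
    rw [mem_ball_iff_norm]
    exact hzz T hTT

lemma sobolevNorm_smul_dil_le_of_mem {a b A : ℝ} (ha : 0 ≤ a) (haA : a ≤ A) (hb : 0 < b)
    (h1 : b ≤ 2) (h2 : b⁻¹ ≤ 2) {σ ρ : ℝ} (hρ : |σ| ≤ ρ) (f : L2 n) :
    sobolevNorm σ ((a : ℂ) • dil hb f) ≤
      ENNReal.ofReal (A * (2 ^ (n / 2 : ℝ) * 2 ^ ρ)) * sobolevNorm σ f := by
  have hA : 0 ≤ A := ha.trans haA
  rw [sobolevNorm_smul, enorm_ofReal_of_nonneg ha, ENNReal.ofReal_mul hA, mul_assoc]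
  have h3 : ENNReal.ofReal (2 ^ (n / 2 : ℝ) * 2 ^ |σ|) ≤
      ENNReal.ofReal (2 ^ (n / 2 : ℝ) * 2 ^ ρ) :=
    ENNReal.ofReal_le_ofReal (mul_le_mul_of_nonneg_left
      (Real.rpow_le_rpow_of_exponent_le one_le_two hρ) (by positivity))
  have h4 := (sobolevNorm_dil_le_of_mem hb h1 h2 σ f).trans (mul_le_mul_left h3 _)
  gcongr

/-- The parameters of the scaling `a u(t/τ, bx)` that preserves the equation. -/
lemma exists_scaling_preserving {κ : ℝ} (hκ : 1 < κ) {τ : ℝ} (h1 : 1 ≤ τ) (h2 : τ ≤ 2) :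
    ∃ a b : ℝ, 0 < a ∧ 0 < b ∧ a ^ (κ - 1) * τ ^ 2 = 1 ∧ 1 * τ * b ^ 2 = 1 ∧ a ≤ 1 ∧
      a⁻¹ ≤ 2 ^ (2 / (κ - 1)) ∧ b ≤ 2 ∧ b⁻¹ ≤ 2 := by
  have hτ : 0 < τ := by linarith
  have hp : 0 ≤ 2 / (κ - 1) := div_nonneg zero_le_two (by linarith)
  have hs : 0 < √τ := Real.sqrt_pos.2 hτ
  have hs1 : 1 ≤ √τ := Real.one_le_sqrt.2 h1
  have hs2 : √τ ≤ 2 := Real.sqrt_le_iff.2 ⟨zero_le_two, by linarith⟩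
  refine ⟨τ ^ (-(2 / (κ - 1))), (√τ)⁻¹, Real.rpow_pos_of_pos hτ _, inv_pos.2 hs, ?_, ?_, ?_, ?_,
    ?_, by rwa [inv_inv]⟩
  · rw [← Real.rpow_mul hτ.le, neg_mul, div_mul_cancel₀ _ (by linarith), Real.rpow_neg hτ.le,
      Real.rpow_two, inv_mul_cancel₀ (by positivity)]
  · rw [inv_pow, Real.sq_sqrt hτ.le, one_mul, mul_inv_cancel₀ hτ.ne']
  · exact Real.rpow_le_one_of_one_le_of_nonpos h1 (by linarith)
  · rw [Real.rpow_neg hτ.le, inv_inv]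
    gcongr
  · exact (inv_le_one_of_one_le₀ hs1).trans one_le_two

/-- Solutions on `[0,T]` are rescaled to solutions on `[0,t]`, at the cost of a constant factor that
is uniform for `T ≤ t ≤ 2T`. -/
lemma exists_rescaled_solution {κ : ℝ} (hκ : 1 < κ) (s : ℝ) :
    ∃ C : ℝ, 0 < C ∧ ∀ {T t σ : ℝ} {u v : ℝ → L2 n}, 0 < T → T ≤ t → t ≤ 2 * T →
      IsCoeffSolution 1 κ σ T u v → ∃ U V : ℝ → L2 n, IsCoeffSolution 1 κ σ t U V ∧
        sobolevNorm s (U 0) ≤ ENNReal.ofReal C * sobolevNorm s (u 0) ∧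
        sobolevNorm (s - 2) (V 0) ≤ ENNReal.ofReal C * sobolevNorm (s - 2) (v 0) ∧
        sobolevNorm s (u T) ≤ ENNReal.ofReal C * sobolevNorm s (U t) := by
  have hA1 : (1 : ℝ) ≤ 2 ^ (2 / (κ - 1)) :=
    Real.one_le_rpow one_le_two (div_nonneg zero_le_two (by linarith))
  refine ⟨2 ^ (2 / (κ - 1)) * (2 ^ (n / 2 : ℝ) * 2 ^ (|s| + 2)), by positivity,
    fun {T t σ u v} hT hTt ht h => ?_⟩
  have hτ1 : 1 ≤ t / T := (one_le_div hT).2 hTt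
  have hτ : 0 < t / T := by linarith
  obtain ⟨a, b, ha, hb, haτ, hbτ, ha1, haA, hb1, hb2⟩ :=
    exists_scaling_preserving hκ hτ1 ((div_le_iff₀ hT).2 ht)
  have hsol := h.scale ha hb hτ haτ hbτ
  rw [div_mul_cancel₀ _ hT.ne'] at hsol
  refine ⟨_, _, hsol, ?_, ?_, ?_⟩
  · rw [zero_div]
    exact sobolevNorm_smul_dil_le_of_mem ha.le (ha1.trans hA1) hb hb1 hb2 (by linarith) _
  · rw [zero_div]
    refine sobolevNorm_smul_dil_le_of_mem (by positivity)
      (((div_le_self ha.le hτ1).trans ha1).trans hA1) hb hb1 hb2 ?_ _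
    refine (abs_sub _ _).trans ?_
    norm_num
  · rw [div_div_cancel₀ (by linarith)]
    have h1 := sobolevNorm_smul_dil_le_of_mem (a := a⁻¹) (ρ := |s| + 2) (σ := s)
      (inv_pos.2 ha).le haA (inv_pos.2 hb) hb2 (by rwa [inv_inv]) (by linarith)
      ((a : ℂ) • dil hb (u T))
    rwa [map_smul, dil_inv_dil, smul_smul, ← Complex.ofReal_mul, inv_mul_cancel₀ ha.ne',
      Complex.ofReal_one, one_smul] at h1

/-- The solution map is not continuous at zero in `H^s × H^{s-2}` below the critical exponent. -/
theorem not_solutionMapContinuousAtZero (hn : 1 ≤ n) {k : ℕ} (hk : (n : ℝ) / 2 < k) {κ : ℝ}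
    (hκ : 1 < κ) (hsmooth : (∃ m : ℕ, Odd m ∧ κ = m) ∨ (k : ℝ) + 2 ≤ κ) {s : ℝ} (hs : 0 < s)
    (hsc : s < (n : ℝ) / 2 - 4 / (κ - 1)) {t : ℝ} (ht : 0 < t) :
    ¬ SolutionMapContinuousAtZero n (-1) κ ((k : ℝ) + 2) s t := by
  intro hcont
  have hsk : s ≤ k := by
    have : 0 < 4 / (κ - 1) := div_pos four_pos (by linarith)
    linarith
  obtain ⟨C, hC, hresc⟩ := exists_rescaled_solution (n := n) hκ s
  obtain ⟨δ, hδ, h1⟩ := hcont 1 one_pos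
  obtain ⟨δ', hδ', h2⟩ := hcont (δ / C) (by positivity)
  obtain ⟨ε, hε, hεδ, hεt, hεC⟩ : ∃ ε : ℝ, 0 < ε ∧ ε ≤ δ' ∧ ε ≤ t / 2 ∧ ε ≤ C⁻¹ :=
    ⟨min δ' (min (t / 2) C⁻¹), by positivity, min_le_left _ _,
      (min_le_right _ _).trans (min_le_left _ _), (min_le_right _ _).trans (min_le_right _ _)⟩
  obtain ⟨u₁, v₁, r, hr, hrε, hsol₁, -, ⟨f, hf⟩, hsmall, hv₁, hlarge⟩ :=
    exists_norm_inflation hn hk hκ hsmooth hs hsc hε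
  rw [hf] at hsmall
  have hz : (0 : 𝓢(Space n, ℂ)).toLp 2 = (0 : L2 n) :=
    (SchwartzMap.toLpCLM ℂ ℂ 2 volume).map_zero
  have hz' : sobolevNorm (s - 2) (0 : L2 n) = 0 := by
    simpa using sobolevNorm_smul (s - 2) 0 (0 : L2 n)
  obtain ⟨u₂, v₂, hsol₂, hu₂0, hv₂0, hu₂, hv₂⟩ := h2 f 0
    (hsmall.trans_le (ENNReal.ofReal_le_ofReal hεδ)) (by
      rw [hz, hz']
      exact ENNReal.ofReal_pos.2 hδ')
  rw [hz] at hv₂0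
  rw [isSolution_iff] at hsol₁ hsol₂
  -- both solutions have the same data, so the second one is large at time `r` and small at time `t`
  have hru : u₁ r = u₂ r := hsol₁.unique hk hκ hsmooth hr.le (hsol₂.mono (by linarith))
    (by rw [hf, hu₂0]) (by rw [hv₁, hv₂0]) ⟨hr.le, le_rfl⟩
  obtain ⟨U, V, hUV, hU0, hV0, hUt⟩ := hresc (T := t - r) (t := t) (by linarith) (by linarith)
    (by linarith) (hsol₂.reverse (T' := t - r) (by linarith))
  rw [sub_zero] at hU0 hV0
  rw [sobolevNorm_neg] at hV0
  rw [sub_sub_cancel, ← hru] at hUt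
  have hCδ : ENNReal.ofReal C * ENNReal.ofReal (δ / C) = ENNReal.ofReal δ := by
    rw [← ENNReal.ofReal_mul hC.le, mul_div_cancel₀ _ hC.ne']
  have hC0 : ENNReal.ofReal C ≠ 0 := (ENNReal.ofReal_pos.2 hC).ne'
  have hlt : ∀ {x : ℝ≥0∞}, x < ENNReal.ofReal (δ / C) → ENNReal.ofReal C * x < ENNReal.ofReal δ :=
    fun hx => hCδ ▸ (ENNReal.mul_lt_mul_iff_right hC0 ENNReal.ofReal_ne_top).2 hx
  have hUt1 : 1 < sobolevNorm s (U t) := by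
    refine (ENNReal.mul_lt_mul_iff_right hC0 ENNReal.ofReal_ne_top).1 (lt_of_lt_of_le ?_ hUt)
    rw [mul_one]
    exact (ENNReal.ofReal_le_ofReal ((le_inv_comm₀ hC hε).2 hεC)).trans_lt hlarge
  obtain ⟨f', g', hf', hg', u, v, huv, hu0, hv0, hut⟩ := hUV.exists_schwartz_data hk hκ hsmooth
    ht.le hsk (hU0.trans_lt (hlt hu₂)) (hV0.trans_lt (hlt hv₂)) hUt1
  obtain ⟨u', v', huv', hu0', hv0', hut', -⟩ := h1 f' g' hf' hg'
  have he := huv.unique hk hκ hsmooth ht.le (isSolution_iff.1 huv') (by rw [hu0, hu0'])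
    (by rw [hv0, hv0']) ⟨ht.le, le_rfl⟩
  rw [he] at hut
  rw [ENNReal.ofReal_one] at hut'
  exact lt_asymm hut hut'

end NonlinearBeam

end

theorem theorem5p1 (n : ℕ) (hn : 1 ≤ n) (κ : ℝ) (hκ : 1 < κ)
    (k : ℕ) (hk : (n : ℝ) / 2 < k)
    (hsmooth : (∃ m : ℕ, Odd m ∧ κ = m) ∨ (k : ℝ) + 2 ≤ κ)
    (s : ℝ) (hs : 0 < s) (hsc : s < (n : ℝ) / 2 - 4 / (κ - 1)) :
    (∀ ε : ℝ, 0 < ε → ∃ (u v : ℝ → NonlinearBeam.L2 n) (t : ℝ),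
      0 < t ∧ t < ε ∧
      NonlinearBeam.IsSolution (-1) κ ((k : ℝ) + 2) t u v ∧
      (∀ r ∈ Set.Icc 0 t, ∀ᵐ x, (u r x).im = 0) ∧
      (∃ f : 𝓢(NonlinearBeam.Space n, ℂ), u 0 = f.toLp 2) ∧
      NonlinearBeam.sobolevNorm s (u 0) < ENNReal.ofReal ε ∧
      v 0 = 0 ∧
      ENNReal.ofReal ε⁻¹ < NonlinearBeam.sobolevNorm s (u t)) ∧
    (∀ t : ℝ, 0 < t →
      ¬ NonlinearBeam.SolutionMapContinuousAtZero n (-1) κ ((k : ℝ) + 2) s t) := by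
  exact ⟨fun ε hε => NonlinearBeam.exists_norm_inflation hn hk hκ hsmooth hs hsc hε,
    fun t ht => NonlinearBeam.not_solutionMapContinuousAtZero hn hk hκ hsmooth hs hsc ht⟩
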